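/- Let $M$ be a (Hausdorff) complex manifold of dimension $n$ and let $N\subset M$ be a divisor with normal crossings: near each point $o$ there are local coordinates $(x_1,\dots,x_n)$ vanishing at $o$ in which $N$ is given by $\prod_{i\in I}x_i=0$ for some (possibly empty) $I\subset\{1,\dots,n\}$. Let $\pi:T^*\langle M/N\rangle\to M$ be the logarithmic cotangent bundle, i.e. the vector bundle whose sheaf of sections is the sheaf of logarithmic $1$-forms with poles along $N$; for coordinates as above it has coordinates $(x,\xi)$, and its canonical $1$-form is $\theta=\sum_{i\in I}\xi_i\,dx_i/x_i+\sum_{i\notin I}\xi_i\,dx_i$. Let $L\subset M$ be a trivial center of $(M,N)$: a closed submanifold such that near each $o\in L$ there are coordinates vanishing at $o$ and index sets $J\subset I$ with $|J|\ge 2$, $N=\{\prod_{i\in I}x_i=0\}$ and $L=\{x_i=0 \text{ for all } i\in J\}$. Let $\rho:\widetilde M\to M$ be the blow up of $M$ along $L$, put $\widetilde N=\rho^{-1}(N)$, let $\widetilde\pi:T^*\langle\widetilde M/\widetilde N\rangle\to\widetilde M$ be the projection and $\widetilde\theta$ the canonical $1$-form, and let $\tau:X\to T^*\langle M/N\rangle$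 be the blow up of $T^*\langle M/N\rangle$ along $\pi^{-1}(L)$. (i) $\widetilde N$ is a divisor with normal crossings of $\widetilde M$. The manifold $X$ is a logarithmic symplectic manifold with poles along $\tau^{-1}(\pi^{-1}(N))$ for the $2$-form $d(\tau^*\theta)$; that is, $\tau^*\theta$ is a logarithmic $1$-form and the $n$-th exterior power of $d(\tau^*\theta)$ generates the logarithmic $2n$-forms. There is a biholomorphic map $\Phi:X\to T^*\langle\widetilde M/\widetilde N\rangle$ with $\Phi^*\widetilde\theta=\tau^*\theta$ and $\rho\circ\widetilde\pi\circ\Phi=\pi\circ\tau$, and the map $\tau\circ\Phi^{-1}:T^*\langle\widetilde M/\widetilde N\rangle\to T^*\langle M/N\rangle$ commutes with the multiplication by scalars in the fibres. (ii) Let $S\subset M$ be a hypersurface (a nowhere dense subset which near every point of $M$ is the zero set of one holomorphic function) that is natural, i.e. at no point of $S$ is the germ of $S$ an intersection of irreducible components of the germ of $N$. The conormal of $S$ in $T^*\langle M/N\rangle$ is the closure of the conormal bundle of the regular part of $S\setminus N$, and the proper inverse image of a set under a blow up is the closure of the inverse image of its part outside the center. Then the proper inverse image $\widetilde S$ of $S$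 under $\rho$ is a natural hypersurface of $(\widetilde M,\widetilde N)$, and $\Phi$ maps the proper inverse image under $\tau$ of the conormal of $S$ onto the conormal of $\widetilde S$ in $T^*\langle\widetilde M/\widetilde N\rangle$. -/

import Mathlib

open Set Topology
open scoped Manifold ContDiff

set_option linter.unusedSectionVars false

noncomputable section

/-! ### Gluing open subsets of `ℂ^κ` over a base

A `PatchFamily` consists of open subsets `dom i` of `ℂ^κ`, each with a map `base i` to a set `B` and,
off a subset `center` of `B`, a second map `fib i` to a set `Y`, such that the pair is injective on the
dense part of `dom i` lying off the center.  Two points of two patches are identified when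
some biholomorphism between neighbourhoods of them respects these maps.  The result is a complex manifold
with a projection to `B`. -/

/-- Patches to be glued over a base `B`. -/
structure PatchFamily (κ : Type) [Fintype κ] (B Y : Type*) where
  ι : Type*
  dom : ι → Set (κ → ℂ)
  base : ι → (κ → ℂ) → B
  fib : ι → (κ → ℂ) → Y
  center : Set B
  isOpen_dom : ∀ i, IsOpen (dom i)
  dense : ∀ i, dom i ⊆ closure (dom i ∩ {y | base i y ∉ center})
  inj : ∀ i, InjOn (fun y => (base i y, fib i y)) (dom i ∩ {y | base i y ∉ center})

namespace PatchFamily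

variable {κ : Type} [Fintype κ] {B Y : Type*} (G : PatchFamily κ B Y)

/-- `φ` is a biholomorphism from an open subset of the `i`-th patch onto an open subset of the
`j`-th one which respects the maps to `B` and (off the center) to `Y`. -/
structure IsTransition (i j : G.ι) (φ : OpenPartialHomeomorph (κ → ℂ) (κ → ℂ)) : Prop where
  holomorphic : φ ∈ contDiffGroupoid ω 𝓘(ℂ, κ → ℂ)
  source_subset : φ.source ⊆ G.dom i
  target_subset : φ.target ⊆ G.dom j
  base_eq : ∀ z ∈ φ.source, G.base j (φ z) = G.base i z
  fib_eq : ∀ z ∈ φ.source, G.base i z ∉ G.center → G.fib j (φ z) = G.fib i z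

variable {G} in
theorem IsTransition.refl (i : G.ι) :
    G.IsTransition i i (OpenPartialHomeomorph.ofSet (G.dom i) (G.isOpen_dom i)) :=
  ⟨ofSet_mem_contDiffGroupoid _, by simp, by simp, by simp, by simp⟩

variable {G} in
theorem IsTransition.symm {i j : G.ι} {φ : OpenPartialHomeomorph (κ → ℂ) (κ → ℂ)}
    (h : G.IsTransition i j φ) : G.IsTransition j i φ.symm := by
  refine ⟨(contDiffGroupoid ω 𝓘(ℂ, κ → ℂ)).symm h.holomorphic, h.target_subset, h.source_subset,
    fun z hz => ?_, fun z hz hc => ?_⟩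
  · have := h.base_eq _ (φ.map_target hz)
    rw [φ.right_inv hz] at this
    exact this.symm
  · have h1 := h.base_eq _ (φ.map_target hz)
    rw [φ.right_inv hz] at h1
    have := h.fib_eq _ (φ.map_target hz) (by rwa [← h1])
    rw [φ.right_inv hz] at this
    exact this.symm

variable {G} in
theorem IsTransition.trans {i j k : G.ι} {φ ψ : OpenPartialHomeomorph (κ → ℂ) (κ → ℂ)}
    (h : G.IsTransition i j φ) (h' : G.IsTransition j k ψ) : G.IsTransition i k (φ.trans ψ) := by
  refine ⟨(contDiffGroupoid ω 𝓘(ℂ, κ → ℂ)).trans h.holomorphic h'.holomorphic, fun z hz => ?_,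
    fun z hz => ?_, fun z hz => ?_, fun z hz hc => ?_⟩
  · rw [OpenPartialHomeomorph.trans_source] at hz
    exact h.source_subset hz.1
  · rw [OpenPartialHomeomorph.trans_target] at hz
    exact h'.target_subset hz.1
  · rw [OpenPartialHomeomorph.trans_source] at hz
    exact (h'.base_eq _ hz.2).trans (h.base_eq _ hz.1)
  · rw [OpenPartialHomeomorph.trans_source] at hz
    exact (h'.fib_eq _ hz.2 (by rwa [h.base_eq _ hz.1])).trans (h.fib_eq _ hz.1 hc)

/-- A transition from a patch to itself is the identity. -/
theorem IsTransition.eq_self {i : G.ι} {φ : OpenPartialHomeomorph (κ → ℂ) (κ → ℂ)}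
    (h : G.IsTransition i i φ) {y : κ → ℂ} (hy : y ∈ φ.source) : φ y = y := by
  have hcl : y ∈ closure (φ.source ∩ (G.dom i ∩ {y | G.base i y ∉ G.center})) :=
    φ.open_source.inter_closure ⟨hy, G.dense i (h.source_subset hy)⟩
  have hne : (𝓝[φ.source ∩ (G.dom i ∩ {y | G.base i y ∉ G.center})] y).NeBot :=
    mem_closure_iff_nhdsWithin_neBot.1 hcl
  have hEq : EqOn φ id (φ.source ∩ (G.dom i ∩ {y | G.base i y ∉ G.center})) := by
    intro z hz
    have hb := h.base_eq z hz.1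
    have hf := h.fib_eq z hz.1 hz.2.2
    refine G.inj i ⟨h.target_subset (φ.map_source hz.1), ?_⟩ hz.2 ?_
    · change G.base i (φ z) ∉ G.center
      rw [hb]; exact hz.2.2
    · simp only [id, hb, hf]
  have h1 : Filter.Tendsto φ (𝓝[φ.source ∩ (G.dom i ∩ {y | G.base i y ∉ G.center})] y) (𝓝 (φ y)) :=
    (φ.continuousAt hy).tendsto.mono_left nhdsWithin_le_nhds
  have h2 : Filter.Tendsto φ (𝓝[φ.source ∩ (G.dom i ∩ {y | G.base i y ∉ G.center})] y) (𝓝 y) :=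
    (Filter.tendsto_id.mono_left nhdsWithin_le_nhds).congr'
      (Filter.eventuallyEq_of_mem self_mem_nhdsWithin fun z hz => (hEq hz).symm)
  exact tendsto_nhds_unique h1 h2

/-- The identification of points of the patches. -/
def setoid : Setoid (Σ i : G.ι, G.dom i) where
  r p q := ∃ φ, G.IsTransition p.1 q.1 φ ∧ (p.2 : κ → ℂ) ∈ φ.source ∧ φ p.2 = q.2
  iseqv :=
    { refl := fun p => ⟨_, IsTransition.refl p.1, p.2.2, rfl⟩
      symm := by
        rintro p q ⟨φ, h, hs, he⟩
        refine ⟨φ.symm, h.symm, ?_, ?_⟩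
        · rw [← he]; exact φ.map_source hs
        · rw [← he]; exact φ.left_inv hs
      trans := by
        rintro p q r ⟨φ, h, hs, he⟩ ⟨ψ, h', hs', he'⟩
        refine ⟨φ.trans ψ, h.trans h', ?_, ?_⟩
        · rw [OpenPartialHomeomorph.trans_source]
          exact ⟨hs, by rw [mem_preimage, he]; exact hs'⟩
        · rw [OpenPartialHomeomorph.trans_apply, he, he'] }

/-- The manifold obtained by gluing the patches. -/
def Glued : Type _ := Quotient G.setoid

namespace Glued

/-- The point of the glued manifold with coordinates `y` in the patch `i`. -/
def mk (i : G.ι) (y : G.dom i) : G.Glued := Quotient.mk G.setoid ⟨i, y⟩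

theorem mk_eq_mk {i j : G.ι} {y : G.dom i} {z : G.dom j} :
    mk G i y = mk G j z ↔ ∃ φ, G.IsTransition i j φ ∧ (y : κ → ℂ) ∈ φ.source ∧ φ y = z :=
  Quotient.eq (r := G.setoid)

theorem mk_injective (i : G.ι) : Function.Injective (mk G i) := by
  intro y z h
  obtain ⟨φ, hφ, hy, he⟩ := (mk_eq_mk G).1 h
  exact Subtype.ext ((hφ.eq_self G hy).symm.trans he)

theorem exists_mk (x : G.Glued) : ∃ i y, mk G i y = x := by
  induction x using Quotient.inductionOn with
  | h p => exact ⟨p.1, p.2, rfl⟩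

/-- The projection to the base. -/
def proj : G.Glued → B :=
  Quotient.lift (fun p => G.base p.1 p.2) fun p q h => by
    obtain ⟨φ, hφ, hp, he⟩ := h
    rw [← he, hφ.base_eq _ hp]

open Classical in
/-- The value in `Y` of a point off the center (and a default value on it). -/
def val [Inhabited Y] : G.Glued → Y :=
  Quotient.lift (fun p => if G.base p.1 p.2 ∈ G.center then default else G.fib p.1 p.2)
    fun p q h => by
      obtain ⟨φ, hφ, hp, he⟩ := h
      rw [← he, hφ.base_eq _ hp]
      split_ifs with hc
      · rfl
      · exact (hφ.fib_eq _ hp hc).symm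

open Classical in
/-- The coordinates of the patch `i`; the point `x₀` only serves as a default value. -/
def chart (i : G.ι) (x₀ : G.Glued) : PartialEquiv G.Glued (κ → ℂ) where
  toFun x := if h : ∃ y, mk G i y = x then (h.choose : κ → ℂ) else 0
  invFun y := if h : y ∈ G.dom i then mk G i ⟨y, h⟩ else x₀
  source := range (mk G i)
  target := G.dom i
  map_source' := by
    rintro x h
    have h' : ∃ y, mk G i y = x := h
    rw [dif_pos h']
    exact h'.choose.2
  map_target' y hy := by
    rw [dif_pos hy]
    exact mem_range_self _
  left_inv' := by
    rintro x h
    have h' : ∃ y, mk G i y = x := h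
    rw [dif_pos h', dif_pos h'.choose.2]
    exact h'.choose_spec
  right_inv' y hy := by
    have h' : ∃ z, mk G i z = mk G i ⟨y, hy⟩ := ⟨_, rfl⟩
    rw [dif_pos hy, dif_pos h']
    exact congrArg Subtype.val (mk_injective G i h'.choose_spec)

open Classical in
theorem chart_mk {i : G.ι} {x₀ : G.Glued} (y : G.dom i) : chart G i x₀ (mk G i y) = y := by
  have h : ∃ z, mk G i z = mk G i y := ⟨y, rfl⟩
  change (if h : ∃ z, mk G i z = mk G i y then (h.choose : κ → ℂ) else 0) = y
  rw [dif_pos h]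
  exact congrArg Subtype.val (mk_injective G i h.choose_spec)

theorem chart_symm {i : G.ι} {x₀ : G.Glued} {y : κ → ℂ} (hy : y ∈ G.dom i) :
    (chart G i x₀).symm y = mk G i ⟨y, hy⟩ :=
  dif_pos hy

/-- Coordinate changes are locally transitions. -/
theorem exists_transition {i j : G.ι} {x₀ x₁ : G.Glued} {y : κ → ℂ}
    (hy : y ∈ ((chart G i x₀).symm.trans (chart G j x₁)).source) :
    ∃ φ, G.IsTransition i j φ ∧ y ∈ φ.source ∧
      φ.source ⊆ ((chart G i x₀).symm.trans (chart G j x₁)).source ∧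
      EqOn ((chart G i x₀).symm.trans (chart G j x₁)) φ φ.source := by
  rw [PartialEquiv.trans_source] at hy
  have hyi : y ∈ G.dom i := hy.1
  obtain ⟨z, hz⟩ : (chart G i x₀).symm y ∈ range (mk G j) := hy.2
  rw [chart_symm G hyi] at hz
  obtain ⟨φ, hφ, hs, -⟩ := (mk_eq_mk G).1 hz.symm
  have key : ∀ w (hw : w ∈ φ.source), (chart G i x₀).symm w =
      mk G j ⟨φ w, hφ.target_subset (φ.map_source hw)⟩ := fun w hw => by
    rw [chart_symm G (hφ.source_subset hw)]
    exact (mk_eq_mk G).2 ⟨φ, hφ, hw, rfl⟩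
  refine ⟨φ, hφ, hs, fun w hw => ?_, fun w hw => ?_⟩
  · rw [PartialEquiv.trans_source]
    refine ⟨hφ.source_subset hw, ?_⟩
    rw [mem_preimage, key w hw]
    exact mem_range_self _
  · rw [PartialEquiv.coe_trans, Function.comp_apply, key w hw, chart_mk]

/-- The atlas given by the patches. -/
def core : ChartedSpaceCore (κ → ℂ) G.Glued where
  atlas := range fun p : G.ι × G.Glued => chart G p.1 p.2
  chartAt x := chart G (exists_mk G x).choose x
  mem_chart_source x := (exists_mk G x).choose_spec
  chart_mem_atlas x := ⟨(_, x), rfl⟩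
  open_source := by
    rintro _ _ ⟨⟨i, x₀⟩, rfl⟩ ⟨⟨j, x₁⟩, rfl⟩
    rw [isOpen_iff_mem_nhds]
    intro y hy
    obtain ⟨φ, -, hs, hsub, -⟩ := exists_transition G hy
    exact Filter.mem_of_superset (φ.open_source.mem_nhds hs) hsub
  continuousOn_toFun := by
    rintro _ _ ⟨⟨i, x₀⟩, rfl⟩ ⟨⟨j, x₁⟩, rfl⟩ y hy
    obtain ⟨φ, -, hs, -, heq⟩ := exists_transition G hy
    exact ((φ.continuousAt hs).congr
      (Filter.eventuallyEq_of_mem (φ.open_source.mem_nhds hs) heq.symm)).continuousWithinAt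

instance : TopologicalSpace G.Glued := (core G).toTopologicalSpace

instance : ChartedSpace (κ → ℂ) G.Glued := (core G).toChartedSpace

instance : IsManifold 𝓘(ℂ, κ → ℂ) ω G.Glued := by
  refine isManifold_of_contDiffOn _ _ _ ?_
  rintro e e' he he'
  obtain ⟨c, hc, rfl⟩ : ∃ c, ∃ hc : c ∈ (core G).atlas, (core G).openPartialHomeomorph c hc = e := by
    have he1 : e ∈ ⋃ (c : PartialEquiv _ _) (hc : c ∈ (core G).atlas),
      {(core G).openPartialHomeomorph c hc} := he
    simp only [mem_iUnion, mem_singleton_iff] at he1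
    obtain ⟨c, hc, h⟩ := he1
    exact ⟨c, hc, h.symm⟩
  obtain ⟨c', hc', rfl⟩ :
      ∃ c, ∃ hc : c ∈ (core G).atlas, (core G).openPartialHomeomorph c hc = e' := by
    have he1 : e' ∈ ⋃ (c : PartialEquiv _ _) (hc : c ∈ (core G).atlas),
      {(core G).openPartialHomeomorph c hc} := he'
    simp only [mem_iUnion, mem_singleton_iff] at he1
    obtain ⟨c, hc, h⟩ := he1
    exact ⟨c, hc, h.symm⟩
  obtain ⟨⟨i, x₀⟩, rfl⟩ := hc
  obtain ⟨⟨j, x₁⟩, rfl⟩ := hc'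
  rintro y ⟨hy, -⟩
  obtain ⟨φ, hφ, hs, -, heq⟩ := exists_transition G (i := i) (j := j) (x₀ := x₀) (x₁ := x₁) hy
  have h1 : ContDiffOn ℂ ω φ φ.source := by
    have h2 := hφ.holomorphic
    rw [contDiffGroupoid, mem_groupoid_of_pregroupoid] at h2
    simpa [contDiffPregroupoid] using h2.1
  exact ((h1.contDiffAt (φ.open_source.mem_nhds hs)).congr_of_eventuallyEq
    (Filter.eventuallyEq_of_mem (φ.open_source.mem_nhds hs) heq)).contDiffWithinAt

end Glued

end PatchFamily

section Manifolds

variable (κ : Type) [Fintype κ] {M : Type*} [TopologicalSpace M] [ChartedSpace (κ → ℂ) M]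

/-- A system of holomorphic local coordinates on an open subset of the complex manifold `M`. -/
def IsCoordinateChart (e : OpenPartialHomeomorph M (κ → ℂ)) : Prop :=
  e ∈ IsManifold.maximalAtlas 𝓘(ℂ, κ → ℂ) ω M

variable {κ}

/-- In the coordinates `e`, the set `N` is given by `∏_{i ∈ K} x_i = 0`. -/
def IsCoordinateDivisor (e : OpenPartialHomeomorph M (κ → ℂ)) (K : Finset κ) (N : Set M) : Prop :=
  ∀ x ∈ e.source, x ∈ N ↔ ∏ i ∈ K, e x i = 0

/-- In the coordinates `e`, the set `L` is given by `x_i = 0`, `i ∈ J`. -/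
def IsCoordinateSubspace (e : OpenPartialHomeomorph M (κ → ℂ)) (J : Finset κ) (L : Set M) : Prop :=
  ∀ x ∈ e.source, x ∈ L ↔ ∀ i ∈ J, e x i = 0

variable (κ)

/-- `N` is a divisor with normal crossings: near every point `o` there are coordinates vanishing
at `o` in which `N` is given by the product of some of the coordinates. -/
def IsNormalCrossings (N : Set M) : Prop :=
  ∀ o : M, ∃ e : OpenPartialHomeomorph M (κ → ℂ), ∃ K : Finset κ,
    IsCoordinateChart κ e ∧ o ∈ e.source ∧ e o = 0 ∧ IsCoordinateDivisor e K N

/-- `L` is a trivial center of `(M, N)`: a closed submanifold of codimension at least two which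
near each of its points is an intersection of local irreducible components of `N`. -/
def IsTrivialCenter (N L : Set M) : Prop :=
  IsClosed L ∧ ∀ o ∈ L, ∃ e : OpenPartialHomeomorph M (κ → ℂ), ∃ I J : Finset κ,
    IsCoordinateChart κ e ∧ o ∈ e.source ∧ e o = 0 ∧ IsCoordinateDivisor e I N ∧
      IsCoordinateSubspace e J L ∧ J ⊆ I ∧ 2 ≤ J.card

/-- `S` is a (closed analytic) hypersurface: nowhere dense and locally the zero set of one
holomorphic function. -/
def IsHypersurface (S : Set M) : Prop :=
  interior S = ∅ ∧ ∀ o : M, ∃ U : Set M, IsOpen U ∧ o ∈ U ∧ ∃ f : M → ℂ,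
    ContMDiffOn 𝓘(ℂ, κ → ℂ) 𝓘(ℂ, ℂ) ω f U ∧ ∀ x ∈ U, x ∈ S ↔ f x = 0

/-- `S` is natural with respect to `(M, N)`: at no point of `S` is the germ of `S` an intersection
of irreducible components `x_i = 0`, `i ∈ K`, of the germ of `N`. -/
def IsNatural (N S : Set M) : Prop :=
  ∀ o ∈ S, ¬ ∃ e : OpenPartialHomeomorph M (κ → ℂ), ∃ K I : Finset κ,
    IsCoordinateChart κ e ∧ o ∈ e.source ∧ e o = 0 ∧ IsCoordinateDivisor e K N ∧
      I ⊆ K ∧ I.Nonempty ∧ IsCoordinateSubspace e I S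

/-- The covector `α` at `x` is conormal to `S`: near `x ∈ S` the set `S` is a submanifold, and `α`
vanishes on the tangent space of `S` at `x`. -/
def IsConormalCovector (S : Set M) (x : M) (α : TangentSpace 𝓘(ℂ, κ → ℂ) x →L[ℂ] ℂ) : Prop :=
  x ∈ S ∧ ∃ e : OpenPartialHomeomorph M (κ → ℂ), ∃ J : Finset κ,
    IsCoordinateChart κ e ∧ x ∈ e.source ∧ IsCoordinateSubspace e J S ∧
      ∀ v : TangentSpace 𝓘(ℂ, κ → ℂ) x,
        (∀ i ∈ J, (mfderiv 𝓘(ℂ, κ → ℂ) 𝓘(ℂ, κ → ℂ) e x v : κ → ℂ) i = 0) → α v = 0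

variable {κ}

/-- The proper inverse image of `S` under the blow up `ρ` with center `L`. -/
def properInverseImage {M' : Type*} [TopologicalSpace M'] (ρ : M' → M) (L S : Set M) : Set M' :=
  closure (ρ ⁻¹' (S \ L))

open Classical in
/-- The denominator of the `i`-th member `dx_i / x_i` (for `i ∈ K`) or `dx_i` (for `i ∉ K`) of the
frame of logarithmic one-forms with poles along `∏_{i ∈ K} x_i = 0`, at the point `u`. -/
def logDenominator (K : Finset κ) (u : κ → ℂ) (i : κ) : ℂ := if i ∈ K then u i else 1

/-- The one-form `∑_{i ∈ K} a_i dx_i / x_i + ∑_{i ∉ K} a_i dx_i` at the point `x`, where `x_i` are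
the coordinates `e`. -/
def logCovector (e : OpenPartialHomeomorph M (κ → ℂ)) (K : Finset κ) (a : κ → ℂ) (x : M) :
    TangentSpace 𝓘(ℂ, κ → ℂ) x →L[ℂ] ℂ :=
  (∑ i, (a i / logDenominator K (e x) i) • (ContinuousLinearMap.proj i : (κ → ℂ) →L[ℂ] ℂ)).comp
    (mfderiv 𝓘(ℂ, κ → ℂ) 𝓘(ℂ, κ → ℂ) e x)

open Classical in
/-- The derivative of `f` along the `k`-th logarithmic vector field `x_k ∂/∂x_k` (for `k ∈ K`) or
`∂/∂x_k` (for `k ∉ K`). -/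
def frameDeriv (K : Finset κ) (k : κ) (f : (κ → ℂ) → ℂ) (u : κ → ℂ) : ℂ :=
  logDenominator K u k * fderiv ℂ f u (Pi.single k 1)

open Classical in
/-- The one-form `θ` on `M ∖ N` is the potential of a logarithmic symplectic form `σ = dθ` with poles
along the normal crossings divisor `N`.  Locally `θ = ∑_i a_i ω_i` with `a_i` holomorphic (also along
`N`) and `ω_i` the logarithmic coordinate frame; then `dθ = ∑_{k<l} (D_k a_l - D_l a_k) ω_k ∧ ω_l`,
with `D_k` the dual frame of logarithmic vector fields.  The top exterior power of `dθ` generates the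
logarithmic forms of top degree if and only if the matrix of `dθ` is everywhere invertible. -/
def IsLogSymplecticPotential (κ : Type) [Fintype κ] {M : Type*} [TopologicalSpace M]
    [ChartedSpace (κ → ℂ) M] (N : Set M)
    (θ : ∀ x : M, TangentSpace 𝓘(ℂ, κ → ℂ) x →L[ℂ] ℂ) : Prop :=
  IsNormalCrossings κ N ∧
  ∀ o : M, ∃ e : OpenPartialHomeomorph M (κ → ℂ), ∃ K : Finset κ, ∃ a : κ → (κ → ℂ) → ℂ,
    IsCoordinateChart κ e ∧ o ∈ e.source ∧ IsCoordinateDivisor e K N ∧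
    (∀ i, AnalyticOnNhd ℂ (a i) e.target) ∧
    (∀ x ∈ e.source, x ∉ N → θ x = logCovector e K (fun i => a i (e x)) x) ∧
    ∀ u ∈ e.target,
      (Matrix.of fun k l => frameDeriv K k (a l) u - frameDeriv K l (a k) u).det ≠ 0

end Manifolds

/-! ### Blow ups -/

section BlowUp

variable (κ : Type) [Fintype κ] {M : Type*} [TopologicalSpace M] [ChartedSpace (κ → ℂ) M]

theorem subset_closure_inter_ne_zero {V : Set (κ → ℂ)} (hV : IsOpen V) (K : Finset κ) :
    V ⊆ closure (V ∩ {y | ∀ i ∈ K, y i ≠ 0}) := by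
  intro y hy
  have hc : Filter.Tendsto (fun t : ℂ => fun i => y i + t) (𝓝[≠] 0) (𝓝 y) := by
    have : Continuous fun t : ℂ => fun i => y i + t := by fun_prop
    have h := (this.tendsto 0).mono_left (nhdsWithin_le_nhds (s := {0}ᶜ))
    simpa using h
  refine mem_closure_of_tendsto hc ((hc.eventually (hV.mem_nhds hy)).and ?_)
  refine (Filter.eventually_all_finset K).2 fun i _ => ?_
  by_cases hi : y i = 0
  · filter_upwards [self_mem_nhdsWithin] with t ht
    simpa [hi] using ht
  · have : ContinuousAt (fun t : ℂ => y i + t) 0 := by fun_prop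
    exact (this.eventually_ne (by simpa using hi)).filter_mono nhdsWithin_le_nhds

open Classical in
/-- The map `ℂ^κ → ℂ^κ` which multiplies the coordinates with index in `J`, other than the `j`-th one,
by the `j`-th one.  If `x` are the coordinates of the image and `j ∈ J`, the coordinates of the source
are `x_j`, the quotients `x_i / x_j` for `i ∈ J`, `i ≠ j`, and `x_i` for `i ∉ J`. -/
def blowDown (J : Finset κ) (j : κ) (y : κ → ℂ) : κ → ℂ :=
  fun i => if i ∈ J ∧ i ≠ j then y i * y j else y i

theorem continuous_blowDown (J : Finset κ) (j : κ) : Continuous (blowDown κ J j) := by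
  refine continuous_pi fun i => ?_
  unfold blowDown
  split_ifs <;> fun_prop

variable {κ} in
/-- The coordinate systems from which the blow up along `L` is glued: coordinates on an open set that
does not meet `L`, and, for coordinates in which `L` is given by `x_i = 0` for `i ∈ J`, the affine
patch belonging to an index `j ∈ J`. -/
inductive BlowUpPatch (L : Set M) : Type _
  | off (e : OpenPartialHomeomorph M (κ → ℂ)) (he : IsCoordinateChart κ e)
      (hL : Disjoint e.source L) : BlowUpPatch L
  | along (e : OpenPartialHomeomorph M (κ → ℂ)) (he : IsCoordinateChart κ e) (J : Finset κ)
      (hL : IsCoordinateSubspace e J L) (j : κ) (hj : j ∈ J) : BlowUpPatch L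

namespace BlowUpPatch

variable {κ} {L : Set M}

/-- The coordinates of `M` from which the patch is made. -/
def chart : BlowUpPatch (κ := κ) L → OpenPartialHomeomorph M (κ → ℂ)
  | off e _ _ => e
  | along e _ _ _ _ _ => e

/-- The projection from the patch to `M`, written in coordinates. -/
def toCoord : BlowUpPatch (κ := κ) L → (κ → ℂ) → (κ → ℂ)
  | off _ _ _ => id
  | along _ _ J _ j _ => blowDown κ J j

theorem continuous_toCoord (P : BlowUpPatch (κ := κ) L) : Continuous P.toCoord := by
  cases P with
  | off e he hL => exact continuous_id
  | along e he J hL j hj => exact continuous_blowDown κ J j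

theorem isOpen_dom (P : BlowUpPatch (κ := κ) L) : IsOpen (P.toCoord ⁻¹' P.chart.target) :=
  P.chart.open_target.preimage P.continuous_toCoord

theorem along_mem_iff {e : OpenPartialHomeomorph M (κ → ℂ)} {J : Finset κ}
    (hL : IsCoordinateSubspace e J L) {j : κ} (hj : j ∈ J) {y : κ → ℂ}
    (hy : blowDown κ J j y ∈ e.target) : e.symm (blowDown κ J j y) ∈ L ↔ y j = 0 := by
  rw [hL _ (e.map_target hy), e.right_inv hy]
  refine ⟨fun h => by simpa [blowDown] using h j hj, fun h i hi => ?_⟩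
  by_cases hij : i = j
  · simp [blowDown, hij, h]
  · simp [blowDown, hi, hij, h]

end BlowUpPatch

/-- The affine patches of the blow up of `M` along `L`, with their projections to `M`. -/
def blowUpPatches (L : Set M) : PatchFamily κ M Unit where
  ι := BlowUpPatch (κ := κ) L
  dom P := P.toCoord ⁻¹' P.chart.target
  base P y := P.chart.symm (P.toCoord y)
  fib _ _ := ()
  center := L
  isOpen_dom P := P.isOpen_dom
  dense P := by
    cases P with
    | off e he hL =>
      intro y hy
      exact subset_closure ⟨hy, fun h => hL.le_bot ⟨e.map_target hy, h⟩⟩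
    | along e he J hL j hj =>
      refine (subset_closure_inter_ne_zero κ (BlowUpPatch.isOpen_dom (.along e he J hL j hj))
        {j}).trans (closure_mono ?_)
      rintro y ⟨hy, hne⟩
      exact ⟨hy, fun h => hne j (by simp) ((BlowUpPatch.along_mem_iff hL hj hy).1 h)⟩
  inj P := by
    cases P with
    | off e he hL =>
      rintro y ⟨hy, -⟩ z ⟨hz, -⟩ h
      exact e.symm.injOn hy hz (congrArg Prod.fst h)
    | along e he J hL j hj =>
      rintro y ⟨hy, hyL⟩ z ⟨hz, -⟩ h
      have hb : blowDown κ J j y = blowDown κ J j z := e.symm.injOn hy hz (congrArg Prod.fst h)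
      have hyj : y j ≠ 0 := fun h0 => hyL ((BlowUpPatch.along_mem_iff hL hj hy).2 h0)
      have hj' : y j = z j := by simpa [blowDown] using congrFun hb j
      funext i
      have hi := congrFun hb i
      by_cases hc : i ∈ J ∧ i ≠ j
      · simp only [blowDown, if_pos hc, ← hj'] at hi
        exact mul_right_cancel₀ hyj hi
      · simpa only [blowDown, if_neg hc] using hi

/-- The blow up of the complex manifold `M` along the closed submanifold `L`. -/
abbrev BlowUp (L : Set M) : Type _ := (blowUpPatches κ L).Glued

/-- The projection of the blow up of `M` along `L` to `M`. -/
def BlowUp.proj (L : Set M) : BlowUp κ L → M := PatchFamily.Glued.proj (blowUpPatches κ L)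

end BlowUp

/-! ### The logarithmic cotangent bundle -/

section LogCotangent

variable (κ : Type) [Fintype κ] {M : Type*} [TopologicalSpace M] [ChartedSpace (κ → ℂ) M]

variable {κ} in
/-- Coordinates in which `N` is given by the product of some of the coordinates. -/
structure LogChart (N : Set M) where
  chart : OpenPartialHomeomorph M (κ → ℂ)
  poles : Finset κ
  isChart : IsCoordinateChart κ chart
  divisor : IsCoordinateDivisor chart poles N

variable {κ} in
theorem logCovector_injective [IsManifold 𝓘(ℂ, κ → ℂ) ω M] {e : OpenPartialHomeomorph M (κ → ℂ)}
    (he : IsCoordinateChart κ e) {K : Finset κ} {x : M} (hx : x ∈ e.source)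
    (h0 : ∏ i ∈ K, e x i ≠ 0) : Function.Injective fun a : κ → ℂ => logCovector e K a x := by
  classical
  intro a b hab
  have hM1 : IsManifold 𝓘(ℂ, κ → ℂ) 1 M := IsManifold.of_le (n := ω) le_top
  have hd : e.MDifferentiable 𝓘(ℂ, κ → ℂ) 𝓘(ℂ, κ → ℂ) :=
    ⟨(contMDiffOn_of_mem_maximalAtlas he).mdifferentiableOn (by simp),
      (contMDiffOn_symm_of_mem_maximalAtlas he).mdifferentiableOn (by simp)⟩
  funext i
  obtain ⟨v, hv⟩ := hd.mfderiv_surjective hx (Pi.single i (1 : ℂ) : κ → ℂ)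
  have h1 := congrArg (fun α => α v) hab
  have hden : logDenominator K (e x) i ≠ 0 := by
    unfold logDenominator
    split_ifs with hi
    · exact Finset.prod_ne_zero_iff.1 h0 i hi
    · exact one_ne_zero
  have key : ∀ c : κ → ℂ, logCovector e K c x v = c i / logDenominator K (e x) i := by
    intro c
    have : logCovector e K c x v = (∑ k, (c k / logDenominator K (e x) k) •
        (ContinuousLinearMap.proj k : (κ → ℂ) →L[ℂ] ℂ)) (Pi.single i (1 : ℂ) : κ → ℂ) := by
      rw [← hv]; rfl
    rw [this]
    simp [Pi.single_apply]
  simp only [key] at h1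
  exact (div_left_inj' hden).1 h1

variable {κ} in
theorem LogChart.inj [IsManifold 𝓘(ℂ, κ → ℂ) ω M] {N : Set M} (c : LogChart (κ := κ) N)
    {u u' ξ ξ' : κ → ℂ} (hu : u ∈ c.chart.target) (hu' : u' ∈ c.chart.target)
    (hN : c.chart.symm u ∉ N) (h1 : c.chart.symm u = c.chart.symm u')
    (h2 : (logCovector c.chart c.poles ξ (c.chart.symm u) : (κ → ℂ) →L[ℂ] ℂ) =
      logCovector c.chart c.poles ξ' (c.chart.symm u')) : u = u' ∧ ξ = ξ' := by
  obtain rfl : u = u' := c.chart.symm.injOn hu hu' h1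
  have hx := c.chart.map_target hu
  exact ⟨rfl, logCovector_injective c.isChart hx (fun h0 => hN ((c.divisor _ hx).2 h0)) h2⟩

/-- The patches of the logarithmic cotangent bundle of `(M, N)`.  To coordinates `x` in which `N` is
given by `∏_{i ∈ K} x_i = 0` belongs the patch with coordinates `(x, ξ)`; off `N` its point `(x, ξ)` is
the covector `∑_{i ∈ K} ξ_i dx_i / x_i + ∑_{i ∉ K} ξ_i dx_i` at the point `x` of `M`. -/
def logCotangentPatches [IsManifold 𝓘(ℂ, κ → ℂ) ω M] (N : Set M) :
    PatchFamily (κ ⊕ κ) M ((κ → ℂ) →L[ℂ] ℂ) where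
  ι := LogChart (κ := κ) N
  dom c := {y | y ∘ Sum.inl ∈ c.chart.target}
  base c y := c.chart.symm (y ∘ Sum.inl)
  fib c y := logCovector c.chart c.poles (y ∘ Sum.inr) (c.chart.symm (y ∘ Sum.inl))
  center := N
  isOpen_dom c := c.chart.open_target.preimage (by fun_prop)
  dense c := by
    classical
    refine (subset_closure_inter_ne_zero (κ ⊕ κ)
      (c.chart.open_target.preimage (f := fun y : κ ⊕ κ → ℂ => y ∘ Sum.inl) (by fun_prop))
      (c.poles.image Sum.inl)).trans (closure_mono ?_)
    rintro y ⟨hy, hne⟩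
    refine ⟨hy, fun h => ?_⟩
    rw [c.divisor _ (c.chart.map_target hy), c.chart.right_inv hy, Finset.prod_eq_zero_iff] at h
    obtain ⟨i, hi, h⟩ := h
    exact hne (Sum.inl i) (Finset.mem_image_of_mem _ hi) h
  inj c := by
    rintro y ⟨hy, hyN⟩ z ⟨hz, -⟩ h
    obtain ⟨hu, hξ⟩ := c.inj hy hz hyN (Prod.mk.inj h).1 (Prod.mk.inj h).2
    funext k
    cases k with
    | inl i => exact congrFun hu i
    | inr i => exact congrFun hξ i

/-- The logarithmic cotangent bundle `T*⟨M/N⟩` of `M` along the normal crossings divisor `N`. -/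
abbrev LogCotangent [IsManifold 𝓘(ℂ, κ → ℂ) ω M] (N : Set M) : Type _ :=
  (logCotangentPatches κ N).Glued

namespace LogCotangent

variable [IsManifold 𝓘(ℂ, κ → ℂ) ω M] (N : Set M)

/-- The projection `T*⟨M/N⟩ → M`. -/
def proj : LogCotangent κ N → M := PatchFamily.Glued.proj (logCotangentPatches κ N)

/-- Off `N`, the points of `T*⟨M/N⟩` are the covectors of `M`. -/
def covector (p : LogCotangent κ N) : TangentSpace 𝓘(ℂ, κ → ℂ) (proj κ N p) →L[ℂ] ℂ :=
  PatchFamily.Glued.val (logCotangentPatches κ N) p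

/-- The canonical one-form of `T*⟨M/N⟩`, off its poles. -/
def canonicalForm (p : LogCotangent κ N) :
    TangentSpace 𝓘(ℂ, κ ⊕ κ → ℂ) p →L[ℂ] ℂ :=
  (covector κ N p).comp (mfderiv 𝓘(ℂ, κ ⊕ κ → ℂ) 𝓘(ℂ, κ → ℂ) (proj κ N) p)

/-- `q` is the multiple `t p` in the fibre of the vector bundle `T*⟨M/N⟩` that contains `p`. -/
def IsMultiple (t : ℂ) (p q : LogCotangent κ N) : Prop :=
  ∃ (c : LogChart (κ := κ) N) (y z : (logCotangentPatches κ N).dom c),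
    p = PatchFamily.Glued.mk (logCotangentPatches κ N) c y ∧
    q = PatchFamily.Glued.mk (logCotangentPatches κ N) c z ∧
    (∀ i, z.1 (Sum.inl i) = y.1 (Sum.inl i)) ∧ ∀ i, z.1 (Sum.inr i) = t * y.1 (Sum.inr i)

/-- The conormal of `S` relative to `N`, for a set `S` none of whose components lies in `N`: the
closure in `T*⟨M/N⟩` of the conormal bundle of the regular part of `S ∖ N`. -/
def conormal (S : Set M) : Set (LogCotangent κ N) :=
  closure {p | proj κ N p ∉ N ∧ IsConormalCovector κ S (proj κ N p) (covector κ N p)}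

end LogCotangent

end LogCotangent

/-- The pull back of a one-form. -/
def pullbackForm (κ κ' : Type) [Fintype κ] [Fintype κ'] {X X' : Type*} [TopologicalSpace X]
    [ChartedSpace (κ → ℂ) X] [TopologicalSpace X'] [ChartedSpace (κ' → ℂ) X'] (f : X' → X)
    (θ : ∀ x : X, TangentSpace 𝓘(ℂ, κ → ℂ) x →L[ℂ] ℂ) (x : X') :
    TangentSpace 𝓘(ℂ, κ' → ℂ) x →L[ℂ] ℂ :=
  (θ (f x)).comp (mfderiv 𝓘(ℂ, κ' → ℂ) 𝓘(ℂ, κ → ℂ) f x)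

end

noncomputable section

/-! ### Division of holomorphic functions by a coordinate -/

section Division

variable {E : Type*} [NormedAddCommGroup E] [NormedSpace ℂ E]

/-! The heart is one identity between logarithmic forms. In the affine patch of the blow up
belonging to `j ∈ J` one has `x_i = y_i y_j` for `i ∈ J`, `i ≠ j`, and `x_i = y_i` otherwise. Since
`J ⊆ I`, all these coordinates are poles, and `dx_i/x_i = dy_i/y_i + dy_j/y_j`. Hence `∑ ξ_i ω_i`,
written in the logarithmic frame of the `y`, has coefficients `η_j = ξ_j + ∑_{l ∈ J, l ≠ j} ξ_l` and
`η_i = ξ_i` for `i ≠ j` (`AdaptedPatch.sum_logFrame`). The center of the blow up `τ` is given by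
base coordinates only, so `(y, ξ)` are coordinates of `X`, and `(y, ξ) ↦ (y, η)` is a biholomorphic
map to a patch of the logarithmic cotangent bundle of the blow up. It is linear in the fibres and
respects the canonical forms.

These local isomorphisms are glued without computing on overlaps. Off `N`, which contains `L`, a
point on either side amounts to a covector at a point of `M`, and `IsCorresponding` says that one
covector is the pull back of the other by the derivative of `ρ`. On a dense set the relation
determines each partner by the other, so in Hausdorff spaces the local maps agree
(`exists_diffeomorph_of_relation`). The symplectic property is then transported from the bundle of
the blow up, where the matrix of the differential of the canonical form is the standard one.

The blow up and the bundle are glued from all admissible coordinate systems, so the adapted patches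
must be shown to cover and the glued spaces to be Hausdorff. Both rest on dividing holomorphic
functions by a coordinate. For the blow up, coordinates vanishing on `L` are divisible by the
equation of the exceptional divisor, and not all quotients vanish at a point
(`IsExceptionalQuotient.exists_ne_zero`). For the bundle, logarithmic vector fields preserve the
ideals of the components of `N`, so the transition matrices are holomorphic along `N`
(`LogChart.exists_logDerivative_eq_mul`).

For a hypersurface, the pulled back equation is a power of `y_j` times a function not vanishing
identically on `y_j = 0`. The zeros of this second factor are the proper inverse image
(`AnalyticAt.exists_zero_iff_mem_closure`). Naturality and conormals are compared off the center,
where the blow ups are local isomorphisms, and the conormals are then recovered by closure. -/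

theorem ContinuousMultilinearMap.map_diag_sub_map_diag {m : ℕ}
    (f : ContinuousMultilinearMap ℂ (fun _ : Fin (m + 1) => E) ℂ) (x w v : E) (t : ℂ)
    (h : x - w = t • v) :
    f (fun _ => x) - f (fun _ => w) =
      t * ∑ k : Fin (m + 1), f (fun i => if i < k then w else if i = k then v else x) := by
  -- The difference telescopes: replace the arguments `x` by `w` one at a time. The `k`-th step
  -- changes only slot `k`, by `x - w = t • v`.
  set T : ℕ → ℂ := fun k => f (fun i => if (i : ℕ) < k then w else x) with hT
  have h0 : T 0 = f (fun _ => x) := by simp [hT]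
  have h1 : T (m + 1) = f (fun _ => w) := by
    simp only [hT]
    congr 1
    funext i
    simp [i.2]
  rw [← h0, ← h1, ← Finset.sum_range_sub', Finset.mul_sum, Finset.sum_range]
  refine Finset.sum_congr rfl fun k _ => ?_
  have e1 : (fun i : Fin (m + 1) => if (i : ℕ) < k then w else x) =
      Function.update (fun i : Fin (m + 1) => if (i : ℕ) < k then w else x) k x := by
    funext i
    by_cases hi : i = k <;> simp [hi]
  have e2 : (fun i : Fin (m + 1) => if (i : ℕ) < k + 1 then w else x) =
      Function.update (fun i : Fin (m + 1) => if (i : ℕ) < k then w else x) k w := by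
    funext i
    by_cases hi : i = k
    · simp [hi]
    · have : (i : ℕ) ≠ k := fun h => hi (Fin.ext h)
      have h' : (i : ℕ) < k + 1 ↔ (i : ℕ) < k := by omega
      simp [hi, h']
  have e3 : (fun i : Fin (m + 1) => if i < k then w else if i = k then v else x) =
      Function.update (fun i : Fin (m + 1) => if (i : ℕ) < k then w else x) k v := by
    funext i
    by_cases hi : i = k
    · simp [hi]
    · simp [hi]
  simp only [hT]
  rw [e1, e2, e3, ← f.map_update_sub, h, f.map_update_smul, smul_eq_mul]

/-- If `P` is a linear map and `x - P x = ℓ(x) v` then `f(x) - f(P x)` is divisible by `ℓ`. -/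
theorem AnalyticAt.exists_sub_eq_mul {f : E → ℂ} (hf : AnalyticAt ℂ f 0) (P : E →L[ℂ] E)
    (ℓ : E → ℂ) (v : E) (hP : ∀ x, x - P x = ℓ x • v) :
    ∃ g : E → ℂ, AnalyticAt ℂ g 0 ∧ ∀ᶠ x in 𝓝 0, f x - f (P x) = ℓ x * g x := by
  obtain ⟨p, r, hp⟩ := hf
  obtain ⟨C, a, hC, ha, hpa⟩ := p.le_mul_pow_of_radius_pos (hp.r_pos.trans_le hp.r_le)
  -- A common bound for the norms of `P` and of the identity.
  set D : ℝ := ‖P‖ + 1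
  have hD : 1 ≤ D := by simp [D]
  -- The quotient series, read off from the telescoping identity for `p (m + 1)`: slot `k` receives
  -- `v`, the slots before it `P x`, those after it `x`.
  let q : FormalMultilinearSeries ℂ E ℂ := fun m =>
    ∑ k : Fin (m + 1), ((p (m + 1)).compContinuousLinearMap
      (fun i => if i = k then ContinuousLinearMap.id ℂ E else if i < k then P else
        ContinuousLinearMap.id ℂ E)).curryMid k v
  have hqn : ∀ m, ‖q m‖ ≤ (m + 1 : ℕ) * (C * a ^ (m + 1) * D ^ (m + 1) * ‖v‖) := by
    intro m
    refine (norm_sum_le _ _).trans ?_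
    have : ∀ k ∈ (Finset.univ : Finset (Fin (m + 1))), ‖((p (m + 1)).compContinuousLinearMap
      (fun i => if i = k then ContinuousLinearMap.id ℂ E else if i < k then P else
        ContinuousLinearMap.id ℂ E)).curryMid k v‖ ≤ C * a ^ (m + 1) * D ^ (m + 1) * ‖v‖ := by
      intro k _
      refine (ContinuousLinearMap.le_opNorm _ _).trans ?_
      gcongr
      rw [ContinuousMultilinearMap.norm_curryMid]
      refine (ContinuousMultilinearMap.norm_compContinuousLinearMap_le _ _).trans ?_
      gcongr
      · exact hpa _
      · refine (Finset.prod_le_prod (fun _ _ => norm_nonneg _) (g := fun _ => D) ?_).trans ?_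
        · intro i _
          have hid : ‖ContinuousLinearMap.id ℂ E‖ ≤ D := ContinuousLinearMap.norm_id_le.trans hD
          split_ifs
          · exact hid
          · simp [D]
          · exact hid
        · simp
    refine (Finset.sum_le_card_nsmul _ _ _ this).trans ?_
    simp
  have hrad : 0 < q.radius := by
    -- The factor `2` absorbs the number `m + 1 ≤ 2 ^ m` of summands of `q m`.
    set s : ℝ := 1 / (2 * a * D)
    have hs : 0 < s := by positivity
    have : ((Real.toNNReal s : NNReal) : ENNReal) ≤ q.radius := by
      refine q.le_radius_of_bound (C * a * D * ‖v‖) fun m => ?_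
      rw [Real.coe_toNNReal s hs.le]
      have h2 : ((m + 1 : ℕ) : ℝ) ≤ 2 ^ m := by exact_mod_cast Nat.lt_two_pow_self
      have h3 : (2 : ℝ) ^ m * a ^ m * D ^ m * s ^ m = 1 := by
        rw [← mul_pow, ← mul_pow, ← mul_pow]
        have : 2 * a * D * s = 1 := by simp only [s]; field_simp
        rw [this, one_pow]
      calc ‖q m‖ * s ^ m ≤ ((m + 1 : ℕ) * (C * a ^ (m + 1) * D ^ (m + 1) * ‖v‖)) * s ^ m := by
            gcongr; exact hqn m
        _ ≤ (2 ^ m * (C * a ^ (m + 1) * D ^ (m + 1) * ‖v‖)) * s ^ m := by gcongr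
        _ = (2 ^ m * a ^ m * D ^ m * s ^ m) * (C * a * D * ‖v‖) := by ring
        _ = C * a * D * ‖v‖ := by rw [h3, one_mul]
    exact lt_of_lt_of_le (by simpa using hs) this
  have hq := q.hasFPowerSeriesOnBall hrad
  refine ⟨q.sum, hq.analyticAt, ?_⟩
  have hb1 : ∀ᶠ x in 𝓝 (0 : E), x ∈ Metric.eball (0 : E) r := Metric.eball_mem_nhds _ hp.r_pos
  have hb2 : ∀ᶠ x in 𝓝 (0 : E), P x ∈ Metric.eball (0 : E) r :=
    P.continuous.continuousAt.eventually (by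
      rw [map_zero]; exact Metric.eball_mem_nhds (0 : E) hp.r_pos)
  have hb3 : ∀ᶠ x in 𝓝 (0 : E), x ∈ Metric.eball (0 : E) q.radius :=
    Metric.eball_mem_nhds _ hrad
  filter_upwards [hb1, hb2, hb3] with x h1 h2 h3
  have s1 := (hp.hasSum h1).sub (hp.hasSum h2)
  simp only [zero_add] at s1
  have s2 := (hq.hasSum h3).mul_left (ℓ x)
  simp only [zero_add] at s2
  have s3 : HasSum (fun n => (p (n + 1) fun _ => x) - (p (n + 1) fun _ => P x)) (f x - f (P x)) := by
    refine (hasSum_nat_add_iff (f := fun n => (p n fun _ => x) - (p n fun _ => P x)) 1).2 ?_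
    have : (p 0 fun _ => x) = (p 0 fun _ => P x) := by
      congr 1; funext i; exact i.elim0
    simpa [this] using s1
  have hterm : (fun n => (p (n + 1) fun _ => x) - (p (n + 1) fun _ => P x)) =
      fun n => ℓ x * (q n fun _ => x) := by
    funext m
    rw [(p (m + 1)).map_diag_sub_map_diag x (P x) v (ℓ x) (hP x)]
    congr 1
    simp only [q, sum_apply, ContinuousMultilinearMap.curryMid_apply,
      ContinuousMultilinearMap.compContinuousLinearMap_apply]
    refine Finset.sum_congr rfl fun k _ => ?_
    congr 1
    funext i
    by_cases hi : i = k
    · subst hi; simp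
    · obtain ⟨i', rfl⟩ := Fin.exists_succAbove_eq hi
      by_cases hlt : k.succAbove i' < k <;> simp [hi, hlt]
  rw [hterm] at s3
  exact s3.unique s2

variable {κ : Type} [Fintype κ]

/-- A holomorphic function which vanishes on the hyperplane `x_i = 0` is divisible by `x_i`. -/
theorem AnalyticAt.exists_eq_coord_mul {f : (κ → ℂ) → ℂ} {a : κ → ℂ} (hf : AnalyticAt ℂ f a)
    {i : κ} (hi : a i = 0) (h0 : ∀ᶠ x in 𝓝 a, x i = 0 → f x = 0) :
    ∃ g : (κ → ℂ) → ℂ, AnalyticAt ℂ g a ∧ ∀ᶠ x in 𝓝 a, f x = x i * g x := by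
  classical
  -- The projection to the hyperplane `x_i = 0`. The function vanishes there, so its difference with
  -- the composition with `P` is the function itself.
  let P : (κ → ℂ) →L[ℂ] (κ → ℂ) := ContinuousLinearMap.id ℂ _ -
    (ContinuousLinearMap.proj i : (κ → ℂ) →L[ℂ] ℂ).smulRight (Pi.single i (1 : ℂ))
  have hsub : AnalyticAt ℂ (fun x : κ → ℂ => x - a) a := by fun_prop
  have hf' : AnalyticAt ℂ (fun x => f (x + a)) 0 := by
    refine AnalyticAt.fun_comp (g := f) (f := fun x => x + a) (by simpa using hf) (by fun_prop)
  obtain ⟨g, hg, hE⟩ := hf'.exists_sub_eq_mul P (fun x => x i) (Pi.single i 1)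
    (fun x => by simp [P])
  have htend : Filter.Tendsto (fun x : κ → ℂ => x - a) (𝓝 a) (𝓝 0) := by
    simpa using hsub.continuousAt.tendsto
  refine ⟨fun x => g (x - a), AnalyticAt.fun_comp (by simpa using hg) hsub, ?_⟩
  have htP : Filter.Tendsto (fun x : κ → ℂ => P (x - a) + a) (𝓝 a) (𝓝 a) := by
    have : Continuous fun x : κ → ℂ => P (x - a) + a := by fun_prop
    simpa using this.tendsto a
  filter_upwards [htend.eventually hE, htP.eventually h0] with x h1 h2
  have h3 : f (P (x - a) + a) = 0 := h2 (by simp [P, hi])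
  simp only [h3, sub_add_cancel, sub_zero, Pi.sub_apply, hi] at h1
  exact h1

/-- If the zeros of a holomorphic function near one of its zeros `z` lie in the hyperplane `x_j = 0`,
then they fill the hyperplane. -/
theorem AnalyticAt.eventually_eq_zero_of_coord_eq_zero {h : (κ → ℂ) → ℂ} {z : κ → ℂ}
    (hh : AnalyticAt ℂ h z) {j : κ} (hj : z j = 0) (hz : h z = 0)
    (h0 : ∀ᶠ x in 𝓝 z, h x = 0 → x j = 0) : ∀ᶠ x in 𝓝 z, x j = 0 → h x = 0 := by
  classical
  obtain ⟨r, hr, hball⟩ := Metric.nhds_basis_closedBall.eventually_iff.1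
    (hh.eventually_analyticAt.and h0)
  have hupd : ∀ t : ℂ, ‖t‖ ≤ r → ∀ x ∈ Metric.closedBall z r,
      Function.update x j t ∈ Metric.closedBall z r := by
    intro t ht x hx
    rw [Metric.mem_closedBall, dist_pi_le_iff hr.le] at hx ⊢
    intro i
    by_cases hi : i = j
    · subst hi; simpa [hj] using ht
    · simpa [hi] using hx i
  have hcont : ∀ x ∈ Metric.closedBall z r, ∀ t : ℂ, ‖t‖ ≤ r →
      ContinuousAt (fun p : (κ → ℂ) × ℂ => h (Function.update p.1 j p.2)) (x, t) := by
    intro x hx t ht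
    refine ContinuousAt.comp' (f := fun p : (κ → ℂ) × ℂ => Function.update p.1 j p.2) ?_ ?_
    · exact (hball (hupd t ht x hx)).1.continuousAt
    · exact (continuous_fst.update j continuous_snd).continuousAt
  have hzb : z ∈ Metric.closedBall z r := Metric.mem_closedBall_self hr.le
  obtain ⟨t₀, ht₀, hmin⟩ := (isCompact_sphere (0 : ℂ) r).exists_isMinOn
    (NormedSpace.sphere_nonempty.2 hr.le) (f := fun t => ‖h (Function.update z j t)‖) (by
      intro t ht
      have := (hcont z hzb t (by simpa using ht.le)).comp'
        (f := fun t : ℂ => (z, t)) (by fun_prop)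
      exact this.norm.continuousWithinAt)
  -- The minimum of `|h|` on the circle `|t| = r` in the line through `z` parallel to the
  -- `x_j`-axis. It is positive because zeros of `h` have `x_j = 0`.
  set ε := ‖h (Function.update z j t₀)‖ with hε
  have hεpos : 0 < ε := by
    rw [hε, norm_pos_iff]
    intro hzero
    have := (hball (hupd t₀ (by simpa using ht₀.le) z hzb)).2 hzero
    rw [Function.update_self] at this
    rw [this] at ht₀
    simp [hr.ne] at ht₀
  have ev1 : ∀ᶠ x in 𝓝 z, ∀ t ∈ Metric.sphere (0 : ℂ) r, ε / 2 < ‖h (Function.update x j t)‖ := by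
    refine (isCompact_sphere (0 : ℂ) r).eventually_forall_of_forall_eventually fun t ht => ?_
    have := (hcont z hzb t (by simpa using ht.le)).norm
    refine this.eventually (lt_mem_nhds ?_)
    exact (half_lt_self hεpos).trans_le (hmin ht)
  have ev2 : ∀ᶠ x in 𝓝 z, ‖h x‖ < ε / 2 :=
    hh.continuousAt.norm.eventually (gt_mem_nhds (by simpa [hz] using hεpos))
  filter_upwards [ev1, ev2, Metric.closedBall_mem_nhds z hr] with x h1 h2 h3 hxj
  by_contra hne
  -- If `h x ≠ 0`, there is no zero on the whole disc through `x`, since a zero could only lie at `t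
  -- = 0`. So `1/h` is holomorphic there; it is at most `2/ε` on the circle and larger at the
  -- centre, against the maximum principle.
  have hsx : ∀ t : ℂ, ‖t‖ ≤ r → h (Function.update x j t) ≠ 0 := by
    intro t ht hzero
    have := (hball (hupd t ht x h3)).2 hzero
    rw [Function.update_self] at this
    subst this
    rw [← hxj, Function.update_eq_self] at hzero
    exact hne (hzero.trans hxj)
  have hd : DifferentiableOn ℂ (fun t => (h (Function.update x j t))⁻¹)
      (Metric.closedBall (0 : ℂ) r) := by
    intro t ht
    have ht' : ‖t‖ ≤ r := by simpa using ht
    refine DifferentiableAt.differentiableWithinAt (DifferentiableAt.fun_inv ?_ (hsx t ht'))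
    refine DifferentiableAt.comp t (g := h) (f := fun t => Function.update x j t)
      (hball (hupd t ht' x h3)).1.differentiableAt ?_
    exact (hasDerivAt_update x j t).differentiableAt
  have hdc : DiffContOnCl ℂ (fun t => (h (Function.update x j t))⁻¹) (Metric.ball (0 : ℂ) r) :=
    DifferentiableOn.diffContOnCl (hd.mono Metric.closure_ball_subset_closedBall)
  have hmax := Complex.norm_le_of_forall_mem_frontier_norm_le (z := 0) (C := (ε / 2)⁻¹)
    Metric.isBounded_ball hdc ?_ (subset_closure (Metric.mem_ball_self hr))
  · rw [← hxj, Function.update_eq_self, norm_inv] at hmax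
    have := (inv_le_inv₀ (norm_pos_iff.2 hne) (by positivity)).1 hmax
    linarith
  · intro t ht
    rw [frontier_ball _ hr.ne'] at ht
    rw [norm_inv]
    exact (inv_le_inv₀ (by linarith [h1 t ht]) (by positivity)).2 (h1 t ht).le

/-- Otherwise the identity theorem on each line makes `F` vanish in a ball off the hyperplane `x_j =
y_j`, hence everywhere in it by continuity. The condition `v j ≠ 0` ensures that, when `y_j = 0`,
the power `x_j ^ m` restricts to a nonzero multiple of `t ^ m`, so the order of `F` on the line
bounds the exponent of `x_j`. -/
theorem AnalyticAt.exists_line_ne_zero {F : (κ → ℂ) → ℂ} {y : κ → ℂ} (hF : AnalyticAt ℂ F y)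
    (j : κ) (hne : ¬ ∀ᶠ x in 𝓝 y, F x = 0) :
    ∃ v : κ → ℂ, v j ≠ 0 ∧ ¬ ∀ᶠ t in 𝓝 (0 : ℂ), F (y + t • v) = 0 := by
  by_contra! H
  refine hne ?_
  obtain ⟨r, hr, hball⟩ := Metric.nhds_basis_ball.eventually_iff.1 hF.eventually_analyticAt
  have key : ∀ p ∈ Metric.ball y r, p j ≠ y j → F p = 0 := by
    intro p hp hpj
    have hH := H (p - y) (by simpa [sub_eq_zero] using hpj)
    have hcont : Continuous fun t : ℂ => y + t • (p - y) := by fun_prop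
    have hconv : Convex ℝ {t : ℂ | y + t • (p - y) ∈ Metric.ball y r} := by
      intro s hs t ht a b ha hb hab
      have := (convex_ball y r) hs ht ha hb hab
      simp only [mem_ofPred_eq]
      convert this using 1
      have hab' : (a : ℂ) + b = 1 := by exact_mod_cast hab
      funext i
      simp only [Pi.add_apply, Pi.smul_apply, Pi.sub_apply, Complex.real_smul, smul_eq_mul]
      linear_combination (-y i) * hab'
    have han : AnalyticOnNhd ℂ (fun t : ℂ => F (y + t • (p - y)))
        {t : ℂ | y + t • (p - y) ∈ Metric.ball y r} := by
      intro t ht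
      exact AnalyticAt.fun_comp (g := F) (hball ht) (by fun_prop)
    have := han.eqOn_zero_of_preconnected_of_eventuallyEq_zero hconv.isPreconnected (z₀ := 0)
      (by simpa using hr) hH (x := 1) (by simpa [dist_eq_norm] using hp)
    simpa using this
  filter_upwards [Metric.ball_mem_nhds y hr] with x hx
  by_cases hxj : x j = y j
  · have hx' : x - y ∈ closure ((fun w => w + y) ⁻¹' Metric.ball y r ∩ {w | ∀ i ∈ ({j} : Finset κ), w i ≠ 0}) :=
      subset_closure_inter_ne_zero κ
        (Metric.isOpen_ball.preimage (f := fun w => w + y) (by fun_prop)) {j}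
        (by simpa [dist_eq_norm] using hx)
    have hFx : ContinuousAt (fun w => F (w + y)) (x - y) := by
      refine ContinuousAt.comp' (g := F) ?_ (by fun_prop)
      simpa using (hball hx).continuousAt
    have hm := hFx.continuousWithinAt.mem_closure_image hx'
    have : (fun w => F (w + y)) '' ((fun w => w + y) ⁻¹' Metric.ball y r ∩ {w | ∀ i ∈ ({j} : Finset κ), w i ≠ 0}) ⊆ {0} := by
      rintro _ ⟨w, ⟨hw, hwj⟩, rfl⟩
      exact key _ hw (by simpa using hwj j (by simp))
    have := closure_mono this hm
    simpa using this
  · exact key x hx hxj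

/-- A nonzero germ of a holomorphic function is a power of the coordinate `x_j` times a function that
does not vanish identically on `x_j = 0`. -/
theorem AnalyticAt.exists_eq_coord_pow_mul {F : (κ → ℂ) → ℂ} {y : κ → ℂ} (hF : AnalyticAt ℂ F y)
    {j : κ} (hj : y j = 0) (hne : ¬ ∀ᶠ x in 𝓝 y, F x = 0) :
    ∃ (m : ℕ) (h : (κ → ℂ) → ℂ), AnalyticAt ℂ h y ∧ (∀ᶠ x in 𝓝 y, F x = x j ^ m * h x) ∧
      ¬ ∀ᶠ x in 𝓝 y, x j = 0 → h x = 0 := by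
  classical
  obtain ⟨v, hv, hline⟩ := hF.exists_line_ne_zero j hne
  have htend : Filter.Tendsto (fun t : ℂ => y + t • v) (𝓝 0) (𝓝 y) := by
    have : Continuous fun t : ℂ => y + t • v := by fun_prop
    simpa using this.tendsto 0
  have hs : AnalyticAt ℂ (fun t : ℂ => F (y + t • v)) 0 :=
    AnalyticAt.fun_comp (g := F) (by simpa using hF) (by fun_prop)
  obtain ⟨M, g, hg, hg0, hgE⟩ := hs.exists_eventuallyEq_pow_smul_nonzero_iff.2 hline
  -- The admissible exponents of `x_j`. They are bounded by the order `M` of `F` along the chosen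
  -- line, and for the greatest one the cofactor cannot vanish on `x_j = 0`, since it could be
  -- divided once more.
  let A : ℕ → Prop := fun m => ∃ h : (κ → ℂ) → ℂ, AnalyticAt ℂ h y ∧ ∀ᶠ x in 𝓝 y, F x = x j ^ m * h x
  have hA0 : A 0 := ⟨F, hF, by simp⟩
  have hAM : ∀ m, A m → m ≤ M := by
    rintro m ⟨h, hh, hE⟩
    by_contra! hlt
    have hE' := htend.eventually hE
    have h1 : ∀ᶠ t in 𝓝[≠] (0 : ℂ), g t = t ^ (m - M) * (v j ^ m * h (y + t • v)) := by
      filter_upwards [hE'.filter_mono nhdsWithin_le_nhds, hgE.filter_mono nhdsWithin_le_nhds,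
        self_mem_nhdsWithin] with t h1 h2 h3
      have ht : t ≠ 0 := h3
      rw [h1] at h2
      simp only [Pi.add_apply, hj, Pi.smul_apply, smul_eq_mul, zero_add, sub_zero, mul_pow] at h2
      have hpow : t ^ m = t ^ M * t ^ (m - M) := by rw [← pow_add]; congr 1; omega
      rw [hpow] at h2
      have := pow_ne_zero M ht
      apply mul_left_cancel₀ this
      rw [← h2]; ring
    have hc1 : Filter.Tendsto g (𝓝[≠] 0) (𝓝 (g 0)) := hg.continuousAt.tendsto.mono_left nhdsWithin_le_nhds
    have hc2 : Filter.Tendsto (fun t : ℂ => t ^ (m - M) * (v j ^ m * h (y + t • v))) (𝓝[≠] 0) (𝓝 0) := by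
      have : ContinuousAt (fun t : ℂ => t ^ (m - M) * (v j ^ m * h (y + t • v))) 0 := by
        have h5 : ContinuousAt (fun t : ℂ => h (y + t • v)) 0 :=
          ContinuousAt.comp' (g := h) (by simpa using hh.continuousAt) (by fun_prop)
        exact (by fun_prop : ContinuousAt (fun t : ℂ => t ^ (m - M)) 0).mul
          (continuousAt_const.mul h5)
      have h6 := this.tendsto.mono_left (nhdsWithin_le_nhds (s := {0}ᶜ))
      simpa [show m - M ≠ 0 by omega] using h6
    exact hg0 (tendsto_nhds_unique (hc1.congr' h1) hc2)
  have hmax := Nat.findGreatest_spec (P := A) (Nat.zero_le M) hA0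
  obtain ⟨h, hh, hE⟩ := hmax
  refine ⟨_, h, hh, hE, fun hzero => ?_⟩
  obtain ⟨g', hg', hE'⟩ := hh.exists_eq_coord_mul hj hzero
  have hsucc : A (Nat.findGreatest A M + 1) := by
    refine ⟨g', hg', ?_⟩
    filter_upwards [hE, hE'] with x h1 h2
    rw [h1, h2]; ring
  have := Nat.le_findGreatest (hAM _ hsucc) hsucc
  omega

/-- The closure of the part of a hypersurface off a coordinate hyperplane is a hypersurface. -/
theorem AnalyticAt.exists_zero_iff_mem_closure {F : (κ → ℂ) → ℂ} {y : κ → ℂ}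
    (hF : AnalyticAt ℂ F y) {j : κ} (hj : y j = 0) (hne : ¬ ∀ᶠ x in 𝓝 y, F x = 0)
    {W : Set (κ → ℂ)} (hW : W ∈ 𝓝 y) :
    ∃ (V : Set (κ → ℂ)) (h : (κ → ℂ) → ℂ), IsOpen V ∧ y ∈ V ∧ V ⊆ W ∧ AnalyticOnNhd ℂ h V ∧
      ∀ x ∈ V, h x = 0 ↔ x ∈ closure {w | w ∈ V ∧ w j ≠ 0 ∧ F w = 0} := by
  classical
  obtain ⟨m, h, hh, hE, hnz⟩ := hF.exists_eq_coord_pow_mul hj hne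
  obtain ⟨r, hr, hball⟩ := Metric.nhds_basis_ball.eventually_iff.1
    ((hh.eventually_analyticAt.and hE).and hW)
  refine ⟨Metric.ball y r, h, Metric.isOpen_ball, Metric.mem_ball_self hr, fun x hx => (hball hx).2,
    fun x hx => (hball hx).1.1, fun x hx => ⟨fun hx0 => ?_, fun hxc => ?_⟩⟩
  · by_cases hxj : x j = 0
    · by_contra hcl
      -- If `x` were not in the closure, all zeros of `h` near `x` would lie in the hyperplane and
      -- so fill it. The identity theorem for `h` restricted to the hyperplane carries this from `x`
      -- to `y`, where it is excluded.
      have hnear : ∀ᶠ w in 𝓝 x, h w = 0 → w j = 0 := by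
        filter_upwards [Metric.isOpen_ball.mem_nhds hx, isClosed_closure.isOpen_compl.mem_nhds hcl]
          with w hw hwc hw0
        by_contra hwj
        exact hwc (subset_closure ⟨hw, hwj, by rw [(hball hw).1.2, hw0, mul_zero]⟩)
      have hz := (hball hx).1.1.eventually_eq_zero_of_coord_eq_zero hxj hx0 hnear
      have hP : ∀ w ∈ Metric.ball y r, Function.update w j 0 ∈ Metric.ball y r := by
        intro w hw
        rw [Metric.mem_ball, dist_pi_lt_iff hr] at hw ⊢
        intro i
        by_cases hi : i = j
        · subst hi; simpa [hj] using hr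
        · simpa [hi] using hw i
      have hPa : ∀ w : κ → ℂ, AnalyticAt ℂ (fun w : κ → ℂ => Function.update w j 0) w := by
        intro w
        rw [analyticAt_pi_iff]
        intro i
        by_cases hi : i = j
        · subst hi; simpa using analyticAt_const
        · simp only [Function.update_of_ne hi]
          exact (ContinuousLinearMap.proj i : (κ → ℂ) →L[ℂ] ℂ).analyticAt w
      have han : AnalyticOnNhd ℂ (fun w => h (Function.update w j 0)) (Metric.ball y r) :=
        fun w hw => AnalyticAt.fun_comp (g := h) (hball (hP w hw)).1.1 (hPa w)
      have hxu : Function.update x j 0 = x := by rw [← hxj, Function.update_eq_self]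
      have hev : (fun w => h (Function.update w j 0)) =ᶠ[𝓝 x] 0 := by
        have ht : Filter.Tendsto (fun w : κ → ℂ => Function.update w j 0) (𝓝 x) (𝓝 x) := by
          have := (hPa x).continuousAt.tendsto
          rwa [hxu] at this
        filter_upwards [ht.eventually hz] with w hw
        exact hw (by simp)
      have := han.eqOn_zero_of_preconnected_of_eventuallyEq_zero
        (convex_ball y r).isPreconnected hx hev
      refine hnz ?_
      filter_upwards [Metric.ball_mem_nhds y hr] with w hw hwj
      have h2 := this hw
      have hwu : Function.update w j 0 = w := by rw [← hwj, Function.update_eq_self]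
      simpa [hwu] using h2
    · refine subset_closure ⟨hx, hxj, ?_⟩
      rw [(hball hx).1.2, hx0, mul_zero]
  · have hm := (hball hx).1.1.continuousAt.continuousWithinAt.mem_closure_image hxc
    have : h '' {w | w ∈ Metric.ball y r ∧ w j ≠ 0 ∧ F w = 0} ⊆ {0} := by
      rintro _ ⟨w, ⟨hw, hwj, hw0⟩, rfl⟩
      rw [(hball hw).1.2] at hw0
      exact (mul_eq_zero.1 hw0).resolve_left (pow_ne_zero _ hwj)
    simpa using closure_mono this hm

end Division

end

noncomputable section

/-! ### Coordinates of glued manifolds -/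

theorem mem_contDiffGroupoid_of_contDiffOn {E : Type*} [NormedAddCommGroup E] [NormedSpace ℂ E]
    {φ : OpenPartialHomeomorph E E} (h : ContDiffOn ℂ ω φ φ.source)
    (h' : ContDiffOn ℂ ω φ.symm φ.target) : φ ∈ contDiffGroupoid ω 𝓘(ℂ, E) := by
  rw [contDiffGroupoid, mem_groupoid_of_pregroupoid]
  simpa [contDiffPregroupoid] using And.intro h h'

namespace PatchFamily

variable {κ : Type} [Fintype κ] {B Y : Type*} (G : PatchFamily κ B Y)

/-- A continuous map from a patch to itself which respects the maps to `B` and `Y` is the identity. -/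
theorem eventually_eq_self {i : G.ι} {y : κ → ℂ} (hy : y ∈ G.dom i) {H : (κ → ℂ) → (κ → ℂ)}
    (hH : ∀ᶠ w in 𝓝 y, ContinuousAt H w)
    (hb : ∀ᶠ w in 𝓝 y, H w ∈ G.dom i ∧ G.base i (H w) = G.base i w ∧
      (G.base i w ∉ G.center → G.fib i (H w) = G.fib i w)) : ∀ᶠ w in 𝓝 y, H w = w := by
  obtain ⟨U, hU, hUo, hyU⟩ := eventually_nhds_iff.1
    ((hH.and hb).and ((G.isOpen_dom i).mem_nhds hy))
  filter_upwards [hUo.mem_nhds hyU] with w hw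
  have hcl : w ∈ closure (U ∩ (G.dom i ∩ {y | G.base i y ∉ G.center})) :=
    hUo.inter_closure ⟨hw, G.dense i (hU w hw).2⟩
  have hne := mem_closure_iff_nhdsWithin_neBot.1 hcl
  have hEq : EqOn H id (U ∩ (G.dom i ∩ {y | G.base i y ∉ G.center})) := by
    intro z hz
    obtain ⟨⟨-, h1, h2, h3⟩, h4⟩ := hU z hz.1
    refine G.inj i ⟨h1, ?_⟩ hz.2 ?_
    · change G.base i (H z) ∉ G.center
      rw [h2]; exact hz.2.2
    · simp only [id, h2, h3 hz.2.2]
  have h1 : Filter.Tendsto H (𝓝[U ∩ (G.dom i ∩ {y | G.base i y ∉ G.center})] w) (𝓝 (H w)) :=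
    (hU w hw).1.1.tendsto.mono_left nhdsWithin_le_nhds
  have h2 : Filter.Tendsto H (𝓝[U ∩ (G.dom i ∩ {y | G.base i y ∉ G.center})] w) (𝓝 w) :=
    (Filter.tendsto_id.mono_left nhdsWithin_le_nhds).congr'
      (Filter.eventuallyEq_of_mem self_mem_nhdsWithin fun z hz => (hEq hz).symm)
  exact tendsto_nhds_unique h1 h2

namespace Glued

/-- Two points of two patches are identified when there are holomorphic maps in both directions
which respect the maps to `B` and `Y`. -/
theorem mk_eq_mk_of_analyticAt {i j : G.ι} {y : κ → ℂ} (hy : y ∈ G.dom i)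
    {F F' : (κ → ℂ) → (κ → ℂ)} (hF : AnalyticAt ℂ F y) (hz : F y ∈ G.dom j)
    (hF' : AnalyticAt ℂ F' (F y)) (hy' : F' (F y) ∈ G.dom i)
    (hb : ∀ᶠ w in 𝓝 y, G.base j (F w) = G.base i w ∧
      (G.base i w ∉ G.center → G.fib j (F w) = G.fib i w))
    (hb' : ∀ᶠ w in 𝓝 (F y), G.base i (F' w) = G.base j w ∧
      (G.base j w ∉ G.center → G.fib i (F' w) = G.fib j w)) :
    mk G i ⟨y, hy⟩ = mk G j ⟨F y, hz⟩ := by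
  have hFd : ∀ᶠ w in 𝓝 y, F w ∈ G.dom j := hF.continuousAt.eventually ((G.isOpen_dom j).mem_nhds hz)
  have hFd' : ∀ᶠ w in 𝓝 (F y), F' w ∈ G.dom i :=
    hF'.continuousAt.eventually ((G.isOpen_dom i).mem_nhds hy')
  -- Both compositions respect the maps to `B` and `Y`, which separate points on a dense part of a
  -- patch. So they are the identity, and `F`, `F'` are inverse to each other on suitable
  -- neighbourhoods.
  have hid : ∀ᶠ w in 𝓝 y, F' (F w) = w := by
    refine G.eventually_eq_self (i := i) (H := fun w => F' (F w)) hy ?_ ?_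
    · filter_upwards [hF.eventually_analyticAt,
        hF.continuousAt.eventually hF'.eventually_analyticAt] with w h1 h2
      exact ContinuousAt.comp' h2.continuousAt h1.continuousAt
    · filter_upwards [hb, hF.continuousAt.eventually hb', hF.continuousAt.eventually hFd']
        with w h1 h2 h3
      exact ⟨h3, h2.1.trans h1.1, fun hc => (h2.2 (by rwa [h1.1])).trans (h1.2 hc)⟩
  have hyy : F' (F y) = y := hid.self_of_nhds
  have hFy : Filter.Tendsto F' (𝓝 (F y)) (𝓝 y) := by
    have := hF'.continuousAt.tendsto
    rwa [hyy] at this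
  have hid' : ∀ᶠ w in 𝓝 (F y), F (F' w) = w := by
    refine G.eventually_eq_self (i := j) (H := fun w => F (F' w)) hz ?_ ?_
    · filter_upwards [hF'.eventually_analyticAt, hFy.eventually hF.eventually_analyticAt] with w h1 h2
      exact ContinuousAt.comp' h2.continuousAt h1.continuousAt
    · filter_upwards [hb', hFy.eventually hb, hFy.eventually hFd] with w h1 h2 h3
      exact ⟨h3, h2.1.trans h1.1, fun hc => (h2.2 (by rwa [h1.1])).trans (h1.2 hc)⟩
  obtain ⟨U, hU, hUo, hyU⟩ := eventually_nhds_iff.1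
    (((hF.eventually_analyticAt.and hb).and hid).and ((G.isOpen_dom i).mem_nhds hy))
  obtain ⟨V, hV, hVo, hyV⟩ := eventually_nhds_iff.1
    ((hF'.eventually_analyticAt.and hid').and ((G.isOpen_dom j).mem_nhds hz))
  have hFc : ContinuousOn F U := fun w hw => (hU w hw).1.1.1.continuousAt.continuousWithinAt
  have hFc' : ContinuousOn F' V := fun w hw => (hV w hw).1.1.continuousAt.continuousWithinAt
  let φ : OpenPartialHomeomorph (κ → ℂ) (κ → ℂ) :=
    { toFun := F
      invFun := F'
      source := U ∩ F ⁻¹' V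
      target := V ∩ F' ⁻¹' U
      map_source' := fun w hw => ⟨hw.2, by
        rw [mem_preimage, (hU w hw.1).1.2]; exact hw.1⟩
      map_target' := fun w hw => ⟨hw.2, by
        rw [mem_preimage, (hV w hw.1).1.2]; exact hw.1⟩
      left_inv' := fun w hw => (hU w hw.1).1.2
      right_inv' := fun w hw => (hV w hw.1).1.2
      open_source := hFc.isOpen_inter_preimage hUo hVo
      open_target := hFc'.isOpen_inter_preimage hVo hUo
      continuousOn_toFun := hFc.mono inter_subset_left
      continuousOn_invFun := hFc'.mono inter_subset_left }
  refine (mk_eq_mk G).2 ⟨φ, ⟨mem_contDiffGroupoid_of_contDiffOn ?_ ?_, fun w hw => (hU w hw.1).2,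
    fun w hw => (hV w hw.1).2, fun w hw => (hU w hw.1).1.1.2.1,
    fun w hw => (hU w hw.1).1.1.2.2⟩, ⟨hyU, hyV⟩, rfl⟩
  · exact fun w hw => (hU w hw.1).1.1.1.contDiffAt.contDiffWithinAt
  · exact fun w hw => (hV w hw.1).1.1.contDiffAt.contDiffWithinAt

/-- The coordinates of the patch `i`, as a chart of the glued manifold. -/
def patchChart (i : G.ι) (x₀ : G.Glued) : OpenPartialHomeomorph G.Glued (κ → ℂ) :=
  (core G).openPartialHomeomorph (chart G i x₀) ⟨(i, x₀), rfl⟩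

variable {i : G.ι} {x₀ : G.Glued}

@[simp] theorem patchChart_mk (y : G.dom i) : patchChart G i x₀ (mk G i y) = y := chart_mk G y

theorem patchChart_symm {y : κ → ℂ} (hy : y ∈ G.dom i) :
    (patchChart G i x₀).symm y = mk G i ⟨y, hy⟩ := chart_symm G hy

theorem mk_mem_patchChart_source (y : G.dom i) : mk G i y ∈ (patchChart G i x₀).source :=
  mem_range_self y

theorem isCoordinateChart_patchChart : IsCoordinateChart κ (patchChart G i x₀) := by
  refine IsManifold.subset_maximalAtlas (I := 𝓘(ℂ, κ → ℂ)) (n := ω) ?_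
  change patchChart G i x₀ ∈ ⋃ (c : PartialEquiv _ _) (hc : c ∈ (core G).atlas),
      {(core G).openPartialHomeomorph c hc}
  simp only [mem_iUnion, mem_singleton_iff]
  exact ⟨chart G i x₀, ⟨(i, x₀), rfl⟩, rfl⟩

theorem tendsto_patchChart (y : G.dom i) :
    Filter.Tendsto (patchChart G i x₀) (𝓝 (mk G i y)) (𝓝 (y : κ → ℂ)) := by
  have := (patchChart G i x₀).continuousAt (mk_mem_patchChart_source G y)
  rwa [ContinuousAt, patchChart_mk] at this

@[simp] theorem proj_mk (y : G.dom i) : proj G (mk G i y) = G.base i y := rfl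

theorem val_mk [Inhabited Y] (y : G.dom i) (h : G.base i y ∉ G.center) :
    val G (mk G i y) = G.fib i y := if_neg h

theorem eventually_proj_eq (y : G.dom i) :
    ∀ᶠ x in 𝓝 (mk G i y), proj G x = G.base i (patchChart G i x₀ x) := by
  filter_upwards [(patchChart G i x₀).open_source.mem_nhds (mk_mem_patchChart_source G y)]
  rintro _ ⟨z, rfl⟩
  rw [patchChart_mk, proj_mk]

/-- The points off the center are dense. -/
theorem dense_proj_notMem_center : Dense {x : G.Glued | proj G x ∉ G.center} := by
  intro x
  obtain ⟨i, y, rfl⟩ := exists_mk G x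
  have hc : ContinuousAt (patchChart G i (mk G i y)).symm y :=
    (patchChart G i (mk G i y)).continuousAt_symm y.2
  have := hc.continuousWithinAt.mem_closure_image (G.dense i y.2)
  rw [patchChart_symm G y.2] at this
  refine closure_mono ?_ this
  rintro _ ⟨w, ⟨hw, hwc⟩, rfl⟩
  rw [patchChart_symm G hw]
  exact hwc

end Glued

end PatchFamily

end

noncomputable section

/-! ### Local biholomorphisms and coordinates -/

section Biholomorphism

variable {κ : Type} [Fintype κ]
  {X : Type*} [TopologicalSpace X] [ChartedSpace (κ → ℂ) X]
  {X' : Type*} [TopologicalSpace X'] [ChartedSpace (κ → ℂ) X']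

variable (κ) in
/-- `φ` is a biholomorphism between open subsets of two complex manifolds. -/
def IsBiholomorphic (φ : OpenPartialHomeomorph X X') : Prop :=
  ContMDiffOn 𝓘(ℂ, κ → ℂ) 𝓘(ℂ, κ → ℂ) ω φ φ.source ∧
    ContMDiffOn 𝓘(ℂ, κ → ℂ) 𝓘(ℂ, κ → ℂ) ω φ.symm φ.target

namespace IsBiholomorphic

variable {φ : OpenPartialHomeomorph X X'}

theorem symm (h : IsBiholomorphic κ φ) : IsBiholomorphic κ φ.symm := ⟨h.2, h.1⟩

theorem trans {X'' : Type*} [TopologicalSpace X''] [ChartedSpace (κ → ℂ) X'']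
    {ψ : OpenPartialHomeomorph X' X''} (h : IsBiholomorphic κ φ) (h' : IsBiholomorphic κ ψ) :
    IsBiholomorphic κ (φ.trans ψ) := by
  constructor
  · rw [OpenPartialHomeomorph.trans_source]
    exact h'.1.comp (h.1.mono inter_subset_left) inter_subset_right
  · rw [OpenPartialHomeomorph.trans_target]
    exact h.2.comp (h'.2.mono inter_subset_left) inter_subset_right

theorem restrOpen (h : IsBiholomorphic κ φ) {s : Set X} (hs : IsOpen s) :
    IsBiholomorphic κ (φ.restrOpen s hs) :=
  ⟨h.1.mono inter_subset_left, h.2.mono inter_subset_left⟩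

theorem of_diffeomorph (Φ : X ≃ₘ^ω⟮𝓘(ℂ, κ → ℂ), 𝓘(ℂ, κ → ℂ)⟯ X') :
    IsBiholomorphic κ Φ.toHomeomorph.toOpenPartialHomeomorph :=
  ⟨Φ.contMDiff.contMDiffOn, Φ.symm.contMDiff.contMDiffOn⟩

theorem mdifferentiableAt (h : IsBiholomorphic κ φ) {x : X} (hx : x ∈ φ.source) :
    MDifferentiableAt 𝓘(ℂ, κ → ℂ) 𝓘(ℂ, κ → ℂ) φ x :=
  (h.1.contMDiffAt (φ.open_source.mem_nhds hx)).mdifferentiableAt (by simp)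

end IsBiholomorphic

theorem isCoordinateChart_iff [IsManifold 𝓘(ℂ, κ → ℂ) ω X]
    {e : OpenPartialHomeomorph X (κ → ℂ)} : IsCoordinateChart κ e ↔ IsBiholomorphic κ e :=
  IsManifold.mem_maximalAtlas_iff_contMDiffOn e

section Charts

variable [IsManifold 𝓘(ℂ, κ → ℂ) ω X] [IsManifold 𝓘(ℂ, κ → ℂ) ω X']
  {φ : OpenPartialHomeomorph X X'}

theorem IsBiholomorphic.isCoordinateChart_trans (h : IsBiholomorphic κ φ)
    {e : OpenPartialHomeomorph X' (κ → ℂ)} (he : IsCoordinateChart κ e) :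
    IsCoordinateChart κ (φ.trans e) :=
  isCoordinateChart_iff.2 (h.trans (isCoordinateChart_iff.1 he))

theorem IsBiholomorphic.mfderiv_trans (h : IsBiholomorphic κ φ)
    {e : OpenPartialHomeomorph X' (κ → ℂ)} (he : IsCoordinateChart κ e) {x : X}
    (hx : x ∈ φ.source) (hx' : φ x ∈ e.source) :
    mfderiv 𝓘(ℂ, κ → ℂ) 𝓘(ℂ, κ → ℂ) (φ.trans e) x =
      (mfderiv 𝓘(ℂ, κ → ℂ) 𝓘(ℂ, κ → ℂ) e (φ x)).comp
        (mfderiv 𝓘(ℂ, κ → ℂ) 𝓘(ℂ, κ → ℂ) φ x) := by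
  rw [OpenPartialHomeomorph.coe_trans]
  exact mfderiv_comp x ((isCoordinateChart_iff.1 he).mdifferentiableAt hx') (h.mdifferentiableAt hx)

theorem IsBiholomorphic.mfderiv_symm_comp (h : IsBiholomorphic κ φ) {x : X} (hx : x ∈ φ.source) :
    (mfderiv 𝓘(ℂ, κ → ℂ) 𝓘(ℂ, κ → ℂ) φ x).comp
      (mfderiv 𝓘(ℂ, κ → ℂ) 𝓘(ℂ, κ → ℂ) φ.symm (φ x)) = ContinuousLinearMap.id ℂ _ := by
  have h1 := h.symm.mdifferentiableAt (φ.map_source hx)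
  have h2 : MDifferentiableAt 𝓘(ℂ, κ → ℂ) 𝓘(ℂ, κ → ℂ) φ (φ.symm (φ x)) :=
    h.mdifferentiableAt (by rwa [φ.left_inv hx])
  have h3 := mfderiv_comp (φ x) h2 h1
  have h4 : mfderiv 𝓘(ℂ, κ → ℂ) 𝓘(ℂ, κ → ℂ) (φ ∘ φ.symm) (φ x) =
      mfderiv 𝓘(ℂ, κ → ℂ) 𝓘(ℂ, κ → ℂ) id (φ x) := by
    refine Filter.EventuallyEq.mfderiv_eq ?_
    filter_upwards [φ.open_target.mem_nhds (φ.map_source hx)] with z hz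
    exact φ.right_inv hz
  rw [h4, mfderiv_id, φ.left_inv hx] at h3
  exact h3.symm

theorem IsBiholomorphic.logCovector_trans (h : IsBiholomorphic κ φ)
    {e : OpenPartialHomeomorph X' (κ → ℂ)} (he : IsCoordinateChart κ e) {x : X}
    (hx : x ∈ φ.source) (hx' : φ x ∈ e.source) (K : Finset κ) (a : κ → ℂ) :
    logCovector (φ.trans e) K a x = (logCovector e K a (φ x)).comp
        (mfderiv 𝓘(ℂ, κ → ℂ) 𝓘(ℂ, κ → ℂ) φ x) := by
  unfold logCovector
  rw [h.mfderiv_trans he hx hx']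
  rfl

theorem IsBiholomorphic.isConormalCovector_comp (h : IsBiholomorphic κ φ) {x : X}
    (hx : x ∈ φ.source) {S : Set X} {S' : Set X'} (hS : ∀ z ∈ φ.source, z ∈ S ↔ φ z ∈ S')
    {β : TangentSpace 𝓘(ℂ, κ → ℂ) (φ x) →L[ℂ] ℂ} (hβ : IsConormalCovector κ S' (φ x) β) :
    IsConormalCovector κ S x (β.comp (mfderiv 𝓘(ℂ, κ → ℂ) 𝓘(ℂ, κ → ℂ) φ x)) := by
  obtain ⟨h1, e, J, he, hxe, hJ, hk⟩ := hβ
  refine ⟨(hS x hx).2 h1, φ.trans e, J, h.isCoordinateChart_trans he, ⟨hx, hxe⟩, ?_, ?_⟩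
  · rintro z ⟨hz, hz'⟩
    rw [hS z hz]
    exact hJ _ hz'
  · intro v hv
    refine hk _ fun i hi => ?_
    have := hv i hi
    rw [h.mfderiv_trans he hx hxe] at this
    exact this

/-- The converse direction is the direct one for `φ.symm`, as the derivatives of `φ` and its inverse
cancel. -/
theorem IsBiholomorphic.isConormalCovector_comp_iff (h : IsBiholomorphic κ φ) {x : X}
    (hx : x ∈ φ.source) {S : Set X} {S' : Set X'} (hS : ∀ z ∈ φ.source, z ∈ S ↔ φ z ∈ S')
    {β : TangentSpace 𝓘(ℂ, κ → ℂ) (φ x) →L[ℂ] ℂ} :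
    IsConormalCovector κ S x (β.comp (mfderiv 𝓘(ℂ, κ → ℂ) 𝓘(ℂ, κ → ℂ) φ x)) ↔
      IsConormalCovector κ S' (φ x) β := by
  refine ⟨fun hα => ?_, h.isConormalCovector_comp hx hS⟩
  have hx' : φ.symm (φ x) = x := φ.left_inv hx
  have key := h.symm.isConormalCovector_comp (φ.map_source hx) (S := S') (S' := S)
    (fun z hz => by rw [hS _ (φ.map_target hz), φ.right_inv hz])
    (β := β.comp (mfderiv 𝓘(ℂ, κ → ℂ) 𝓘(ℂ, κ → ℂ) φ x)) (by
      have : ∀ w, w = x → IsConormalCovector κ S w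
        (ContinuousLinearMap.comp (M₂ := κ → ℂ) β
          (mfderiv 𝓘(ℂ, κ → ℂ) 𝓘(ℂ, κ → ℂ) φ x : (κ → ℂ) →L[ℂ] (κ → ℂ))) := by
        rintro w rfl; exact hα
      exact this _ hx')
  convert key using 1
  have := h.mfderiv_symm_comp hx
  ext v
  exact congrArg β (DFunLike.congr_fun this v).symm

theorem IsBiholomorphic.isNormalCrossings (Φ : X ≃ₘ^ω⟮𝓘(ℂ, κ → ℂ), 𝓘(ℂ, κ → ℂ)⟯ X')
    {N : Set X'} (hN : IsNormalCrossings κ N) : IsNormalCrossings κ (Φ ⁻¹' N) := by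
  intro o
  obtain ⟨e, K, he, ho, h0, hK⟩ := hN (Φ o)
  refine ⟨Φ.toHomeomorph.toOpenPartialHomeomorph.trans e, K,
    (IsBiholomorphic.of_diffeomorph Φ).isCoordinateChart_trans he, ⟨trivial, ho⟩, h0, ?_⟩
  rintro z ⟨-, hz⟩
  exact hK _ hz

/-- Composing a chart of `X'` with `Φ` gives a chart of `X` in which the form has literally the same
coefficients, and the matrix condition involves only these. Agreement off the poles suffices because
the form is prescribed only there. -/
theorem IsLogSymplecticPotential.pullback (Φ : X ≃ₘ^ω⟮𝓘(ℂ, κ → ℂ), 𝓘(ℂ, κ → ℂ)⟯ X')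
    {N : Set X'} {θ : ∀ x : X', TangentSpace 𝓘(ℂ, κ → ℂ) x →L[ℂ] ℂ}
    (h : IsLogSymplecticPotential κ N θ) {θ' : ∀ x : X, TangentSpace 𝓘(ℂ, κ → ℂ) x →L[ℂ] ℂ}
    (hθ : ∀ x, Φ x ∉ N → θ' x = pullbackForm κ κ Φ θ x) :
    IsLogSymplecticPotential κ (Φ ⁻¹' N) θ' := by
  refine ⟨IsBiholomorphic.isNormalCrossings Φ h.1, fun o => ?_⟩
  obtain ⟨e, K, a, he, ho, hK, ha, hc, hd⟩ := h.2 (Φ o)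
  have hb := IsBiholomorphic.of_diffeomorph Φ
  refine ⟨Φ.toHomeomorph.toOpenPartialHomeomorph.trans e, K, a, hb.isCoordinateChart_trans he,
    ⟨trivial, ho⟩, ?_, ?_, ?_, ?_⟩
  · rintro z ⟨-, hz⟩
    exact hK _ hz
  · intro i z hz
    exact ha i z hz.1
  · rintro x ⟨hx0, hx⟩ hxN
    rw [hb.logCovector_trans he hx0 hx, hθ x hxN, pullbackForm, hc (Φ x) hx hxN]
    rfl
  · intro u hu
    exact hd u hu.1

theorem IsCoordinateChart.analyticAt_comp_symm {e e' : OpenPartialHomeomorph X (κ → ℂ)}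
    (he : IsCoordinateChart κ e) (he' : IsCoordinateChart κ e') {u : κ → ℂ} (hu : u ∈ e.target)
    (hu' : e.symm u ∈ e'.source) : AnalyticAt ℂ (fun w => e' (e.symm w)) u := by
  rw [isCoordinateChart_iff] at he he'
  have := ((he.symm.trans he').1.contMDiffAt ((e.symm.trans e').open_source.mem_nhds ⟨hu, hu'⟩))
  exact ContDiffAt.analyticAt (contMDiffAt_iff_contDiffAt.1 this)

theorem IsCoordinateChart.analyticAt_function {e : OpenPartialHomeomorph X (κ → ℂ)}
    (he : IsCoordinateChart κ e) {u : κ → ℂ} (hu : u ∈ e.target) {f : X → ℂ}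
    (hf : ContMDiffAt 𝓘(ℂ, κ → ℂ) 𝓘(ℂ, ℂ) ω f (e.symm u)) :
    AnalyticAt ℂ (fun w => f (e.symm w)) u := by
  rw [isCoordinateChart_iff] at he
  have := hf.comp u (he.2.contMDiffAt (e.open_target.mem_nhds hu))
  exact ContDiffAt.analyticAt (contMDiffAt_iff_contDiffAt.1 this)

theorem IsCoordinateChart.mfderiv_eq_fderiv_comp {e e' : OpenPartialHomeomorph X (κ → ℂ)}
    (he : IsCoordinateChart κ e) (he' : IsCoordinateChart κ e') {x : X} (hx : x ∈ e.source)
    (hx' : x ∈ e'.source) :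
    mfderiv 𝓘(ℂ, κ → ℂ) 𝓘(ℂ, κ → ℂ) e' x =
      (fderiv ℂ (fun w => e' (e.symm w)) (e x)).comp
        (mfderiv 𝓘(ℂ, κ → ℂ) 𝓘(ℂ, κ → ℂ) e x) := by
  have ha := he.analyticAt_comp_symm he' (e.map_source hx) (by rwa [e.left_inv hx])
  have h1 : mfderiv 𝓘(ℂ, κ → ℂ) 𝓘(ℂ, κ → ℂ) e' x =
      mfderiv 𝓘(ℂ, κ → ℂ) 𝓘(ℂ, κ → ℂ) ((fun w => e' (e.symm w)) ∘ e) x := by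
    refine Filter.EventuallyEq.mfderiv_eq ?_
    filter_upwards [e.open_source.mem_nhds hx] with z hz
    simp [e.left_inv hz]
  rw [h1, ← mfderiv_eq_fderiv]
  exact mfderiv_comp x ha.differentiableAt.mdifferentiableAt
    ((isCoordinateChart_iff.1 he).mdifferentiableAt hx)

/-- Coordinates centered at `o`, with smaller domain. -/
theorem IsCoordinateChart.exists_centered {e : OpenPartialHomeomorph X (κ → ℂ)}
    (he : IsCoordinateChart κ e) {o : X} (ho : o ∈ e.source) {W : Set X} (hW : W ∈ 𝓝 o) :
    ∃ e' : OpenPartialHomeomorph X (κ → ℂ), IsCoordinateChart κ e' ∧ o ∈ e'.source ∧ e' o = 0 ∧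
      e'.source ⊆ e.source ∩ W ∧ (∀ x i, e' x i = e x i - e o i) ∧
      ∀ x ∈ e'.source, ∀ i, e o i ≠ 0 → e x i ≠ 0 := by
  have hev : ∀ᶠ x in 𝓝 o, ∀ i, e o i ≠ 0 → e x i ≠ 0 := by
    rw [Filter.eventually_all]
    intro i
    by_cases hi : e o i = 0
    · simp [hi]
    · have hc : ContinuousAt (fun x => e x i) o :=
        (continuous_apply i).continuousAt.comp (e.continuousAt ho)
      filter_upwards [hc.eventually_ne hi] with x hx _ using hx
  obtain ⟨V, hV, hVo, hoV⟩ := eventually_nhds_iff.1 (hev.and hW)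
  let T : OpenPartialHomeomorph (κ → ℂ) (κ → ℂ) :=
    (Homeomorph.subRight (e o)).toOpenPartialHomeomorph
  have hT : IsBiholomorphic κ T :=
    ⟨(contMDiff_iff_contDiff.2 (by
        change ContDiff ℂ ω (fun x => x - e o); fun_prop)).contMDiffOn,
      (contMDiff_iff_contDiff.2 (by
        change ContDiff ℂ ω (fun x => x + e o); fun_prop)).contMDiffOn⟩
  refine ⟨(e.restrOpen V hVo).trans T,
    isCoordinateChart_iff.2 (((isCoordinateChart_iff.1 he).restrOpen hVo).trans hT),
    ⟨⟨ho, hoV⟩, trivial⟩, ?_, fun x hx => ⟨hx.1.1, (hV x hx.1.2).2⟩, fun x i => rfl,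
    fun x hx => (hV x hx.1.2).1⟩
  exact sub_self (e o)

/-- In coordinates centered at `o` only the components through `o` matter. -/
theorem IsCoordinateDivisor.exists_centered {e : OpenPartialHomeomorph X (κ → ℂ)}
    (he : IsCoordinateChart κ e) {K : Finset κ} {N : Set X} (hK : IsCoordinateDivisor e K N) {o : X}
    (ho : o ∈ e.source) {W : Set X} (hW : W ∈ 𝓝 o) :
    ∃ e' : OpenPartialHomeomorph X (κ → ℂ), ∃ K' ⊆ K, IsCoordinateChart κ e' ∧ o ∈ e'.source ∧
      e' o = 0 ∧ e'.source ⊆ e.source ∩ W ∧ IsCoordinateDivisor e' K' N ∧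
      (∀ i ∈ K, e o i = 0 → i ∈ K') ∧ ∀ x i, e o i = 0 → e' x i = e x i := by
  classical
  obtain ⟨e', he', ho', h0, hsub, hval, hne⟩ := he.exists_centered ho hW
  refine ⟨e', K.filter fun i => e o i = 0, Finset.filter_subset _ _, he', ho', h0, hsub,
    fun x hx => ?_, fun i hi h => Finset.mem_filter.2 ⟨hi, h⟩, fun x i hi => by rw [hval, hi, sub_zero]⟩
  rw [hK x (hsub hx).1, Finset.prod_eq_zero_iff, Finset.prod_eq_zero_iff]
  constructor
  · rintro ⟨i, hi, h⟩
    have hoi : e o i = 0 := by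
      by_contra h'
      exact hne x hx i h' h
    exact ⟨i, Finset.mem_filter.2 ⟨hi, hoi⟩, by rw [hval, h, hoi, sub_zero]⟩
  · rintro ⟨i, hi, h⟩
    rw [Finset.mem_filter] at hi
    exact ⟨i, hi.1, by rwa [hval, hi.2, sub_zero] at h⟩

end Charts

end Biholomorphism

end

noncomputable section

/-! ### Coordinates of blow ups -/

section BlowUpCoordinates

variable {κ : Type} [Fintype κ] {M : Type*} [TopologicalSpace M] [ChartedSpace (κ → ℂ) M]
  {L : Set M}

theorem analyticAt_coord (i : κ) (y : κ → ℂ) : AnalyticAt ℂ (fun w : κ → ℂ => w i) y :=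
  (ContinuousLinearMap.proj i : (κ → ℂ) →L[ℂ] ℂ).analyticAt y

theorem analyticAt_blowDown (J : Finset κ) (j : κ) (y : κ → ℂ) :
    AnalyticAt ℂ (blowDown κ J j) y := by
  rw [analyticAt_pi_iff]
  intro i
  unfold blowDown
  split_ifs
  · exact (analyticAt_coord i y).mul (analyticAt_coord j y)
  · exact analyticAt_coord i y

@[simp] theorem blowDown_self (J : Finset κ) (j : κ) (y : κ → ℂ) : blowDown κ J j y j = y j := by
  simp [blowDown]

theorem blowDown_of_mem {J : Finset κ} {i j : κ} {y : κ → ℂ} (hi : i ∈ J) (hij : i ≠ j) :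
    blowDown κ J j y i = y i * y j := if_pos ⟨hi, hij⟩

theorem blowDown_of_not {J : Finset κ} {i j : κ} {y : κ → ℂ} (hi : ¬ (i ∈ J ∧ i ≠ j)) :
    blowDown κ J j y i = y i := if_neg hi

namespace BlowUpPatch

theorem isChart (P : BlowUpPatch (κ := κ) L) : IsCoordinateChart κ P.chart := by
  cases P <;> assumption

theorem analyticAt_toCoord (P : BlowUpPatch (κ := κ) L) (y : κ → ℂ) : AnalyticAt ℂ P.toCoord y := by
  cases P with
  | off e he hL => exact analyticAt_id
  | along e he J hL j hj => exact analyticAt_blowDown J j y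

open Classical in
/-- The inverse of `toCoord` off the center. -/
def ofCoord : BlowUpPatch (κ := κ) L → (κ → ℂ) → (κ → ℂ)
  | off _ _ _ => id
  | along _ _ J _ j _ => fun x i => if i ∈ J ∧ i ≠ j then x i / x j else x i

/-- Off the center `y_j ≠ 0`, so division by `x_j` is a holomorphic local inverse of `toCoord`. -/
theorem ofCoord_spec (P : BlowUpPatch (κ := κ) L) {y : κ → ℂ} (hy : P.toCoord y ∈ P.chart.target)
    (hyL : P.chart.symm (P.toCoord y) ∉ L) :
    AnalyticAt ℂ P.ofCoord (P.toCoord y) ∧ P.ofCoord (P.toCoord y) = y ∧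
      ∀ᶠ x in 𝓝 (P.toCoord y), P.toCoord (P.ofCoord x) = x := by
  cases P with
  | off e he hL => exact ⟨analyticAt_id, rfl, by simp [toCoord, ofCoord]⟩
  | along e he J hL j hj =>
    have hyj : y j ≠ 0 := fun h => hyL ((along_mem_iff hL hj hy).2 h)
    refine ⟨?_, ?_, ?_⟩
    · rw [analyticAt_pi_iff]
      intro i
      by_cases hi : i ∈ J ∧ i ≠ j
      · simp only [ofCoord, if_pos hi]
        exact (analyticAt_coord i _).div (analyticAt_coord j _) (by simpa [toCoord] using hyj)
      · simp only [ofCoord, if_neg hi]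
        exact analyticAt_coord i _
    · funext i
      by_cases hi : i ∈ J ∧ i ≠ j
      · simp only [ofCoord, if_pos hi, toCoord, blowDown_self]
        simp [blowDown, hi, hyj]
      · simp only [ofCoord, if_neg hi, toCoord]
        simp only [blowDown, if_neg hi]
    · have hc : ContinuousAt (fun x : κ → ℂ => x j) (blowDown κ J j y) :=
        (continuous_apply j).continuousAt
      filter_upwards [hc.eventually_ne (by simpa using hyj)] with x hx
      funext i
      by_cases hi : i ∈ J ∧ i ≠ j
      · simp [toCoord, ofCoord, blowDown, hi, hx]
      · simp only [toCoord, ofCoord, blowDown, if_neg hi]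

variable [IsManifold 𝓘(ℂ, κ → ℂ) ω M]

theorem analyticAt_chart_base (P : BlowUpPatch (κ := κ) L) {y : κ → ℂ}
    (hy : P.toCoord y ∈ P.chart.target) {e' : OpenPartialHomeomorph M (κ → ℂ)}
    (he' : IsCoordinateChart κ e') (hb : P.chart.symm (P.toCoord y) ∈ e'.source) :
    AnalyticAt ℂ (fun w => e' (P.chart.symm (P.toCoord w))) y :=
  (P.isChart.analyticAt_comp_symm he' hy hb).fun_comp (P.analyticAt_toCoord y)

theorem eventually_base_mem (P : BlowUpPatch (κ := κ) L) {y : κ → ℂ}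
    (hy : P.toCoord y ∈ P.chart.target) {s : Set M} (hs : s ∈ 𝓝 (P.chart.symm (P.toCoord y))) :
    ∀ᶠ w in 𝓝 y, P.toCoord w ∈ P.chart.target ∧ P.chart.symm (P.toCoord w) ∈ s := by
  have hc := (P.continuous_toCoord.continuousAt (x := y))
  filter_upwards [P.isOpen_dom.mem_nhds hy,
    (ContinuousAt.comp' (P.chart.continuousAt_symm hy) hc).eventually hs] with w h1 h2
  exact ⟨h1, h2⟩

/-- Go down to `M` by the first patch and lift by the local inverse of the second; used in both
directions, this identifies points of different patches over the same point off `L`. -/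
theorem exists_map_of_notMem (P P' : BlowUpPatch (κ := κ) L) {y y' : κ → ℂ}
    (hy : P.toCoord y ∈ P.chart.target) (hy' : P'.toCoord y' ∈ P'.chart.target)
    (hb : P.chart.symm (P.toCoord y) = P'.chart.symm (P'.toCoord y'))
    (hL : P'.chart.symm (P'.toCoord y') ∉ L) :
    ∃ F : (κ → ℂ) → (κ → ℂ), AnalyticAt ℂ F y ∧ F y = y' ∧
      ∀ᶠ w in 𝓝 y, P'.chart.symm (P'.toCoord (F w)) = P.chart.symm (P.toCoord w) := by
  obtain ⟨h1, h2, h3⟩ := P'.ofCoord_spec hy' hL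
  have hbs : P.chart.symm (P.toCoord y) ∈ P'.chart.source := by
    rw [hb]; exact P'.chart.map_target hy'
  have ha := P.analyticAt_chart_base hy P'.isChart hbs
  have hval : P'.chart (P.chart.symm (P.toCoord y)) = P'.toCoord y' := by
    rw [hb, P'.chart.right_inv hy']
  refine ⟨fun w => P'.ofCoord (P'.chart (P.chart.symm (P.toCoord w))),
    AnalyticAt.fun_comp (by rw [hval]; exact h1) ha, by simp only [hval, h2], ?_⟩
  have ht := ha.continuousAt.tendsto
  rw [hval] at ht
  filter_upwards [ht.eventually h3,
    P.eventually_base_mem hy (P'.chart.open_source.mem_nhds hbs)] with w h4 h5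
  rw [h4, P'.chart.left_inv h5.2]

end BlowUpPatch

variable [IsManifold 𝓘(ℂ, κ → ℂ) ω M]

open PatchFamily

/-- The blow up is an isomorphism off the center. -/
theorem BlowUp.mk_eq_mk_of_notMem {P P' : BlowUpPatch (κ := κ) L}
    (y : (blowUpPatches κ L).dom P) (y' : (blowUpPatches κ L).dom P')
    (hb : P.chart.symm (P.toCoord y) = P'.chart.symm (P'.toCoord y'))
    (hL : P.chart.symm (P.toCoord y) ∉ L) :
    Glued.mk (blowUpPatches κ L) P y = Glued.mk (blowUpPatches κ L) P' y' := by
  obtain ⟨F, hF, hFy, hFb⟩ := P.exists_map_of_notMem P' y.2 y'.2 hb (hb ▸ hL)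
  obtain ⟨F', hF', hFy', hFb'⟩ := P'.exists_map_of_notMem P y'.2 y.2 hb.symm hL
  have := Glued.mk_eq_mk_of_analyticAt (blowUpPatches κ L) (i := P) (j := P') y.2 hF
    (by rw [hFy]; exact y'.2) (by rw [hFy]; exact hF') (by rw [hFy, hFy']; exact y.2)
    (hFb.mono fun w hw => ⟨hw, fun _ => rfl⟩) (by
      rw [hFy]; exact hFb'.mono fun w hw => ⟨hw, fun _ => rfl⟩)
  rw [this]
  congr 1
  exact Subtype.ext hFy

theorem BlowUp.eq_of_proj_eq {x x' : BlowUp κ L} (h : BlowUp.proj κ L x = BlowUp.proj κ L x')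
    (hL : BlowUp.proj κ L x ∉ L) : x = x' := by
  obtain ⟨P, y, rfl⟩ := Glued.exists_mk _ x
  obtain ⟨P', y', rfl⟩ := Glued.exists_mk _ x'
  exact BlowUp.mk_eq_mk_of_notMem y y' h hL

section Along

variable {e e' : OpenPartialHomeomorph M (κ → ℂ)} {J J' : Finset κ} {j j' : κ}

/-- The functions `u k` are the quotients of the coordinates `e'` by the equation `y_j` of the
exceptional divisor, near the point `y` of the affine patch of `e`. -/
def IsExceptionalQuotient (e : OpenPartialHomeomorph M (κ → ℂ)) (J : Finset κ) (j : κ)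
    (e' : OpenPartialHomeomorph M (κ → ℂ)) (J' : Finset κ) (y : κ → ℂ)
    (u : κ → (κ → ℂ) → ℂ) : Prop :=
  ∀ k ∈ J', AnalyticAt ℂ (u k) y ∧
    ∀ᶠ w in 𝓝 y, e' (e.symm (blowDown κ J j w)) k = w j * u k w

/-- For `k ∈ J'` the coordinate `e'_k` vanishes on `L`, whose inverse image in the patch is `y_j =
0`; hence it is divisible by `y_j`. -/
theorem exists_isExceptionalQuotient (he : IsCoordinateChart κ e)
    (hL : IsCoordinateSubspace e J L) (hj : j ∈ J) (he' : IsCoordinateChart κ e')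
    (hL' : IsCoordinateSubspace e' J' L) {y : κ → ℂ} (hy : blowDown κ J j y ∈ e.target)
    (hyj : y j = 0) (hb : e.symm (blowDown κ J j y) ∈ e'.source) :
    ∃ u, IsExceptionalQuotient e J j e' J' y u := by
  let P : BlowUpPatch (κ := κ) L := .along e he J hL j hj
  have ha := P.analyticAt_chart_base hy he' hb
  have : ∀ k, ∃ u : (κ → ℂ) → ℂ, k ∈ J' → AnalyticAt ℂ u y ∧
      ∀ᶠ w in 𝓝 y, e' (e.symm (blowDown κ J j w)) k = w j * u w := by
    intro k
    by_cases hk : k ∈ J'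
    · obtain ⟨u, hu, hE⟩ := ((analyticAt_pi_iff.1 ha) k).exists_eq_coord_mul hyj (by
        filter_upwards [P.eventually_base_mem hy (e'.open_source.mem_nhds hb)] with w h1 h2
        exact (hL' _ h1.2).1 ((BlowUpPatch.along_mem_iff hL hj h1.1).2 h2) k hk)
      exact ⟨u, fun _ => ⟨hu, hE⟩⟩
    · exact ⟨0, fun h => absurd h hk⟩
  choose u hu using this
  exact ⟨u, hu⟩

/-- Some quotient does not vanish. -/
theorem IsExceptionalQuotient.exists_ne_zero (he : IsCoordinateChart κ e)
    (hL : IsCoordinateSubspace e J L) (hj : j ∈ J) (he' : IsCoordinateChart κ e')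
    (hL' : IsCoordinateSubspace e' J' L) {y : κ → ℂ} (hy : blowDown κ J j y ∈ e.target)
    (hyj : y j = 0) (hb : e.symm (blowDown κ J j y) ∈ e'.source) {u : κ → (κ → ℂ) → ℂ}
    (hu : IsExceptionalQuotient e J j e' J' y u) : ∃ k ∈ J', u k y ≠ 0 := by
  classical
  by_contra! H
  let P : BlowUpPatch (κ := κ) L := .along e he J hL j hj
  have hbL : e.symm (blowDown κ J j y) ∈ L := (BlowUpPatch.along_mem_iff hL hj hy).2 hyj
  set x' := e' (e.symm (blowDown κ J j y)) with hx'
  have hsx' : e'.symm x' = e.symm (blowDown κ J j y) := e'.left_inv hb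
  have hse : e'.symm x' ∈ e.source := by rw [hsx']; exact e.map_target hy
  have hh := he'.analyticAt_comp_symm he (e'.map_source hb) hse
  obtain ⟨C, s, hs, hlip⟩ :=
    (((analyticAt_pi_iff.1 hh) j).hasStrictFDerivAt).exists_lipschitzOnWith
  -- The projection to `L` in the coordinates `e'`. As `e_j` vanishes on `L` and is Lipschitz in
  -- `e'`, one gets `|w_j| ≤ C |x' - Z x'| ≤ C |w_j| ∑ |u_k|` for the coordinates `x'` of the image
  -- of `w`. Dividing by `w_j ≠ 0` and letting `w` tend to `y`, where all `u_k` are supposed to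
  -- vanish, gives `1 ≤ 0`.
  let Z : (κ → ℂ) → (κ → ℂ) := fun v k => if k ∈ J' then 0 else v k
  have hZc : Continuous Z := by
    refine continuous_pi fun k => ?_
    by_cases hk : k ∈ J' <;> simp only [Z, hk, if_true, if_false] <;> fun_prop
  have hZx : Z x' = x' := by
    funext k
    by_cases hk : k ∈ J'
    · simp only [Z, hk, if_true]
      exact ((hL' _ hb).1 hbL k hk).symm
    · simp [Z, hk]
  have ha := (P.analyticAt_chart_base hy he' hb).continuousAt
  have ht : Filter.Tendsto (fun w => e' (e.symm (blowDown κ J j w))) (𝓝 y) (𝓝 x') := ha.tendsto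
  have htZ : Filter.Tendsto (fun w => Z (e' (e.symm (blowDown κ J j w)))) (𝓝 y) (𝓝 x') := by
    have := (hZc.tendsto x').comp ht
    rwa [hZx] at this
  have hZL : ∀ᶠ v in 𝓝 x', (∀ k ∈ J', v k = 0) → e (e'.symm v) j = 0 := by
    filter_upwards [e'.open_target.mem_nhds (e'.map_source hb),
      (e'.continuousAt_symm (e'.map_source hb)).eventually (e.open_source.mem_nhds hse)]
      with v h1 h2 h3
    refine (hL _ h2).1 ((hL' _ (e'.map_target h1)).2 ?_) j hj
    rwa [e'.right_inv h1]
  have hq : ∀ᶠ w in 𝓝 y, ∀ k ∈ J', e' (e.symm (blowDown κ J j w)) k = w j * u k w :=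
    (Filter.eventually_all_finset J').2 fun k hk => (hu k hk).2
  have hmain : ∀ᶠ w in 𝓝 y, w j ≠ 0 → 1 ≤ (C : ℝ) * ∑ k ∈ J', ‖u k w‖ := by
    filter_upwards [ht.eventually hs, htZ.eventually hs, htZ.eventually hZL, hq,
      P.eventually_base_mem hy (e'.open_source.mem_nhds hb)] with w h1 h2 h3 h4 h5 hw
    have h5a : blowDown κ J j w ∈ e.target := h5.1
    have h5b : e.symm (blowDown κ J j w) ∈ e'.source := h5.2
    have h6 := hlip.dist_le_mul _ h1 _ h2
    rw [h3 (fun k hk => by simp [Z, hk]), e'.left_inv h5b, e.right_inv h5a, blowDown_self,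
      dist_zero_right] at h6
    have h7 : dist (e' (e.symm (blowDown κ J j w))) (Z (e' (e.symm (blowDown κ J j w)))) ≤
        ‖w j‖ * ∑ k ∈ J', ‖u k w‖ := by
      rw [dist_pi_le_iff (by positivity)]
      intro k
      by_cases hk : k ∈ J'
      · simp only [Z, hk, if_true, dist_zero_right, h4 k hk, norm_mul]
        gcongr
        exact Finset.single_le_sum (f := fun k => ‖u k w‖) (fun _ _ => norm_nonneg _) hk
      · simp only [Z, hk, if_false, dist_self]
        positivity
    have h8 : ‖w j‖ * 1 ≤ ‖w j‖ * (C * ∑ k ∈ J', ‖u k w‖) := by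
      calc ‖w j‖ * 1 = ‖w j‖ := mul_one _
        _ ≤ C * (‖w j‖ * ∑ k ∈ J', ‖u k w‖) := h6.trans (by gcongr)
        _ = _ := by ring
    exact le_of_mul_le_mul_left h8 (norm_pos_iff.2 hw)
  have hlim : Filter.Tendsto (fun w => (C : ℝ) * ∑ k ∈ J', ‖u k w‖) (𝓝 y) (𝓝 0) := by
    have : Filter.Tendsto (fun w => (C : ℝ) * ∑ k ∈ J', ‖u k w‖) (𝓝 y)
        (𝓝 (C * ∑ k ∈ J', ‖u k y‖)) :=
      (tendsto_finsetSum _ fun k hk => (hu k hk).1.continuousAt.norm.tendsto).const_mul _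
    rwa [Finset.sum_eq_zero fun k hk => by rw [H k hk, norm_zero], mul_zero] at this
  have hcl : y ∈ closure (univ ∩ {w : κ → ℂ | ∀ i ∈ ({j} : Finset κ), w i ≠ 0}) :=
    subset_closure_inter_ne_zero κ isOpen_univ {j} (mem_univ y)
  obtain ⟨w, hw, -, h2⟩ := mem_closure_iff_nhds.1 hcl _
    (hmain.and (hlim.eventually (gt_mem_nhds one_pos)))
  exact absurd (hw.1 (h2 j (by simp))) (not_le.2 hw.2)

/-- The quotients for two patches are inverse to each other at corresponding points. -/
theorem IsExceptionalQuotient.mul_eq_one (hj : j ∈ J) (hj' : j' ∈ J') {y z : κ → ℂ}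
    (hy : blowDown κ J j y ∈ e.target) (hz : blowDown κ J' j' z ∈ e'.target)
    {u u' : κ → (κ → ℂ) → ℂ}
    (hu : IsExceptionalQuotient e J j e' J' y u) (hu' : IsExceptionalQuotient e' J' j' e J z u') :
    ∀ᶠ p in 𝓝 y ×ˢ 𝓝 z, e.symm (blowDown κ J j p.1) = e'.symm (blowDown κ J' j' p.2) →
      p.1 j ≠ 0 → u j' p.1 * u' j p.2 = 1 := by
  have h1 : ∀ᶠ w in 𝓝 y, blowDown κ J j w ∈ e.target :=
    (continuous_blowDown κ J j).continuousAt.eventually (e.open_target.mem_nhds hy)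
  have h2 : ∀ᶠ w in 𝓝 z, blowDown κ J' j' w ∈ e'.target :=
    (continuous_blowDown κ J' j').continuousAt.eventually (e'.open_target.mem_nhds hz)
  filter_upwards [((hu j' hj').2.and h1).prod_mk ((hu' j hj).2.and h2)]
  rintro ⟨w, v⟩ ⟨⟨h3, h4⟩, h5, h6⟩ hb hw
  simp only at *
  -- For two patch points `w`, `v` with the same image, `e'_{j'}` and `e_j` there give `v_{j'} = w_j
  -- u_{j'}(w)` and `w_j = v_{j'} u'_j(v)`.
  rw [hb, e'.right_inv h6, blowDown_self] at h3
  rw [← hb, e.right_inv h4, blowDown_self, h3] at h5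
  apply mul_left_cancel₀ hw
  rw [← mul_assoc, ← h5, mul_one]

/-- The affine coordinates `x'_i / x'_{j'}` of the second patch equal `u_i / u_{j'}`: the common
factor `y_j` cancels, so they extend holomorphically across the exceptional divisor where `u_{j'} ≠
0`. -/
theorem IsExceptionalQuotient.exists_map (he : IsCoordinateChart κ e)
    (hL : IsCoordinateSubspace e J L) (hj : j ∈ J) (he' : IsCoordinateChart κ e')
    (hj' : j' ∈ J') {y : κ → ℂ}
    (hy : blowDown κ J j y ∈ e.target) (hb : e.symm (blowDown κ J j y) ∈ e'.source)
    {u : κ → (κ → ℂ) → ℂ} (hu : IsExceptionalQuotient e J j e' J' y u) (hne : u j' y ≠ 0) :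
    ∃ F : (κ → ℂ) → (κ → ℂ), AnalyticAt ℂ F y ∧
      ∀ᶠ w in 𝓝 y, blowDown κ J' j' (F w) = e' (e.symm (blowDown κ J j w)) := by
  classical
  let P : BlowUpPatch (κ := κ) L := .along e he J hL j hj
  have ha := P.analyticAt_chart_base hy he' hb
  refine ⟨fun w i => if i ∈ J' ∧ i ≠ j' then u i w / u j' w else e' (e.symm (blowDown κ J j w)) i,
    ?_, ?_⟩
  · rw [analyticAt_pi_iff]
    intro i
    by_cases hi : i ∈ J' ∧ i ≠ j'
    · simp only [if_pos hi]
      exact (hu i hi.1).1.div (hu j' hj').1 hne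
    · simp only [if_neg hi]
      exact (analyticAt_pi_iff.1 ha) i
  · have hq : ∀ᶠ w in 𝓝 y, ∀ k ∈ J', e' (e.symm (blowDown κ J j w)) k = w j * u k w :=
      (Filter.eventually_all_finset J').2 fun k hk => (hu k hk).2
    filter_upwards [hq, (hu j' hj').1.continuousAt.eventually_ne hne] with w h1 h2
    funext i
    by_cases hi : i ∈ J' ∧ i ≠ j'
    · have hjj : ¬ (j' ∈ J' ∧ j' ≠ j') := fun h => h.2 rfl
      rw [blowDown_of_mem hi.1 hi.2]
      simp only [if_pos hi, if_neg hjj]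
      rw [h1 i hi.1, h1 j' hj']
      field_simp
    · rw [blowDown_of_not hi]
      simp only [if_neg hi]

/-- Points of two affine patches are identified when the quotient is not zero. -/
theorem IsExceptionalQuotient.exists_mk_eq (he : IsCoordinateChart κ e)
    (hL : IsCoordinateSubspace e J L) (hj : j ∈ J) (he' : IsCoordinateChart κ e')
    (hL' : IsCoordinateSubspace e' J' L) (hj' : j' ∈ J')
    (y : (blowUpPatches κ L).dom (.along e he J hL j hj)) (hyj : y.1 j = 0)
    (hb : e.symm (blowDown κ J j y) ∈ e'.source)
    {u : κ → (κ → ℂ) → ℂ} (hu : IsExceptionalQuotient e J j e' J' y u) (hne : u j' y ≠ 0) :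
    ∃ z : (blowUpPatches κ L).dom (.along e' he' J' hL' j' hj'),
      Glued.mk (blowUpPatches κ L) (.along e he J hL j hj) y =
        Glued.mk (blowUpPatches κ L) (.along e' he' J' hL' j' hj') z := by
  have hy : blowDown κ J j y ∈ e.target := y.2
  let P : BlowUpPatch (κ := κ) L := .along e he J hL j hj
  obtain ⟨F, hF, hFb⟩ := hu.exists_map he hL hj he' hj' hy hb hne
  have hFy := hFb.self_of_nhds
  have hFt : blowDown κ J' j' (F y) ∈ e'.target := by rw [hFy]; exact e'.map_source hb
  have hFs : e'.symm (blowDown κ J' j' (F y)) = e.symm (blowDown κ J j y) := by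
    rw [hFy, e'.left_inv hb]
  have hbL : e.symm (blowDown κ J j y) ∈ L := (BlowUpPatch.along_mem_iff hL hj hy).2 hyj
  have hFj : F y j' = 0 := (BlowUpPatch.along_mem_iff hL' hj' hFt).1 (by rwa [hFs])
  have hFe : e'.symm (blowDown κ J' j' (F y)) ∈ e.source := by rw [hFs]; exact e.map_target hy
  obtain ⟨u', hu'⟩ := exists_isExceptionalQuotient he' hL' hj' he hL hFt hFj hFe
  have hpres : ∀ᶠ w in 𝓝 (y : κ → ℂ),
      e'.symm (blowDown κ J' j' (F w)) = e.symm (blowDown κ J j w) := by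
    filter_upwards [hFb, P.eventually_base_mem hy (e'.open_source.mem_nhds hb)] with w h1 h2
    rw [h1]; exact e'.left_inv h2.2
  -- The relation `u_{j'} u'_j = 1` holds off the exceptional divisor and passes to the limit at
  -- `y`. So the construction also applies in the opposite direction and gives the inverse map.
  have hne' : u' j (F y) ≠ 0 := by
    have hpair : Filter.Tendsto (fun w => (w, F w)) (𝓝 (y : κ → ℂ)) (𝓝 (y : κ → ℂ) ×ˢ 𝓝 (F y)) :=
      Filter.tendsto_id.prodMk hF.continuousAt.tendsto
    have h1 := hpair.eventually (hu.mul_eq_one hj hj' hy hFt hu')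
    have hcl : (y : κ → ℂ) ∈ closure (univ ∩ {w : κ → ℂ | ∀ i ∈ ({j} : Finset κ), w i ≠ 0}) :=
      subset_closure_inter_ne_zero κ isOpen_univ {j} (mem_univ _)
    have hnb := mem_closure_iff_nhdsWithin_neBot.1 hcl
    have hlim : Filter.Tendsto (fun w => u j' w * u' j (F w)) (𝓝 (y : κ → ℂ))
        (𝓝 (u j' y * u' j (F y))) :=
      (hu j' hj').1.continuousAt.tendsto.mul
        ((hu' j hj).1.continuousAt.tendsto.comp hF.continuousAt.tendsto)
    have h6 : Filter.Tendsto (fun w => u j' w * u' j (F w))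
        (𝓝[univ ∩ {w : κ → ℂ | ∀ i ∈ ({j} : Finset κ), w i ≠ 0}] (y : κ → ℂ)) (𝓝 1) := by
      refine tendsto_const_nhds.congr' (f₁ := fun _ => (1 : ℂ)) ?_
      filter_upwards [h1.filter_mono nhdsWithin_le_nhds, hpres.filter_mono nhdsWithin_le_nhds,
        self_mem_nhdsWithin] with w h3 h4 h5
      exact (h3 h4.symm (h5.2 j (by simp))).symm
    have h2 : u j' y * u' j (F y) = 1 :=
      tendsto_nhds_unique (hlim.mono_left nhdsWithin_le_nhds) h6
    intro h0
    rw [h0, mul_zero] at h2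
    exact zero_ne_one h2
  obtain ⟨F', hF', hFb'⟩ := hu'.exists_map he' hL' hj' he hj hFt hFe hne'
  let P' : BlowUpPatch (κ := κ) L := .along e' he' J' hL' j' hj'
  refine ⟨⟨F y, hFt⟩, Glued.mk_eq_mk_of_analyticAt (blowUpPatches κ L)
    (i := .along e he J hL j hj) (j := .along e' he' J' hL' j' hj') y.2 hF hFt hF' ?_
    (hpres.mono fun w hw => ⟨hw, fun _ => rfl⟩) ?_⟩
  · change blowDown κ J j (F' (F y)) ∈ e.target
    rw [hFb'.self_of_nhds]; exact e.map_source hFe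
  · filter_upwards [hFb', P'.eventually_base_mem hFt (e.open_source.mem_nhds hFe)] with w h1 h2
    refine ⟨?_, fun _ => rfl⟩
    change e.symm (blowDown κ J j (F' w)) = e'.symm (blowDown κ J' j' w)
    rw [h1]; exact e.left_inv h2.2

end Along

end BlowUpCoordinates

end

noncomputable section

/-! ### The blow up as a Hausdorff complex manifold -/

section BlowUpManifold

open PatchFamily

variable {κ : Type} [Fintype κ] {M : Type*} [TopologicalSpace M] [ChartedSpace (κ → ℂ) M]
  {L : Set M} [IsManifold 𝓘(ℂ, κ → ℂ) ω M]

theorem BlowUp.contMDiff_proj :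
    ContMDiff 𝓘(ℂ, κ → ℂ) 𝓘(ℂ, κ → ℂ) ω (BlowUp.proj κ L) := by
  intro x
  obtain ⟨P, y, rfl⟩ := Glued.exists_mk _ x
  set x₀ := Glued.mk (blowUpPatches κ L) P y
  have h1 := (isCoordinateChart_iff.1 (Glued.isCoordinateChart_patchChart (blowUpPatches κ L)
    (i := P) (x₀ := x₀))).1.contMDiffAt
    ((Glued.patchChart (blowUpPatches κ L) P x₀).open_source.mem_nhds
      (Glued.mk_mem_patchChart_source _ y))
  have h2 : ContMDiffAt 𝓘(ℂ, κ → ℂ) 𝓘(ℂ, κ → ℂ) ω P.toCoord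
      (Glued.patchChart (blowUpPatches κ L) P x₀ x₀) :=
    contMDiffAt_iff_contDiffAt.2 (P.analyticAt_toCoord _).contDiffAt
  have h3 : ContMDiffAt 𝓘(ℂ, κ → ℂ) 𝓘(ℂ, κ → ℂ) ω P.chart.symm
      (P.toCoord (Glued.patchChart (blowUpPatches κ L) P x₀ x₀)) := by
    refine (isCoordinateChart_iff.1 P.isChart).2.contMDiffAt (P.chart.open_target.mem_nhds ?_)
    rw [Glued.patchChart_mk]; exact y.2
  refine (h3.comp x₀ (h2.comp x₀ h1)).congr_of_eventuallyEq ?_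
  filter_upwards [Glued.eventually_proj_eq (blowUpPatches κ L) (x₀ := x₀) y] with z hz
  exact hz

theorem BlowUp.continuous_proj : Continuous (BlowUp.proj κ L) := BlowUp.contMDiff_proj.continuous

theorem BlowUp.dense_proj_notMem : Dense {x : BlowUp κ L | BlowUp.proj κ L x ∉ L} :=
  Glued.dense_proj_notMem_center (blowUpPatches κ L)

theorem BlowUp.exists_mk_off {x : BlowUp κ L} (hx : BlowUp.proj κ L x ∉ L)
    {e : OpenPartialHomeomorph M (κ → ℂ)} (he : IsCoordinateChart κ e)
    (hxe : BlowUp.proj κ L x ∈ e.source) (hL : Disjoint e.source L) :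
    ∃ (y : κ → ℂ) (hy : (BlowUpPatch.off e he hL).toCoord y ∈ (BlowUpPatch.off e he hL).chart.target),
      x = Glued.mk (blowUpPatches κ L) (.off e he hL) ⟨y, hy⟩ := by
  refine ⟨e (BlowUp.proj κ L x), e.map_source hxe, BlowUp.eq_of_proj_eq ?_ hx⟩
  exact (e.left_inv hxe).symm

/-- The point comes from a patch of some other chart, but one of its exceptional quotients with
respect to `e` is nonzero, and the corresponding affine patch of `e` contains it. Thus any one chart
suffices over its domain. -/
theorem BlowUp.exists_mk_along {x : BlowUp κ L} (hx : BlowUp.proj κ L x ∈ L)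
    {e : OpenPartialHomeomorph M (κ → ℂ)} (he : IsCoordinateChart κ e)
    (hxe : BlowUp.proj κ L x ∈ e.source) {J : Finset κ} (hL : IsCoordinateSubspace e J L) :
    ∃ (j : κ) (hj : j ∈ J) (y : κ → ℂ) (hy : blowDown κ J j y ∈ e.target),
      x = Glued.mk (blowUpPatches κ L) (.along e he J hL j hj) ⟨y, hy⟩ := by
  obtain ⟨P, y, rfl⟩ := Glued.exists_mk _ x
  cases P with
  | off e' he' hL' => exact absurd hx fun h => hL'.le_bot ⟨e'.map_target y.2, h⟩
  | along e' he' J' hL' j' hj' =>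
    have hyj := (BlowUpPatch.along_mem_iff hL' hj' y.2).1 hx
    obtain ⟨u, hu⟩ := exists_isExceptionalQuotient he' hL' hj' he hL y.2 hyj hxe
    obtain ⟨j, hj, hne⟩ := hu.exists_ne_zero he' hL' hj' he hL y.2 hyj hxe
    obtain ⟨z, hz⟩ := hu.exists_mk_eq he' hL' hj' he hL hj y hyj hxe hne
    exact ⟨j, hj, z, z.2, hz⟩

/-- The blow up of a Hausdorff manifold is Hausdorff. -/
theorem BlowUp.t2Space [T2Space M] : T2Space (BlowUp κ L) := by
  rw [t2_iff_nhds]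
  intro x x' hne
  have hproj : BlowUp.proj κ L x = BlowUp.proj κ L x' :=
    tendsto_nhds_unique ((BlowUp.continuous_proj.tendsto x).mono_left (inf_le_left (b := 𝓝 x')))
      ((BlowUp.continuous_proj.tendsto x').mono_left inf_le_right)
  by_cases hL : BlowUp.proj κ L x ∈ L
  swap
  · exact BlowUp.eq_of_proj_eq hproj hL
  -- Points near both `x` and `x'` can be chosen off the center, by density. Along them `u_{j'} u'_j
  -- = 1`, and this survives in the limit. So `u_{j'}` is nonzero at `x`, which therefore lies in
  -- the patch of `x'`, where limits are unique.
  have hne' : (𝓝 x ⊓ 𝓝 x' ⊓ Filter.principal {z | BlowUp.proj κ L z ∉ L}).NeBot := by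
    rw [Filter.inf_principal_neBot_iff]
    intro A hA
    obtain ⟨U, hU, V, hV, rfl⟩ := Filter.mem_inf_iff.1 hA
    obtain ⟨U', hU', hUo, hxU⟩ := mem_nhds_iff.1 hU
    obtain ⟨V', hV', hVo, hxV⟩ := mem_nhds_iff.1 hV
    have : (U' ∩ V').Nonempty := by
      have : U' ∩ V' ∈ 𝓝 x ⊓ 𝓝 x' :=
        Filter.inter_mem_inf (hUo.mem_nhds hxU) (hVo.mem_nhds hxV)
      exact Filter.nonempty_of_mem this
    obtain ⟨z, hz, hz'⟩ := BlowUp.dense_proj_notMem.inter_open_nonempty _ (hUo.inter hVo) this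
    exact ⟨z, ⟨hU' hz.1, hV' hz.2⟩, hz'⟩
  set l := 𝓝 x ⊓ 𝓝 x' ⊓ Filter.principal {z | BlowUp.proj κ L z ∉ L} with hl
  have hlx : l ≤ 𝓝 x := inf_le_left.trans inf_le_left
  have hlx' : l ≤ 𝓝 x' := inf_le_left.trans inf_le_right
  have hlD : ∀ᶠ z in l, BlowUp.proj κ L z ∉ L :=
    Filter.mem_of_superset (Filter.mem_inf_of_right (Filter.mem_principal_self _)) fun _ h => h
  have hL2 : BlowUp.proj κ L x' ∈ L := hproj ▸ hL
  obtain ⟨P, y, rfl⟩ := Glued.exists_mk _ x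
  obtain ⟨P', z, rfl⟩ := Glued.exists_mk _ x'
  cases P with
  | off e he h => exact absurd hL fun h' => h.le_bot ⟨e.map_target y.2, h'⟩
  | along e he J hJ j hj =>
  cases P' with
  | off e' he' h => exact absurd hL2 fun h' => h.le_bot ⟨e'.map_target z.2, h'⟩
  | along e' he' J' hJ' j' hj' =>
    have hb : e.symm (blowDown κ J j y) = e'.symm (blowDown κ J' j' z) := hproj
    have hyj := (BlowUpPatch.along_mem_iff hJ hj y.2).1 hL
    have hzj := (BlowUpPatch.along_mem_iff hJ' hj' z.2).1 hL2
    have hbe' : e.symm (blowDown κ J j y) ∈ e'.source := by rw [hb]; exact e'.map_target z.2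
    have hbe : e'.symm (blowDown κ J' j' z) ∈ e.source := by rw [← hb]; exact e.map_target y.2
    obtain ⟨u, hu⟩ := exists_isExceptionalQuotient he hJ hj he' hJ' y.2 hyj hbe'
    obtain ⟨u', hu'⟩ := exists_isExceptionalQuotient he' hJ' hj' he hJ z.2 hzj hbe
    let x₀ := Glued.mk (blowUpPatches κ L) (.along e he J hJ j hj) y
    set c := Glued.patchChart (blowUpPatches κ L) (.along e he J hJ j hj) x₀ with hc
    set c' := Glued.patchChart (blowUpPatches κ L) (.along e' he' J' hJ' j' hj') x₀ with hc'
    have htc := (Glued.tendsto_patchChart (blowUpPatches κ L) (x₀ := x₀) y).mono_left hlx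
    have htc' := (Glued.tendsto_patchChart (blowUpPatches κ L) (x₀ := x₀) z).mono_left hlx'
    have hmul := (htc.prodMk htc').eventually (hu.mul_eq_one hj hj' y.2 z.2 hu')
    have hone : ∀ᶠ q in l, u j' (c q) * u' j (c' q) = 1 := by
      filter_upwards [hmul, hlD,
        (Glued.eventually_proj_eq (blowUpPatches κ L) (x₀ := x₀) y).filter_mono hlx,
        (Glued.eventually_proj_eq (blowUpPatches κ L) (x₀ := x₀) z).filter_mono hlx',
        hlx (c.open_source.mem_nhds (Glued.mk_mem_patchChart_source _ y))] with
        q h1 h2 h3 h4 h5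
      refine h1 (h3.symm.trans h4) fun h0 => h2 ?_
      change Glued.proj _ q ∈ L
      rw [h3]
      exact (BlowUpPatch.along_mem_iff hJ hj (c.map_source h5)).2 h0
    have hlim : Filter.Tendsto (fun q => u j' (c q) * u' j (c' q)) l (𝓝 (u j' y * u' j z)) :=
      ((hu j' hj').1.continuousAt.tendsto.comp htc).mul
        ((hu' j hj).1.continuousAt.tendsto.comp htc')
    have h1 : u j' y * u' j z = 1 :=
      tendsto_nhds_unique hlim (tendsto_const_nhds.congr' (hone.mono fun _ h => h.symm))
    have hne0 : u j' y ≠ 0 := left_ne_zero_of_mul (h1 ▸ one_ne_zero)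
    obtain ⟨z', hz'⟩ := hu.exists_mk_eq he hJ hj he' hJ' hj' y hyj hbe' hne0
    rw [hz'] at hlx ⊢
    have htz := (Glued.tendsto_patchChart (blowUpPatches κ L) (x₀ := x₀) z').mono_left hlx
    congr 1
    exact Subtype.ext (tendsto_nhds_unique htz htc')

/-- Off the center, the projection of the blow up is locally biholomorphic. -/
theorem BlowUp.exists_isBiholomorphic (hLc : IsClosed L) {x : BlowUp κ L}
    (hx : BlowUp.proj κ L x ∉ L) :
    ∃ φ : OpenPartialHomeomorph (BlowUp κ L) M, IsBiholomorphic κ φ ∧ x ∈ φ.source ∧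
      (∀ z ∈ φ.source, BlowUp.proj κ L z ∉ L) ∧ ∀ z ∈ φ.source, φ z = BlowUp.proj κ L z := by
  set b := BlowUp.proj κ L x
  let e := (chartAt (κ → ℂ) b).restrOpen Lᶜ hLc.isOpen_compl
  have he : IsCoordinateChart κ e := isCoordinateChart_iff.2
    ((isCoordinateChart_iff.1 (IsManifold.chart_mem_maximalAtlas b)).restrOpen hLc.isOpen_compl)
  have hbe : b ∈ e.source := ⟨mem_chart_source _ b, hx⟩
  have hd : Disjoint e.source L := Set.disjoint_left.2 fun z hz => hz.2
  obtain ⟨y, hyd, hy⟩ := BlowUp.exists_mk_off hx he hbe hd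
  set c := Glued.patchChart (blowUpPatches κ L) (.off e he hd) x
  have hcb : IsBiholomorphic κ c :=
    isCoordinateChart_iff.1 (Glued.isCoordinateChart_patchChart (blowUpPatches κ L))
  have hval : ∀ z ∈ c.source, c.trans e.symm z = BlowUp.proj κ L z := by
    rintro _ ⟨w, rfl⟩
    exact congrArg e.symm (Glued.patchChart_mk (blowUpPatches κ L) (x₀ := x) w)
  refine ⟨c.trans e.symm, hcb.trans (isCoordinateChart_iff.1 he).symm, ?_, ?_, ?_⟩
  · have hxs : x ∈ c.source := ⟨⟨y, hyd⟩, hy.symm⟩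
    exact ⟨hxs, c.map_source hxs⟩
  · rintro z ⟨hz, hz'⟩
    rw [← hval z hz]
    exact fun h => hd.le_bot ⟨e.map_target hz', h⟩
  · rintro z ⟨hz, -⟩
    exact hval z hz

namespace BlowUpPatch

variable (P : BlowUpPatch (κ := κ) L)

/-- The point of the blow up with given coordinates in an affine patch. -/
def point {y : κ → ℂ} (hy : P.toCoord y ∈ P.chart.target) : BlowUp κ L :=
  Glued.mk (blowUpPatches κ L) P ⟨y, hy⟩

/-- The coordinates of an affine patch. -/
def affineChart (x₀ : BlowUp κ L) : OpenPartialHomeomorph (BlowUp κ L) (κ → ℂ) :=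
  Glued.patchChart (blowUpPatches κ L) P x₀

theorem isCoordinateChart_affineChart (x₀ : BlowUp κ L) : IsCoordinateChart κ (P.affineChart x₀) :=
  Glued.isCoordinateChart_patchChart _

variable {P} {x₀ : BlowUp κ L}

theorem proj_point {y : κ → ℂ} (hy : P.toCoord y ∈ P.chart.target) :
    BlowUp.proj κ L (P.point hy) = P.chart.symm (P.toCoord y) := rfl

theorem mem_affineChart_source {x : BlowUp κ L} :
    x ∈ (P.affineChart x₀).source ↔ ∃ (y : κ → ℂ) (hy : P.toCoord y ∈ P.chart.target),
      x = P.point hy := by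
  constructor
  · rintro ⟨y, rfl⟩
    exact ⟨y, y.2, rfl⟩
  · rintro ⟨y, hy, rfl⟩
    exact ⟨⟨y, hy⟩, rfl⟩

theorem mem_affineChart_target {y : κ → ℂ} :
    y ∈ (P.affineChart x₀).target ↔ P.toCoord y ∈ P.chart.target := Iff.rfl

theorem affineChart_point {y : κ → ℂ} (hy : P.toCoord y ∈ P.chart.target) :
    P.affineChart x₀ (P.point hy) = y :=
  Glued.patchChart_mk (blowUpPatches κ L) _

theorem affineChart_symm {y : κ → ℂ} (hy : P.toCoord y ∈ P.chart.target) :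
    (P.affineChart x₀).symm y = P.point hy :=
  Glued.patchChart_symm (blowUpPatches κ L) hy

theorem point_mem_affineChart_source {y : κ → ℂ} (hy : P.toCoord y ∈ P.chart.target) :
    P.point hy ∈ (P.affineChart x₀).source := mem_affineChart_source.2 ⟨y, hy, rfl⟩

theorem chart_proj {x : BlowUp κ L} (hx : x ∈ (P.affineChart x₀).source) :
    P.chart (BlowUp.proj κ L x) = P.toCoord (P.affineChart x₀ x) := by
  obtain ⟨y, hy, rfl⟩ := mem_affineChart_source.1 hx
  rw [proj_point, affineChart_point, P.chart.right_inv hy]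

theorem proj_mem_source {x : BlowUp κ L} (hx : x ∈ (P.affineChart x₀).source) :
    BlowUp.proj κ L x ∈ P.chart.source := by
  obtain ⟨y, hy, rfl⟩ := mem_affineChart_source.1 hx
  exact P.chart.map_target hy

/-- The derivative of the projection in affine coordinates. -/
theorem mfderiv_chart_comp_mfderiv_proj {x : BlowUp κ L} (hx : x ∈ (P.affineChart x₀).source) :
    (mfderiv 𝓘(ℂ, κ → ℂ) 𝓘(ℂ, κ → ℂ) P.chart (BlowUp.proj κ L x)).comp
      (mfderiv 𝓘(ℂ, κ → ℂ) 𝓘(ℂ, κ → ℂ) (BlowUp.proj κ L) x) =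
    (fderiv ℂ P.toCoord (P.affineChart x₀ x)).comp
      (mfderiv 𝓘(ℂ, κ → ℂ) 𝓘(ℂ, κ → ℂ) (P.affineChart x₀) x) := by
  have hd := (isCoordinateChart_iff.1 P.isChart).mdifferentiableAt (proj_mem_source hx)
  have hd' : MDifferentiableAt 𝓘(ℂ, κ → ℂ) 𝓘(ℂ, κ → ℂ) (BlowUp.proj κ L) x :=
    BlowUp.contMDiff_proj.mdifferentiableAt (by simp)
  have hd'' := (isCoordinateChart_iff.1 (P.isCoordinateChart_affineChart x₀)).mdifferentiableAt hx
  rw [← mfderiv_comp x hd hd']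
  have h1 : (P.chart ∘ BlowUp.proj κ L) =ᶠ[𝓝 x] (P.toCoord ∘ P.affineChart x₀) := by
    filter_upwards [(P.affineChart x₀).open_source.mem_nhds hx] with z hz
    exact chart_proj hz
  rw [h1.mfderiv_eq, ← mfderiv_eq_fderiv]
  exact mfderiv_comp (I' := 𝓘(ℂ, κ → ℂ)) x
    (P.analyticAt_toCoord _).differentiableAt.mdifferentiableAt hd''

end BlowUpPatch

end BlowUpManifold

end

noncomputable section

/-! ### Coordinate changes of logarithmic cotangent bundles -/

section LogCotangentCoordinates

open PatchFamily

variable {κ : Type} [Fintype κ] {M : Type*} [TopologicalSpace M] [ChartedSpace (κ → ℂ) M]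

theorem analyticAt_logDenominator (K : Finset κ) (i : κ) (u : κ → ℂ) :
    AnalyticAt ℂ (fun w => logDenominator K w i) u := by
  unfold logDenominator
  by_cases hi : i ∈ K
  · simpa only [if_pos hi] using analyticAt_coord i u
  · simpa only [if_neg hi] using analyticAt_const

variable [IsManifold 𝓘(ℂ, κ → ℂ) ω M] {N : Set M}

namespace LogChart

variable (c c' : LogChart (κ := κ) N)

theorem logDenominator_ne_zero {x : M} (hx : x ∈ c.chart.source) (hN : x ∉ N) (i : κ) :
    logDenominator c.poles (c.chart x) i ≠ 0 := by
  unfold logDenominator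
  split_ifs with hi
  · intro h
    exact hN ((c.divisor x hx).2 (Finset.prod_eq_zero hi h))
  · exact one_ne_zero

/-- The derivative of the `i`-th coordinate of `c` along the `k`-th logarithmic vector field of `c'`,
in the coordinates `c`. -/
def logDerivative (k i : κ) (w : κ → ℂ) : ℂ :=
  logDenominator c'.poles (c'.chart (c.chart.symm w)) k *
    fderiv ℂ (fun v => c.chart (c'.chart.symm v)) (c'.chart (c.chart.symm w)) (by
      classical exact Pi.single k 1) i

variable {c c'}

theorem analyticAt_logDerivative {u : κ → ℂ} (hu : u ∈ c.chart.target)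
    (hu' : c.chart.symm u ∈ c'.chart.source) (k i : κ) :
    AnalyticAt ℂ (logDerivative c c' k i) u := by
  classical
  have hg := c.isChart.analyticAt_comp_symm c'.isChart hu hu'
  have hh := c'.isChart.analyticAt_comp_symm c.isChart (c'.chart.map_source hu')
    (by rw [c'.chart.left_inv hu']; exact c.chart.map_target hu)
  have h1 := AnalyticAt.fun_comp (g := fderiv ℂ fun v => c.chart (c'.chart.symm v))
    (f := fun w => c'.chart (c.chart.symm w)) hh.fderiv hg
  have h2 := ((ContinuousLinearMap.proj i : (κ → ℂ) →L[ℂ] ℂ).comp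
    (ContinuousLinearMap.apply ℂ (κ → ℂ) (Pi.single k (1 : ℂ) : κ → ℂ))).analyticAt
      (fderiv ℂ (fun v => c.chart (c'.chart.symm v)) (c'.chart (c.chart.symm u)))
  have h3 := AnalyticAt.fun_comp (f := fun w => c'.chart (c.chart.symm w))
    (analyticAt_logDenominator c'.poles k _) hg
  exact h3.mul (AnalyticAt.fun_comp (f := fun w =>
    fderiv ℂ (fun v => c.chart (c'.chart.symm v)) (c'.chart (c.chart.symm w))) h2 h1)

/-- Logarithmic vector fields are tangent to the divisor. -/
theorem logDerivative_eq_zero_of_generic {w : κ → ℂ} (hw : w ∈ c.chart.target)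
    (hw' : c.chart.symm w ∈ c'.chart.source) {i : κ} (hi : i ∈ c.poles) (hwi : w i = 0)
    (hgen : ∀ l ∈ c.poles, l ≠ i → w l ≠ 0) (k : κ) : logDerivative c c' k i w = 0 := by
  classical
  set v := c'.chart (c.chart.symm w) with hv
  have hvt : v ∈ c'.chart.target := c'.chart.map_source hw'
  have hvs : c'.chart.symm v = c.chart.symm w := c'.chart.left_inv hw'
  have hxN : c.chart.symm w ∈ N := by
    rw [c.divisor _ (c.chart.map_target hw), c.chart.right_inv hw]
    exact Finset.prod_eq_zero hi hwi
  rw [c'.divisor _ hw', Finset.prod_eq_zero_iff] at hxN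
  obtain ⟨l, hl, hvl⟩ := hxN
  replace hvl : v l = 0 := hvl
  unfold logDerivative
  rw [← hv]
  -- The point lies on the component `v_l = 0` of `N`. Either `k = l`, and the vector field `v_l
  -- ∂/∂v_l` vanishes, or the field is a multiple of `∂/∂v_k`, whose integral line stays in `v_l =
  -- 0`. Near a generic point, staying in `N` means staying in `w_i = 0`.
  by_cases hkl : k = l
  · subst hkl
    rw [logDenominator, if_pos hl, hvl, zero_mul]
  have hh := c'.isChart.analyticAt_comp_symm c.isChart hvt
    (by rw [hvs]; exact c.chart.map_target hw)
  have hline : HasDerivAt (fun t : ℂ => v + t • (Pi.single k (1 : ℂ) : κ → ℂ))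
      (Pi.single k (1 : ℂ) : κ → ℂ) 0 := by
    simpa using ((hasDerivAt_id (0 : ℂ)).smul_const (Pi.single k (1 : ℂ) : κ → ℂ)).const_add v
  have ht : Filter.Tendsto (fun t : ℂ => v + t • (Pi.single k (1 : ℂ) : κ → ℂ)) (𝓝 0) (𝓝 v) := by
    simpa using hline.continuousAt.tendsto
  have hder : HasDerivAt (fun t : ℂ => c.chart (c'.chart.symm (v + t • (Pi.single k (1 : ℂ) : κ → ℂ))))
      (fderiv ℂ (fun v => c.chart (c'.chart.symm v)) v (Pi.single k (1 : ℂ) : κ → ℂ)) 0 := by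
    have h0 : HasFDerivAt (fun v => c.chart (c'.chart.symm v))
        (fderiv ℂ (fun v => c.chart (c'.chart.symm v)) v)
        (v + (0 : ℂ) • (Pi.single k (1 : ℂ) : κ → ℂ)) := by
      simpa using hh.differentiableAt.hasFDerivAt
    exact h0.comp_hasDerivAt (0 : ℂ) hline
  have hderi := (hasDerivAt_pi.1 hder) i
  have hhv : c.chart (c'.chart.symm v) = w := by rw [hvs, c.chart.right_inv hw]
  have hhc : Filter.Tendsto (fun v => c.chart (c'.chart.symm v)) (𝓝 v) (𝓝 w) := by
    have := hh.continuousAt.tendsto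
    rwa [hhv] at this
  have hgen' : ∀ᶠ z in 𝓝 w, ∀ l ∈ c.poles, l ≠ i → z l ≠ 0 := by
    refine (Filter.eventually_all_finset _).2 fun l hl => ?_
    by_cases hli : l = i
    · simp [hli]
    · filter_upwards [(continuous_apply l).continuousAt.eventually_ne (hgen l hl hli)] with z hz _
      exact hz
  have hzero : (fun t : ℂ => c.chart (c'.chart.symm (v + t • (Pi.single k (1 : ℂ) : κ → ℂ))) i)
      =ᶠ[𝓝 0] fun _ => 0 := by
    filter_upwards [ht.eventually (c'.chart.open_target.mem_nhds hvt),
      ht.eventually ((c'.chart.continuousAt_symm hvt).eventually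
        (c.chart.open_source.mem_nhds (by rw [hvs]; exact c.chart.map_target hw))),
      (hhc.comp ht).eventually hgen'] with t h1 h2 h3
    have h4 : c'.chart.symm (v + t • (Pi.single k (1 : ℂ) : κ → ℂ)) ∈ N := by
      rw [c'.divisor _ (c'.chart.map_target h1), c'.chart.right_inv h1]
      refine Finset.prod_eq_zero hl ?_
      simp [hvl, Ne.symm hkl]
    rw [c.divisor _ h2, Finset.prod_eq_zero_iff] at h4
    obtain ⟨l', hl', h5⟩ := h4
    by_cases hli : l' = i
    · rwa [hli] at h5
    · exact absurd h5 (h3 l' hl' hli)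
  have h6 := (hzero.hasDerivAt_iff.1 hderi).unique (hasDerivAt_const (0 : ℂ) (0 : ℂ))
  have h7 : fderiv ℂ (fun v => c.chart (c'.chart.symm v)) v (Pi.single k (1 : ℂ) : κ → ℂ) i = 0 := h6
  rw [h7, mul_zero]

/-- This is invariance of the ideal of a component under logarithmic vector fields. Where `w_i` is a
unit or not a pole there is nothing to divide. Otherwise the derivative vanishes at the generic
points of `w_i = 0`, by continuity on all of it, and can be divided by `w_i`. -/
theorem exists_logDerivative_eq_mul {u : κ → ℂ} (hu : u ∈ c.chart.target)
    (hu' : c.chart.symm u ∈ c'.chart.source) (k i : κ) :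
    ∃ m : (κ → ℂ) → ℂ, AnalyticAt ℂ m u ∧
      ∀ᶠ w in 𝓝 u, logDerivative c c' k i w = logDenominator c.poles w i * m w := by
  classical
  have ha := analyticAt_logDerivative hu hu' k i
  by_cases hi : i ∈ c.poles
  swap
  · exact ⟨_, ha, by simp [logDenominator, hi]⟩
  by_cases hui : u i = 0
  swap
  · refine ⟨fun w => logDerivative c c' k i w / w i, ha.div (analyticAt_coord i u) hui, ?_⟩
    filter_upwards [(continuous_apply i).continuousAt.eventually_ne hui] with w hw
    simp only [logDenominator, hi, if_true]
    field_simp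
  suffices hvan : ∀ᶠ w in 𝓝 u, w i = 0 → logDerivative c c' k i w = 0 by
    obtain ⟨m, hm, hE⟩ := ha.exists_eq_coord_mul hui hvan
    exact ⟨m, hm, by simpa [logDenominator, hi] using hE⟩
  have hS : ∀ᶠ w in 𝓝 u, c.chart.symm w ∈ c'.chart.source :=
    (c.chart.continuousAt_symm hu).eventually (c'.chart.open_source.mem_nhds hu')
  obtain ⟨U, hU, hUo, huU⟩ := eventually_nhds_iff.1
    (((c.chart.open_target.eventually_mem hu).and hS).and
      ha.eventually_analyticAt)
  filter_upwards [hUo.mem_nhds huU] with w hw hwi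
  -- Move all coordinates but the `i`-th by `t`: for small `t ≠ 0` the other poles become nonzero,
  -- so the point is generic on `w_i = 0`.
  let γ : ℂ → κ → ℂ := fun t l => if l = i then w l else w l + t
  have hγc : Continuous γ := by
    refine continuous_pi fun l => ?_
    by_cases hl : l = i <;> simp only [γ, hl, if_true, if_false] <;> fun_prop
  have hγ0 : γ 0 = w := by funext l; simp [γ]
  have hγt : Filter.Tendsto γ (𝓝[≠] 0) (𝓝 w) := by
    have := (hγc.tendsto 0).mono_left (nhdsWithin_le_nhds (s := {0}ᶜ))
    rwa [hγ0] at this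
  have hgen : ∀ᶠ t in 𝓝[≠] (0 : ℂ), ∀ l ∈ c.poles, l ≠ i → γ t l ≠ 0 := by
    refine (Filter.eventually_all_finset _).2 fun l hl => ?_
    by_cases hli : l = i
    · simp [hli]
    by_cases hwl : w l = 0
    · filter_upwards [self_mem_nhdsWithin] with t ht _
      simpa [γ, hli, hwl] using ht
    · filter_upwards [hγt.eventually ((continuous_apply l).continuousAt.eventually_ne hwl)]
        with t ht _ using ht
  have h1 := ((hU w hw).2.continuousAt.tendsto.comp hγt)
  refine tendsto_nhds_unique h1 (tendsto_const_nhds.congr' ?_)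
  filter_upwards [hgen, hγt.eventually (hUo.mem_nhds hw)] with t h2 h3
  exact (logDerivative_eq_zero_of_generic (hU _ h3).1.1 (hU _ h3).1.2 hi
    (by simp [γ, hwi]) h2 k).symm

theorem logCovector_apply (e : OpenPartialHomeomorph M (κ → ℂ)) (K : Finset κ) (a : κ → ℂ) (x : M)
    (v : TangentSpace 𝓘(ℂ, κ → ℂ) x) : logCovector e K a x v =
      ∑ i, a i / logDenominator K (e x) i *
        (mfderiv 𝓘(ℂ, κ → ℂ) 𝓘(ℂ, κ → ℂ) e x v : κ → ℂ) i := by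
  have h : ∀ b V : κ → ℂ, (∑ i, b i • (ContinuousLinearMap.proj i : (κ → ℂ) →L[ℂ] ℂ)) V =
      ∑ i, b i * V i := fun b V => by simp
  exact h _ _

/-- The components of logarithmic covectors transform by a matrix of holomorphic functions. -/
theorem exists_transition_matrix {u : κ → ℂ} (hu : u ∈ c.chart.target)
    (hu' : c.chart.symm u ∈ c'.chart.source) :
    ∃ m : κ → κ → (κ → ℂ) → ℂ, (∀ k i, AnalyticAt ℂ (m k i) u) ∧
      ∀ᶠ w in 𝓝 u, c.chart.symm w ∉ N → ∀ ξ : κ → ℂ,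
        logCovector c'.chart c'.poles (fun k => ∑ i, ξ i * m k i w) (c.chart.symm w) =
          logCovector c.chart c.poles ξ (c.chart.symm w) := by
  classical
  -- `m k i` is the value of the form `ω_i` of `c` on the `k`-th logarithmic vector field of `c'`,
  -- so it is the entry of the change of frames.
  choose m hm hE using fun k i => exists_logDerivative_eq_mul hu hu' k i
  refine ⟨m, hm, ?_⟩
  have hE' : ∀ᶠ w in 𝓝 u, ∀ k i, logDerivative c c' k i w = logDenominator c.poles w i * m k i w :=
    Filter.eventually_all.2 fun k => Filter.eventually_all.2 fun i => hE k i
  filter_upwards [hE', c.chart.open_target.mem_nhds hu,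
    (c.chart.continuousAt_symm hu).eventually (c'.chart.open_source.mem_nhds hu')]
    with w h1 h2 h3 hN ξ
  ext v
  rw [logCovector_apply, logCovector_apply,
    c'.isChart.mfderiv_eq_fderiv_comp c.isChart h3 (c.chart.map_target h2), c.chart.right_inv h2]
  set V : κ → ℂ := mfderiv 𝓘(ℂ, κ → ℂ) 𝓘(ℂ, κ → ℂ) c'.chart (c.chart.symm w) v with hV
  set T := fderiv ℂ (fun v => c.chart (c'.chart.symm v)) (c'.chart (c.chart.symm w)) with hT
  have hD : ∀ i, logDenominator c.poles w i ≠ 0 := fun i => by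
    have := c.logDenominator_ne_zero (c.chart.map_target h2) hN i
    rwa [c.chart.right_inv h2] at this
  have hD' := c'.logDenominator_ne_zero h3 hN
  have hTV : ∀ i, T V i = ∑ k, V k * T (Pi.single k 1) i := by
    intro i
    conv_lhs => rw [pi_eq_sum_univ' V]
    simp [map_sum, Finset.sum_apply]
  change _ = ∑ i, ξ i / logDenominator c.poles w i * T V i
  simp_rw [hTV, Finset.mul_sum, Finset.sum_div, Finset.sum_mul]
  rw [Finset.sum_comm]
  refine Finset.sum_congr rfl fun i _ => Finset.sum_congr rfl fun k _ => ?_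
  have h4 := h1 k i
  unfold logDerivative at h4
  have h5 : logDenominator c'.poles (c'.chart (c.chart.symm w)) k * T (Pi.single k 1) i =
    logDenominator c.poles w i * m k i w := h4
  have h6 := hD i
  have h7 := hD' k
  field_simp
  linear_combination (-1 : ℂ) * V k * ξ i * h5

end LogChart

end LogCotangentCoordinates

end

noncomputable section

/-! ### The logarithmic cotangent bundle as a manifold, and its canonical form -/

section LogCotangentManifold

open PatchFamily

variable {κ : Type} [Fintype κ] {M : Type*} [TopologicalSpace M] [ChartedSpace (κ → ℂ) M]
  [IsManifold 𝓘(ℂ, κ → ℂ) ω M] {N : Set M}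

namespace LogChart

/-- The point with coordinates `(u, ξ)` of the logarithmic cotangent bundle. -/
def point (c : LogChart (κ := κ) N) {u : κ → ℂ} (hu : u ∈ c.chart.target) (ξ : κ → ℂ) :
    LogCotangent κ N :=
  Glued.mk (logCotangentPatches κ N) c ⟨Sum.elim u ξ, hu⟩

theorem mk_eq_point (c : LogChart (κ := κ) N) (y : (logCotangentPatches κ N).dom c) :
    Glued.mk (logCotangentPatches κ N) c y = c.point (u := y.1 ∘ Sum.inl) y.2 (y.1 ∘ Sum.inr) := by
  unfold point
  congr 1
  exact Subtype.ext (by simp)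

theorem point_congr (c : LogChart (κ := κ) N) {u u' : κ → ℂ} (hu : u ∈ c.chart.target)
    (hu' : u' ∈ c.chart.target) {ξ ξ' : κ → ℂ} (h : u = u') (h' : ξ = ξ') :
    c.point hu ξ = c.point hu' ξ' := by
  subst h h'; rfl

theorem proj_point (c : LogChart (κ := κ) N) {u : κ → ℂ} (hu : u ∈ c.chart.target) (ξ : κ → ℂ) :
    LogCotangent.proj κ N (c.point hu ξ) = c.chart.symm u := rfl

theorem covector_point (c : LogChart (κ := κ) N) {u : κ → ℂ} (hu : u ∈ c.chart.target) (ξ : κ → ℂ)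
    (hN : c.chart.symm u ∉ N) :
    LogCotangent.covector κ N (c.point hu ξ) = logCovector c.chart c.poles ξ (c.chart.symm u) :=
  Glued.val_mk (logCotangentPatches κ N) (i := c) ⟨Sum.elim u ξ, hu⟩ hN

/-- The matrix `m` is chosen before `ξ`: one matrix serves the whole fibre, which makes coordinate
changes linear in it. -/
theorem exists_transition_map (c c' : LogChart (κ := κ) N) {u : κ → ℂ} (hu : u ∈ c.chart.target)
    (hu' : c.chart.symm u ∈ c'.chart.source) :
    ∃ m : κ → κ → (κ → ℂ) → ℂ, ∀ ξ : κ → ℂ, ∃ F : (κ ⊕ κ → ℂ) → (κ ⊕ κ → ℂ),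
      (∀ w, F w = Sum.elim (c'.chart (c.chart.symm (w ∘ Sum.inl)))
        (fun k => ∑ i, w (Sum.inr i) * m k i (w ∘ Sum.inl))) ∧
      AnalyticAt ℂ F (Sum.elim u ξ) ∧
      ∀ᶠ w in 𝓝 (Sum.elim u ξ),
        (logCotangentPatches κ N).base c' (F w) = (logCotangentPatches κ N).base c w ∧
        ((logCotangentPatches κ N).base c w ∉ (logCotangentPatches κ N).center →
          (logCotangentPatches κ N).fib c' (F w) = (logCotangentPatches κ N).fib c w) := by
  obtain ⟨m, hm, hE⟩ := exists_transition_matrix hu hu'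
  refine ⟨m, fun ξ => ⟨_, fun w => rfl, ?_, ?_⟩⟩
  · have hl : AnalyticAt ℂ (fun w : κ ⊕ κ → ℂ => w ∘ Sum.inl) (Sum.elim u ξ) := by
      rw [analyticAt_pi_iff]
      exact fun i => analyticAt_coord (Sum.inl i) _
    have hg := AnalyticAt.fun_comp (f := fun w : κ ⊕ κ → ℂ => w ∘ Sum.inl)
      (x := Sum.elim u ξ) (g := fun v => c'.chart (c.chart.symm v))
      (c.isChart.analyticAt_comp_symm c'.isChart hu hu') hl
    rw [analyticAt_pi_iff]
    rintro (k | k)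
    · exact (analyticAt_pi_iff.1 hg) k
    · simp only [Sum.elim_inr]
      refine Finset.analyticAt_fun_sum _ fun i _ => ?_
      exact (analyticAt_coord (Sum.inr i) _).mul
        (AnalyticAt.fun_comp (g := m k i) (f := fun w : κ ⊕ κ → ℂ => w ∘ Sum.inl) (hm k i) hl)
  · have ht : Filter.Tendsto (fun w : κ ⊕ κ → ℂ => w ∘ Sum.inl) (𝓝 (Sum.elim u ξ)) (𝓝 u) := by
      have : Continuous fun w : κ ⊕ κ → ℂ => w ∘ Sum.inl := by fun_prop
      exact this.tendsto (Sum.elim u ξ)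
    filter_upwards [ht.eventually hE, ht.eventually ((c.chart.continuousAt_symm hu).eventually
      (c'.chart.open_source.eventually_mem hu'))] with w h1 h2
    have hb : c'.chart.symm (c'.chart (c.chart.symm (w ∘ Sum.inl))) =
      c.chart.symm (w ∘ Sum.inl) := c'.chart.left_inv h2
    refine ⟨hb, fun hN => ?_⟩
    have h3 := h1 hN (w ∘ Sum.inr)
    have h4 : ∀ x, x = c.chart.symm (w ∘ Sum.inl) →
        (logCovector c'.chart c'.poles (fun k => ∑ i, w (Sum.inr i) * m k i (w ∘ Sum.inl)) x :
          (κ → ℂ) →L[ℂ] ℂ) =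
        logCovector c.chart c.poles (w ∘ Sum.inr) (c.chart.symm (w ∘ Sum.inl)) := by
      rintro x rfl; exact h3
    exact h4 _ hb

/-- Coordinate changes of the logarithmic cotangent bundle are linear in the fibres. -/
theorem exists_point_eq (c c' : LogChart (κ := κ) N) {u : κ → ℂ} (hu : u ∈ c.chart.target)
    (hu' : c.chart.symm u ∈ c'.chart.source) :
    ∃ A : κ → κ → ℂ, ∀ ξ : κ → ℂ, c.point hu ξ =
      c'.point (c'.chart.map_source hu') (fun k => ∑ i, ξ i * A k i) := by
  obtain ⟨m, hm⟩ := c.exists_transition_map c' hu hu'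
  refine ⟨fun k i => m k i u, fun ξ => ?_⟩
  obtain ⟨F, hF, hFa, hFb⟩ := hm ξ
  have hus : c'.chart.symm (c'.chart (c.chart.symm u)) ∈ c.chart.source := by
    rw [c'.chart.left_inv hu']; exact c.chart.map_target hu
  obtain ⟨m', hm'⟩ := c'.exists_transition_map c (c'.chart.map_source hu') hus
  obtain ⟨F', hF', hFa', hFb'⟩ := hm' (fun k => ∑ i, ξ i * m k i u)
  have hFy : F (Sum.elim u ξ) = Sum.elim (c'.chart (c.chart.symm u)) (fun k => ∑ i, ξ i * m k i u) :=
    hF _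
  rw [← hFy] at hFa' hFb'
  have := Glued.mk_eq_mk_of_analyticAt (logCotangentPatches κ N) (i := c) (j := c')
    (y := Sum.elim u ξ) hu hFa (by rw [hFy]; exact c'.chart.map_source hu') hFa' (by
      rw [hFy, hF']
      exact c.chart.map_source hus) hFb hFb'
  unfold point
  rw [this]
  congr 1
  exact Subtype.ext hFy

end LogChart

namespace LogCotangent

theorem exists_point (p : LogCotangent κ N) :
    ∃ (c : LogChart (κ := κ) N) (u : κ → ℂ) (hu : u ∈ c.chart.target) (ξ : κ → ℂ),
      p = c.point hu ξ := by
  obtain ⟨c, y, rfl⟩ := Glued.exists_mk _ p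
  exact ⟨c, _, y.2, _, LogChart.mk_eq_point c y⟩

theorem exists_point_of_mem_source (c : LogChart (κ := κ) N) {p : LogCotangent κ N}
    (hp : proj κ N p ∈ c.chart.source) : ∃ ξ, p = c.point (c.chart.map_source hp) ξ := by
  obtain ⟨c₀, u, hu, ξ, rfl⟩ := exists_point p
  obtain ⟨A, hA⟩ := c₀.exists_point_eq c hu hp
  exact ⟨_, hA ξ⟩

theorem exists_eq_point (c : LogChart (κ := κ) N) {p : LogCotangent κ N}
    (hp : proj κ N p ∈ c.chart.source) :
    ∃ (u : κ → ℂ) (hu : u ∈ c.chart.target) (ξ : κ → ℂ), p = c.point hu ξ := by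
  obtain ⟨ξ, h⟩ := exists_point_of_mem_source c hp
  exact ⟨_, _, ξ, h⟩

theorem eq_of_covector_eq {p q : LogCotangent κ N} (h : proj κ N p = proj κ N q)
    (hN : proj κ N p ∉ N)
    (hc : (covector κ N p : (κ → ℂ) →L[ℂ] ℂ) = covector κ N q) : p = q := by
  obtain ⟨c, u, hu, ξ, rfl⟩ := exists_point p
  obtain ⟨u', hu', ξ', rfl⟩ := exists_eq_point c (p := q) (by
    rw [← h]; exact c.chart.map_target hu)
  have hN' : c.chart.symm u' ∉ N := by
    rw [LogChart.proj_point, LogChart.proj_point] at h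
    rw [← h]; exact hN
  obtain ⟨h1, h2⟩ := c.inj hu hu' hN h
    (((c.covector_point hu ξ hN).symm.trans hc).trans (c.covector_point hu' ξ' hN'))
  exact c.point_congr _ _ h1 h2

theorem contMDiff_proj :
    ContMDiff 𝓘(ℂ, κ ⊕ κ → ℂ) 𝓘(ℂ, κ → ℂ) ω (proj κ N) := by
  intro p
  obtain ⟨c, y, rfl⟩ := Glued.exists_mk _ p
  set x₀ := Glued.mk (logCotangentPatches κ N) c y
  have h1 := (isCoordinateChart_iff.1 (Glued.isCoordinateChart_patchChart (logCotangentPatches κ N)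
    (i := c) (x₀ := x₀))).1.contMDiffAt
    ((Glued.patchChart (logCotangentPatches κ N) c x₀).open_source.mem_nhds
      (Glued.mk_mem_patchChart_source _ y))
  have h2 : ContMDiffAt 𝓘(ℂ, κ ⊕ κ → ℂ) 𝓘(ℂ, κ → ℂ) ω (fun w : κ ⊕ κ → ℂ => w ∘ Sum.inl)
      (Glued.patchChart (logCotangentPatches κ N) c x₀ x₀) :=
    contMDiffAt_iff_contDiffAt.2 (contDiffAt_pi.2 fun i => contDiffAt_apply ℂ ℂ (Sum.inl i) _)
  have h3 : ContMDiffAt 𝓘(ℂ, κ → ℂ) 𝓘(ℂ, κ → ℂ) ω c.chart.symm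
      (Glued.patchChart (logCotangentPatches κ N) c x₀ x₀ ∘ Sum.inl) := by
    refine (isCoordinateChart_iff.1 c.isChart).2.contMDiffAt (c.chart.open_target.mem_nhds ?_)
    rw [Glued.patchChart_mk]; exact y.2
  refine (h3.comp x₀ (h2.comp x₀ h1)).congr_of_eventuallyEq ?_
  filter_upwards [Glued.eventually_proj_eq (logCotangentPatches κ N) (x₀ := x₀) y] with z hz
  exact hz

theorem continuous_proj : Continuous (proj κ N) := contMDiff_proj.continuous

theorem dense_proj_notMem : Dense {p : LogCotangent κ N | proj κ N p ∉ N} :=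
  Glued.dense_proj_notMem_center (logCotangentPatches κ N)

/-- Points that cannot be separated have the same image in `M`, hence lie in one bundle chart, where
limits are unique. -/
theorem t2Space [T2Space M] : T2Space (LogCotangent κ N) := by
  rw [t2_iff_nhds]
  intro p q hne
  have hproj : proj κ N p = proj κ N q :=
    tendsto_nhds_unique ((continuous_proj.tendsto p).mono_left (inf_le_left (b := 𝓝 q)))
      ((continuous_proj.tendsto q).mono_left inf_le_right)
  obtain ⟨c, u, hu, ξ, rfl⟩ := exists_point p
  obtain ⟨u', hu', ξ', rfl⟩ := exists_eq_point c (p := q) (by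
    rw [← hproj]; exact c.chart.map_target hu)
  have h1 := (Glued.tendsto_patchChart (logCotangentPatches κ N) (i := c) (x₀ := c.point hu ξ)
    ⟨Sum.elim u ξ, hu⟩).mono_left (inf_le_left (b := 𝓝 (c.point hu' ξ')))
  have h2 := (Glued.tendsto_patchChart (logCotangentPatches κ N) (i := c) (x₀ := c.point hu ξ)
    ⟨Sum.elim u' ξ', hu'⟩).mono_left (inf_le_right (a := 𝓝 (c.point hu ξ)))
  have h3 : Sum.elim u ξ = Sum.elim u' ξ' :=
    tendsto_nhds_unique (l := 𝓝 (c.point hu ξ) ⊓ 𝓝 (c.point hu' ξ')) h1 h2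
  unfold LogChart.point
  congr 1
  exact Subtype.ext h3

section Chart

variable (c : LogChart (κ := κ) N) (p₀ : LogCotangent κ N)

/-- The coordinates `(x, ξ)` belonging to the coordinates `x`. -/
def bundleChart : OpenPartialHomeomorph (LogCotangent κ N) (κ ⊕ κ → ℂ) :=
  Glued.patchChart (logCotangentPatches κ N) c p₀

theorem isCoordinateChart_bundleChart : IsCoordinateChart (κ ⊕ κ) (bundleChart c p₀) :=
  Glued.isCoordinateChart_patchChart _

variable {c p₀}

theorem mem_bundleChart_source {p : LogCotangent κ N} :
    p ∈ (bundleChart c p₀).source ↔ proj κ N p ∈ c.chart.source := by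
  constructor
  · rintro ⟨y, rfl⟩
    exact c.chart.map_target y.2
  · intro h
    obtain ⟨u, hu, ξ, rfl⟩ := exists_eq_point c h
    exact ⟨_, rfl⟩

theorem mem_bundleChart_target {w : κ ⊕ κ → ℂ} :
    w ∈ (bundleChart c p₀).target ↔ w ∘ Sum.inl ∈ c.chart.target := Iff.rfl

theorem bundleChart_point {u : κ → ℂ} (hu : u ∈ c.chart.target) (ξ : κ → ℂ) :
    bundleChart c p₀ (c.point hu ξ) = Sum.elim u ξ :=
  Glued.patchChart_mk (logCotangentPatches κ N) _

theorem bundleChart_symm {w : κ ⊕ κ → ℂ} (hw : w ∘ Sum.inl ∈ c.chart.target) :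
    (bundleChart c p₀).symm w = c.point hw (w ∘ Sum.inr) :=
  (Glued.patchChart_symm (logCotangentPatches κ N) hw).trans (c.mk_eq_point _)

theorem bundleChart_inl {p : LogCotangent κ N} (hp : proj κ N p ∈ c.chart.source) (i : κ) :
    bundleChart c p₀ p (Sum.inl i) = c.chart (proj κ N p) i := by
  obtain ⟨ξ, hξ⟩ := exists_point_of_mem_source c hp
  conv_lhs => rw [hξ]
  rw [bundleChart_point]
  rfl

theorem isCoordinateDivisor_bundleChart :
    IsCoordinateDivisor (bundleChart c p₀) (c.poles.map Function.Embedding.inl) (proj κ N ⁻¹' N) := by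
  intro p hp
  rw [mem_bundleChart_source] at hp
  rw [mem_preimage, c.divisor _ hp, Finset.prod_map]
  simp only [Function.Embedding.inl_apply, bundleChart_inl hp]

theorem isCoordinateSubspace_bundleChart {L : Set M} {J : Finset κ}
    (hL : IsCoordinateSubspace c.chart J L) :
    IsCoordinateSubspace (bundleChart c p₀) (J.map Function.Embedding.inl) (proj κ N ⁻¹' L) := by
  intro p hp
  rw [mem_bundleChart_source] at hp
  rw [mem_preimage, hL _ hp]
  simp [bundleChart_inl hp]

/-- In bundle coordinates the projection forgets `ξ`, so pulling back the covector `∑ ξ_i ω_i`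
leaves its coefficients unchanged and adds no `dξ_i`. -/
theorem canonicalForm_eq {p : LogCotangent κ N} (hp : proj κ N p ∈ c.chart.source)
    (hN : proj κ N p ∉ N) :
    canonicalForm κ N p = logCovector (bundleChart c p₀) (c.poles.map Function.Embedding.inl)
      (Sum.elim (fun i => bundleChart c p₀ p (Sum.inr i)) 0) p := by
  obtain ⟨ξ, hξ⟩ := exists_point_of_mem_source c hp
  have hcov : (covector κ N p : (κ → ℂ) →L[ℂ] ℂ) =
      logCovector c.chart c.poles ξ (proj κ N p) := by
    have h1 : c.chart.symm (c.chart (proj κ N p)) = proj κ N p := c.chart.left_inv hp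
    have h2 := c.covector_point (c.chart.map_source hp) ξ (by rwa [h1])
    rw [← hξ] at h2
    have h3 : ∀ x, x = proj κ N p → (logCovector c.chart c.poles ξ x : (κ → ℂ) →L[ℂ] ℂ) =
      logCovector c.chart c.poles ξ (proj κ N p) := by rintro x rfl; rfl
    exact h2.trans (h3 _ h1)
  have hinr : ∀ i, bundleChart c p₀ p (Sum.inr i) = ξ i := by
    intro i
    conv_lhs => rw [hξ]
    rw [bundleChart_point]
    rfl
  have hps : p ∈ (bundleChart c p₀).source := mem_bundleChart_source.2 hp
  have hdE := (isCoordinateChart_iff.1 (isCoordinateChart_bundleChart c p₀)).mdifferentiableAt hps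
  have hdc := (isCoordinateChart_iff.1 c.isChart).mdifferentiableAt hp
  have hdπ : MDifferentiableAt 𝓘(ℂ, κ ⊕ κ → ℂ) 𝓘(ℂ, κ → ℂ) (proj κ N) p :=
    contMDiff_proj.mdifferentiableAt (by simp)
  let R : (κ ⊕ κ → ℂ) →L[ℂ] (κ → ℂ) :=
    ContinuousLinearMap.pi fun i => ContinuousLinearMap.proj (Sum.inl i)
  have hcomp : (mfderiv 𝓘(ℂ, κ → ℂ) 𝓘(ℂ, κ → ℂ) c.chart (proj κ N p)).comp
      (mfderiv 𝓘(ℂ, κ ⊕ κ → ℂ) 𝓘(ℂ, κ → ℂ) (proj κ N) p) =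
      R.comp (mfderiv 𝓘(ℂ, κ ⊕ κ → ℂ) 𝓘(ℂ, κ ⊕ κ → ℂ) (bundleChart c p₀) p) := by
    rw [← mfderiv_comp p hdc hdπ]
    have h1 : (c.chart ∘ proj κ N) =ᶠ[𝓝 p] (R ∘ bundleChart c p₀) := by
      filter_upwards [(bundleChart c p₀).open_source.mem_nhds hps] with z hz
      funext i
      exact (bundleChart_inl (p₀ := p₀) (mem_bundleChart_source.1 hz) i).symm
    rw [h1.mfderiv_eq, mfderiv_comp (I' := 𝓘(ℂ, κ ⊕ κ → ℂ)) p
      R.differentiableAt.mdifferentiableAt hdE, mfderiv_eq_fderiv, R.fderiv]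
    rfl
  ext v
  have e1 : canonicalForm κ N p v = logCovector c.chart c.poles ξ (proj κ N p)
      (mfderiv 𝓘(ℂ, κ ⊕ κ → ℂ) 𝓘(ℂ, κ → ℂ) (proj κ N) p v) := DFunLike.congr_fun hcov _
  rw [e1, LogChart.logCovector_apply, LogChart.logCovector_apply, Fintype.sum_sum_type]
  have e2 : ∀ i, (mfderiv 𝓘(ℂ, κ → ℂ) 𝓘(ℂ, κ → ℂ) c.chart (proj κ N p)
      (mfderiv 𝓘(ℂ, κ ⊕ κ → ℂ) 𝓘(ℂ, κ → ℂ) (proj κ N) p v) : κ → ℂ) i =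
      (mfderiv 𝓘(ℂ, κ ⊕ κ → ℂ) 𝓘(ℂ, κ ⊕ κ → ℂ) (bundleChart c p₀) p v : κ ⊕ κ → ℂ) (Sum.inl i) :=
    fun i => congrFun (DFunLike.congr_fun hcomp v) i
  have e3 : ∀ i, logDenominator (c.poles.map Function.Embedding.inl) (bundleChart c p₀ p) (Sum.inl i)
      = logDenominator c.poles (c.chart (proj κ N p)) i := by
    intro i
    have h : (Sum.inl i : κ ⊕ κ) ∈ c.poles.map Function.Embedding.inl ↔ i ∈ c.poles :=
      Finset.mem_map' Function.Embedding.inl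
    unfold logDenominator
    by_cases hi : i ∈ c.poles
    · rw [if_pos (h.2 hi), if_pos hi, bundleChart_inl hp]
    · rw [if_neg fun h' => hi (h.1 h'), if_neg hi]
  simp only [Sum.elim_inl, Sum.elim_inr, Pi.zero_apply, zero_div, zero_mul, Finset.sum_const_zero,
    add_zero, e2, e3, hinr]

end Chart

/-- The differential of the canonical form is a logarithmic symplectic form. -/
theorem isLogSymplecticPotential (hN : IsNormalCrossings κ N) :
    IsLogSymplecticPotential (κ ⊕ κ) (proj κ N ⁻¹' N) (canonicalForm κ N) := by
  classical
  have hex : ∀ p : LogCotangent κ N, ∃ c : LogChart (κ := κ) N, proj κ N p ∈ c.chart.source := by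
    intro p
    obtain ⟨e, K, he, ho, -, hK⟩ := hN (proj κ N p)
    exact ⟨⟨e, K, he, hK⟩, ho⟩
  refine ⟨fun p => ?_, fun p => ?_⟩
  · obtain ⟨c, hc⟩ := hex p
    obtain ⟨e', K', -, h1, h2, h3, -, h4, -⟩ :=
      (isCoordinateDivisor_bundleChart (c := c) (p₀ := p)).exists_centered
        (isCoordinateChart_bundleChart c p) (mem_bundleChart_source.2 hc) Filter.univ_mem
    exact ⟨e', K', h1, h2, h3, h4⟩
  · obtain ⟨c, hc⟩ := hex p
    refine ⟨bundleChart c p, c.poles.map Function.Embedding.inl,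
      Sum.elim (fun i w => w (Sum.inr i)) 0, isCoordinateChart_bundleChart c p,
      mem_bundleChart_source.2 hc, isCoordinateDivisor_bundleChart, ?_, ?_, ?_⟩
    · rintro (i | i) w -
      · exact analyticAt_coord _ _
      · exact analyticAt_const
    · intro x hx hxN
      rw [canonicalForm_eq (c := c) (p₀ := p) (mem_bundleChart_source.1 hx) hxN]
      congr 1
      funext i
      cases i <;> rfl
    · intro u _
      -- The coefficients `ξ_i` and `0` do not depend on `x`, so the logarithmic factors `x_k` drop
      -- out and only the derivatives `∂ξ_i/∂ξ_i` remain.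
      have hM : (Matrix.of fun k l : κ ⊕ κ =>
          frameDeriv (c.poles.map Function.Embedding.inl) k
            ((Sum.elim (fun i w => w (Sum.inr i)) 0 : κ ⊕ κ → (κ ⊕ κ → ℂ) → ℂ) l) u -
          frameDeriv (c.poles.map Function.Embedding.inl) l
            ((Sum.elim (fun i w => w (Sum.inr i)) 0 : κ ⊕ κ → (κ ⊕ κ → ℂ) → ℂ) k) u) =
          Matrix.J κ ℂ := by
        have hf : ∀ i : κ, fderiv ℂ (fun w : κ ⊕ κ → ℂ => w (Sum.inr i)) u =
            ContinuousLinearMap.proj (Sum.inr i) := fun i =>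
          (ContinuousLinearMap.proj (Sum.inr i) : (κ ⊕ κ → ℂ) →L[ℂ] ℂ).fderiv
        have hz : fderiv ℂ (0 : (κ ⊕ κ → ℂ) → ℂ) u = 0 := fderiv_const_apply 0
        ext (k | k) (l | l) <;>
          simp [frameDeriv, hf, hz, Matrix.J, logDenominator, Matrix.one_apply, Pi.single_apply,
            eq_comm]
      intro h0
      have h1 := Matrix.isUnit_det_J κ ℂ
      rw [← hM] at h1
      refine h1.ne_zero ?_
      convert h0

end LogCotangent

end LogCotangentManifold

end

noncomputable section

/-! ### Gluing local biholomorphisms -/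

section Gluing

variable {κ : Type} [Fintype κ]
  {X : Type*} [TopologicalSpace X] [ChartedSpace (κ → ℂ) X] [T2Space X]
  {T : Type*} [TopologicalSpace T] [ChartedSpace (κ → ℂ) T] [T2Space T]

/-- On `D` the relation determines the value; elsewhere continuity and the Hausdorff property of `T`
do. -/
theorem OpenPartialHomeomorph.eq_of_relation_dense {X T : Type*} [TopologicalSpace X]
    [TopologicalSpace T] [T2Space T] {A : X → T → Prop}
    {D : Set X} (hD : Dense D) (hA : ∀ x ∈ D, ∀ p p', A x p → A x p' → p = p')
    {φ ψ : OpenPartialHomeomorph X T} (hφ : ∀ z ∈ φ.source, A z (φ z))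
    (hψ : ∀ z ∈ ψ.source, A z (ψ z)) {x : X} (hx : x ∈ φ.source) (hx' : x ∈ ψ.source) :
    φ x = ψ x := by
  have hcl : x ∈ closure (φ.source ∩ ψ.source ∩ D) :=
    (φ.open_source.inter ψ.open_source).inter_closure
      ⟨⟨hx, hx'⟩, by rw [hD.closure_eq]; trivial⟩
  have hne := mem_closure_iff_nhdsWithin_neBot.1 hcl
  refine tendsto_nhds_unique (l := 𝓝[φ.source ∩ ψ.source ∩ D] x) ((φ.continuousAt hx).tendsto.mono_left nhdsWithin_le_nhds)
    (((ψ.continuousAt hx').tendsto.mono_left nhdsWithin_le_nhds).congr'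
      (Filter.eventuallyEq_of_mem self_mem_nhdsWithin fun z hz => ?_))
  exact hA z hz.2 _ _ (hψ z hz.1.2) (hφ z hz.1.1)

/-- Local biholomorphisms which are determined on dense sets by a relation glue. -/
theorem exists_diffeomorph_of_relation {A : X → T → Prop}
    {D : Set X} (hD : Dense D) (hA : ∀ x ∈ D, ∀ p p', A x p → A x p' → p = p')
    {D' : Set T} (hD' : Dense D') (hA' : ∀ p ∈ D', ∀ x x', A x p → A x' p → x = x')
    (h : ∀ x, ∃ φ : OpenPartialHomeomorph X T, IsBiholomorphic κ φ ∧
      (∀ z ∈ φ.source, A z (φ z)) ∧ x ∈ φ.source)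
    (h' : ∀ p, ∃ φ : OpenPartialHomeomorph X T, IsBiholomorphic κ φ ∧
      (∀ z ∈ φ.source, A z (φ z)) ∧ p ∈ φ.target) :
    ∃ Φ : X ≃ₘ^ω⟮𝓘(ℂ, κ → ℂ), 𝓘(ℂ, κ → ℂ)⟯ T, (∀ x, A x (Φ x)) ∧
      ∀ φ : OpenPartialHomeomorph X T, (∀ z ∈ φ.source, A z (φ z)) →
        ∀ x ∈ φ.source, Φ x = φ x := by
  -- The global map is `x ↦ f x x` and its inverse `p ↦ (g p).symm p`. By uniqueness, in each of the
  -- two directions, they agree locally with any map satisfying the relation, which gives smoothness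
  -- and that they are inverse.
  choose f hf1 hf2 hf3 using h
  choose g hg1 hg2 hg3 using h'
  have hsymm : ∀ φ : OpenPartialHomeomorph X T, (∀ z ∈ φ.source, A z (φ z)) →
      ∀ p ∈ φ.symm.source, A (φ.symm p) p := by
    intro φ hφ p hp
    have := hφ _ (φ.map_target hp)
    rwa [φ.right_inv hp] at this
  have key : ∀ φ : OpenPartialHomeomorph X T, (∀ z ∈ φ.source, A z (φ z)) →
      ∀ x ∈ φ.source, f x x = φ x := fun φ hφ x hx =>
    OpenPartialHomeomorph.eq_of_relation_dense hD hA (hf2 x) hφ (hf3 x) hx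
  have key' : ∀ φ : OpenPartialHomeomorph X T, (∀ z ∈ φ.source, A z (φ z)) →
      ∀ p ∈ φ.target, (g p).symm p = φ.symm p := fun φ hφ p hp =>
    OpenPartialHomeomorph.eq_of_relation_dense (A := fun p x => A x p) hD' hA'
      (hsymm _ (hg2 p)) (hsymm φ hφ) (hg3 p) hp
  refine ⟨{ toFun := fun x => f x x
            invFun := fun p => (g p).symm p
            left_inv := fun x => ?_
            right_inv := fun p => ?_
            contMDiff_toFun := fun x => ?_
            contMDiff_invFun := fun p => ?_ }, fun x => hf2 x x (hf3 x), fun φ hφ x hx => key φ hφ x hx⟩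
  · change (g (f x x)).symm (f x x) = x
    rw [key' (f x) (hf2 x) _ ((f x).map_source (hf3 x)), (f x).left_inv (hf3 x)]
  · change f ((g p).symm p) ((g p).symm p) = p
    rw [key (g p) (hg2 p) _ ((g p).map_target (hg3 p)), (g p).right_inv (hg3 p)]
  · refine ((hf1 x).1.contMDiffAt ((f x).open_source.mem_nhds (hf3 x))).congr_of_eventuallyEq ?_
    filter_upwards [(f x).open_source.mem_nhds (hf3 x)] with z hz
    exact key (f x) (hf2 x) z hz
  · refine ((hg1 p).2.contMDiffAt ((g p).open_target.mem_nhds (hg3 p))).congr_of_eventuallyEq ?_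
    filter_upwards [(g p).open_target.mem_nhds (hg3 p)] with z hz
    exact key' (g p) (hg2 p) z hz

end Gluing

/-! ### Adapted coordinates of the blow ups -/

section Adapted

open PatchFamily

variable {κ : Type} [Fintype κ] {M : Type*} [TopologicalSpace M] [ChartedSpace (κ → ℂ) M]

/-- Coordinates in which both the divisor `N` and the center `L` are given by coordinate functions,
together with an affine patch of the blow up along `L`. -/
inductive AdaptedPatch (N L : Set M) : Type _
  | off (c : LogChart (κ := κ) N) (hL : Disjoint c.chart.source L) : AdaptedPatch N L
  | along (c : LogChart (κ := κ) N) (J : Finset κ) (hL : IsCoordinateSubspace c.chart J L)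
      (hJ : J ⊆ c.poles) (j : κ) (hj : j ∈ J) : AdaptedPatch N L

namespace AdaptedPatch

variable {N L : Set M}

/-- The logarithmic coordinates of `M`. -/
def logChart : AdaptedPatch (κ := κ) N L → LogChart (κ := κ) N
  | off c _ => c
  | along c _ _ _ _ _ => c

/-- The patch of the blow up of `M`. -/
def patch : AdaptedPatch (κ := κ) N L → BlowUpPatch (κ := κ) L
  | off c hL => .off c.chart c.isChart hL
  | along c J hL _ j hj => .along c.chart c.isChart J hL j hj

theorem patch_chart (P : AdaptedPatch (κ := κ) N L) : P.patch.chart = P.logChart.chart := by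
  cases P <;> rfl

open Classical in
/-- The difference of the fibre coordinates of the two logarithmic cotangent bundles. -/
def fibreShift : AdaptedPatch (κ := κ) N L → (κ → ℂ) →L[ℂ] (κ → ℂ)
  | off _ _ => 0
  | along _ J _ _ j _ => (∑ l ∈ J.erase j,
      (ContinuousLinearMap.proj l : (κ → ℂ) →L[ℂ] ℂ)).smulRight (Pi.single j (1 : ℂ))

/-- The shift adds to the `j`-th coordinate a sum that omits the `j`-th one, so it has square zero
and `1 + shift` has the inverse `1 - shift`. -/
theorem fibreShift_fibreShift (P : AdaptedPatch (κ := κ) N L) (ξ : κ → ℂ) :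
    P.fibreShift (P.fibreShift ξ) = 0 := by
  classical
  cases P with
  | off c hL => rfl
  | along c J hL hJ j hj =>
    simp only [fibreShift, ContinuousLinearMap.smulRight_apply]
    rw [map_smul]
    have : (∑ l ∈ J.erase j, (ContinuousLinearMap.proj l : (κ → ℂ) →L[ℂ] ℂ))
        (Pi.single j (1 : ℂ)) = 0 := by
      rw [sum_apply]
      refine Finset.sum_eq_zero fun l hl => ?_
      simp [Finset.ne_of_mem_erase hl]
    rw [this, smul_zero, zero_smul]

/-- The coordinates of a covector in the logarithmic frame of the blow up. -/
theorem sum_logFrame (P : AdaptedPatch (κ := κ) N L) (y V ξ : κ → ℂ)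
    (hD : ∀ i, logDenominator P.logChart.poles (P.patch.toCoord y) i ≠ 0) :
    ∑ i, (ξ + P.fibreShift ξ) i / logDenominator P.logChart.poles y i * V i =
      ∑ i, ξ i / logDenominator P.logChart.poles (P.patch.toCoord y) i *
        fderiv ℂ P.patch.toCoord y V i := by
  classical
  cases P with
  | off c hL => simp [fibreShift, patch, BlowUpPatch.toCoord]
  | along c J hL hJ j hj =>
    simp only [logChart, patch, BlowUpPatch.toCoord] at hD ⊢
    have hjp := hJ hj
    have hyj : y j ≠ 0 := by
      have := hD j
      rwa [logDenominator, if_pos hjp, blowDown_self] at this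
    have hder : ∀ i, fderiv ℂ (blowDown κ J j) y V i =
        if i ∈ J ∧ i ≠ j then y i * V j + V i * y j else V i := by
      intro i
      have h1 := (hasFDerivAt_pi'.1
        (analyticAt_blowDown J j y).differentiableAt.hasFDerivAt) i
      by_cases hi : i ∈ J ∧ i ≠ j
      · have h2 : HasFDerivAt (fun x : κ → ℂ => blowDown κ J j x i)
            (y i • (ContinuousLinearMap.proj j : (κ → ℂ) →L[ℂ] ℂ) +
              y j • (ContinuousLinearMap.proj i : (κ → ℂ) →L[ℂ] ℂ)) y := by
          simp only [blowDown, if_pos hi]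
          exact (ContinuousLinearMap.proj i : (κ → ℂ) →L[ℂ] ℂ).hasFDerivAt.mul
            (ContinuousLinearMap.proj j : (κ → ℂ) →L[ℂ] ℂ).hasFDerivAt
        have h3 := DFunLike.congr_fun (h1.unique h2) V
        simp only [if_pos hi]
        simpa [mul_comm] using h3
      · have h2 : HasFDerivAt (fun x : κ → ℂ => blowDown κ J j x i)
            (ContinuousLinearMap.proj i : (κ → ℂ) →L[ℂ] ℂ) y := by
          simp only [blowDown, if_neg hi]
          exact (ContinuousLinearMap.proj i : (κ → ℂ) →L[ℂ] ℂ).hasFDerivAt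
        have h3 := DFunLike.congr_fun (h1.unique h2) V
        simp only [if_neg hi]
        simpa using h3
    -- For `i ∈ J`, `i ≠ j`, this is `dx_i/x_i = dy_i/y_i + dy_j/y_j`. It needs `i` to be a pole,
    -- which `J ⊆ c.poles` provides. Collecting the terms `dy_j/y_j` gives the shift.
    have hterm : ∀ i, ξ i / logDenominator c.poles (blowDown κ J j y) i *
        fderiv ℂ (blowDown κ J j) y V i = ξ i / logDenominator c.poles y i * V i +
          if i ∈ J.erase j then ξ i * (V j / y j) else 0 := by
      intro i
      rw [hder]
      by_cases hi : i ∈ J ∧ i ≠ j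
      · have hip := hJ hi.1
        have h4 := hD i
        have hie : i ∈ J.erase j := Finset.mem_erase.2 ⟨hi.2, hi.1⟩
        rw [logDenominator, if_pos hip, blowDown_of_mem hi.1 hi.2] at h4
        have hyi : y i ≠ 0 := left_ne_zero_of_mul h4
        rw [if_pos hi, if_pos hie, logDenominator, logDenominator, if_pos hip, if_pos hip,
          blowDown_of_mem hi.1 hi.2]
        field_simp
        ring
      · have hie : i ∉ J.erase j := fun h => hi ⟨Finset.mem_of_mem_erase h, Finset.ne_of_mem_erase h⟩
        rw [if_neg hi, if_neg hie, add_zero, logDenominator, logDenominator, blowDown_of_not hi]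
    simp_rw [hterm]
    rw [Finset.sum_add_distrib, Finset.sum_ite_mem, Finset.univ_inter]
    simp only [fibreShift, Pi.add_apply, add_div, add_mul, Finset.sum_add_distrib]
    congr 1
    rw [Finset.sum_eq_single j]
    · rw [logDenominator, if_pos hjp]
      simp [Finset.sum_mul, div_mul_eq_mul_div, Finset.sum_div, mul_div_assoc]
    · intro i _ hij
      simp [hij]
    · simp

variable [IsManifold 𝓘(ℂ, κ → ℂ) ω M]

/-- The patch of the blow up of the logarithmic cotangent bundle. -/
def bundlePatch (p₀ : LogCotangent κ N) : AdaptedPatch (κ := κ) N L →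
    BlowUpPatch (κ := κ ⊕ κ) (LogCotangent.proj κ N ⁻¹' L)
  | off c hL => .off (LogCotangent.bundleChart c p₀) (LogCotangent.isCoordinateChart_bundleChart c p₀)
      (Set.disjoint_left.2 fun _ hp hp' =>
        hL.le_bot ⟨LogCotangent.mem_bundleChart_source.1 hp, hp'⟩)
  | along c J hL _ j hj => .along (LogCotangent.bundleChart c p₀)
      (LogCotangent.isCoordinateChart_bundleChart c p₀) (J.map Function.Embedding.inl)
      (LogCotangent.isCoordinateSubspace_bundleChart hL) (Sum.inl j)
      (Finset.mem_map_of_mem Function.Embedding.inl hj)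

variable (P : AdaptedPatch (κ := κ) N L) (p₀ : LogCotangent κ N)

theorem bundlePatch_chart :
    (P.bundlePatch p₀).chart = LogCotangent.bundleChart P.logChart p₀ := by
  cases P <;> rfl

/-- The center of the bundle is given by base coordinates, so blowing it up leaves the fibre
coordinates alone. -/
theorem bundlePatch_toCoord (w : κ ⊕ κ → ℂ) :
    (P.bundlePatch p₀).toCoord w = Sum.elim (P.patch.toCoord (w ∘ Sum.inl)) (w ∘ Sum.inr) := by
  cases P with
  | off c hL =>
    funext i
    cases i <;> rfl
  | along c J hL hJ j hj =>
    funext i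
    cases i with
    | inl i =>
      by_cases hi : i ∈ J ∧ i ≠ j
      · simp [bundlePatch, BlowUpPatch.toCoord, blowDown, patch, hi]
      · have hi' : ¬ ((Sum.inl i : κ ⊕ κ) ∈ J.map Function.Embedding.inl ∧
            (Sum.inl i : κ ⊕ κ) ≠ Sum.inl j) := by
          rintro ⟨h1, h2⟩
          exact hi ⟨(Finset.mem_map' Function.Embedding.inl).1 h1, fun h => h2 (by rw [h])⟩
        simp only [bundlePatch, BlowUpPatch.toCoord, patch, blowDown_of_not hi', Sum.elim_inl,
          blowDown_of_not hi, Function.comp_apply]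
    | inr i =>
      have hi' : ¬ ((Sum.inr i : κ ⊕ κ) ∈ J.map Function.Embedding.inl ∧
          (Sum.inr i : κ ⊕ κ) ≠ Sum.inl j) := by simp
      simp only [bundlePatch, BlowUpPatch.toCoord, blowDown_of_not hi', Sum.elim_inr,
        Function.comp_apply]

theorem mem_bundlePatch_dom {w : κ ⊕ κ → ℂ} :
    (P.bundlePatch p₀).toCoord w ∈ (P.bundlePatch p₀).chart.target ↔
      P.patch.toCoord (w ∘ Sum.inl) ∈ P.patch.chart.target := by
  rw [bundlePatch_chart, bundlePatch_toCoord, LogCotangent.mem_bundleChart_target, patch_chart]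
  rfl

/-- Pulling back introduces only additional factors `y_j`, and `j` is already a pole. So the same
index set describes the inverse image of `N`. -/
theorem toCoord_mem_divisor {y : κ → ℂ} :
    ∏ i ∈ P.logChart.poles, P.patch.toCoord y i = 0 ↔ ∏ i ∈ P.logChart.poles, y i = 0 := by
  cases P with
  | off c hL => rfl
  | along c J hL hJ j hj =>
    simp only [logChart, patch, BlowUpPatch.toCoord, Finset.prod_eq_zero_iff]
    constructor
    · rintro ⟨i, hi, h⟩
      by_cases hij : i ∈ J ∧ i ≠ j
      · rw [blowDown_of_mem hij.1 hij.2] at h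
        rcases mul_eq_zero.1 h with h | h
        · exact ⟨i, hi, h⟩
        · exact ⟨j, hJ hj, h⟩
      · exact ⟨i, hi, by rwa [blowDown_of_not hij] at h⟩
    · rintro ⟨i, hi, h⟩
      refine ⟨i, hi, ?_⟩
      by_cases hij : i ∈ J ∧ i ≠ j
      · rw [blowDown_of_mem hij.1 hij.2, h, zero_mul]
      · rwa [blowDown_of_not hij]

/-- The logarithmic coordinates of the blow up of `M`. -/
def blowUpChart (x₀ : BlowUp κ L) : LogChart (κ := κ) (BlowUp.proj κ L ⁻¹' N) where
  chart := P.patch.affineChart x₀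
  poles := P.logChart.poles
  isChart := P.patch.isCoordinateChart_affineChart x₀
  divisor := by
    intro x hx
    have h1 := BlowUpPatch.chart_proj hx
    have h2 := BlowUpPatch.proj_mem_source hx
    rw [patch_chart] at h1 h2
    rw [mem_preimage, P.logChart.divisor _ h2, h1, toCoord_mem_divisor]

end AdaptedPatch

end Adapted

end

noncomputable section

/-! ### The isomorphism of the two blow ups -/

section Isomorphism

open PatchFamily

variable {κ : Type} [Fintype κ] {M : Type*} [TopologicalSpace M] [ChartedSpace (κ → ℂ) M]
  [IsManifold 𝓘(ℂ, κ → ℂ) ω M] {N L : Set M}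

theorem IsTrivialCenter.subset (hL : IsTrivialCenter κ N L) : L ⊆ N := by
  intro o ho
  obtain ⟨e, I, J, -, hoe, h0, hI, -, hJI, hJ⟩ := hL.2 o ho
  obtain ⟨j, hj⟩ := Finset.card_pos.1 (by omega : 0 < J.card)
  exact (hI o hoe).2 (Finset.prod_eq_zero (hJI hj) (by rw [h0]; rfl))

/-- Near each point there are logarithmic coordinates which are adapted to the center. -/
theorem exists_logChart_off (hN : IsNormalCrossings κ N) (hL : IsClosed L) {o : M} (ho : o ∉ L) :
    ∃ c : LogChart (κ := κ) N, o ∈ c.chart.source ∧ Disjoint c.chart.source L := by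
  obtain ⟨e, K, he, hoe, -, hK⟩ := hN o
  refine ⟨⟨e.restrOpen Lᶜ hL.isOpen_compl, K,
    isCoordinateChart_iff.2 ((isCoordinateChart_iff.1 he).restrOpen _), fun x hx => hK x hx.1⟩,
    ⟨hoe, ho⟩, Set.disjoint_left.2 fun x hx => hx.2⟩

theorem AdaptedPatch.exists_point (hN : IsNormalCrossings κ N) (hL : IsTrivialCenter κ N L)
    (x : BlowUp κ L) : ∃ (P : AdaptedPatch (κ := κ) N L) (y : κ → ℂ)
      (hy : P.patch.toCoord y ∈ P.patch.chart.target), x = P.patch.point hy := by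
  by_cases hx : BlowUp.proj κ L x ∈ L
  · obtain ⟨e, I, J, he, hoe, -, hI, hJ, hJI, -⟩ := hL.2 _ hx
    obtain ⟨j, hj, y, hy, h⟩ := BlowUp.exists_mk_along hx he hoe hJ
    exact ⟨.along ⟨e, I, he, hI⟩ J hJ hJI j hj, y, hy, h⟩
  · obtain ⟨c, hoc, hc⟩ := exists_logChart_off hN hL.1 hx
    obtain ⟨y, hy, h⟩ := BlowUp.exists_mk_off hx c.isChart hoc hc
    exact ⟨.off c hc, y, hy, h⟩

theorem AdaptedPatch.exists_bundle_point (hN : IsNormalCrossings κ N) (hL : IsTrivialCenter κ N L)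
    (p₀ : LogCotangent κ N) (x : BlowUp (κ ⊕ κ) (LogCotangent.proj κ N ⁻¹' L)) :
    ∃ (P : AdaptedPatch (κ := κ) N L) (w : κ ⊕ κ → ℂ)
      (hw : (P.bundlePatch p₀).toCoord w ∈ (P.bundlePatch p₀).chart.target),
      x = (P.bundlePatch p₀).point hw := by
  by_cases hx : BlowUp.proj (κ ⊕ κ) (LogCotangent.proj κ N ⁻¹' L) x ∈ LogCotangent.proj κ N ⁻¹' L
  · obtain ⟨e, I, J, he, hoe, -, hI, hJ, hJI, -⟩ := hL.2 _ hx
    let c : LogChart (κ := κ) N := ⟨e, I, he, hI⟩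
    obtain ⟨j', hj', y, hy, h⟩ := BlowUp.exists_mk_along hx
      (LogCotangent.isCoordinateChart_bundleChart c p₀)
      (LogCotangent.mem_bundleChart_source.2 hoe)
      (LogCotangent.isCoordinateSubspace_bundleChart (c := c) hJ)
    obtain ⟨j, hj, rfl⟩ := Finset.mem_map.1 hj'
    exact ⟨.along c J hJ hJI j hj, y, hy, h⟩
  · obtain ⟨c, hoc, hc⟩ := exists_logChart_off hN hL.1 hx
    obtain ⟨y, hy, h⟩ := BlowUp.exists_mk_off hx (LogCotangent.isCoordinateChart_bundleChart c p₀)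
      (LogCotangent.mem_bundleChart_source.2 hoc) (Set.disjoint_left.2 fun _ hp hp' =>
        hc.le_bot ⟨LogCotangent.mem_bundleChart_source.1 hp, hp'⟩)
    exact ⟨.off c hc, y, hy, h⟩

/-- The inverse image of a normal crossings divisor under the blow up of a trivial center. -/
theorem IsTrivialCenter.isNormalCrossings_preimage (hN : IsNormalCrossings κ N)
    (hL : IsTrivialCenter κ N L) : IsNormalCrossings κ (BlowUp.proj κ L ⁻¹' N) := by
  intro x
  obtain ⟨P, y, hy, rfl⟩ := AdaptedPatch.exists_point hN hL x
  let c := P.blowUpChart (P.patch.point hy)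
  obtain ⟨e', K', -, h1, h2, h3, -, h4, -⟩ := c.divisor.exists_centered c.isChart
    (BlowUpPatch.point_mem_affineChart_source hy) Filter.univ_mem
  exact ⟨e', K', h1, h2, h3, h4⟩

/-- A point of the blow up of the logarithmic cotangent bundle corresponds to a point of the
logarithmic cotangent bundle of the blow up. -/
def IsCorresponding (N L : Set M) (x : BlowUp (κ ⊕ κ) (LogCotangent.proj κ N ⁻¹' L))
    (p : LogCotangent κ (BlowUp.proj κ L ⁻¹' N)) : Prop :=
  LogCotangent.proj κ N (BlowUp.proj (κ ⊕ κ) (LogCotangent.proj κ N ⁻¹' L) x) =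
    BlowUp.proj κ L (LogCotangent.proj κ (BlowUp.proj κ L ⁻¹' N) p) ∧
  (LogCotangent.proj κ N (BlowUp.proj (κ ⊕ κ) (LogCotangent.proj κ N ⁻¹' L) x) ∉ N →
    (LogCotangent.covector κ (BlowUp.proj κ L ⁻¹' N) p : (κ → ℂ) →L[ℂ] ℂ) =
      (LogCotangent.covector κ N (BlowUp.proj (κ ⊕ κ) (LogCotangent.proj κ N ⁻¹' L) x) :
        (κ → ℂ) →L[ℂ] ℂ).comp
        (mfderiv 𝓘(ℂ, κ → ℂ) 𝓘(ℂ, κ → ℂ) (BlowUp.proj κ L)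
          (LogCotangent.proj κ (BlowUp.proj κ L ⁻¹' N) p) : (κ → ℂ) →L[ℂ] (κ → ℂ)))

namespace AdaptedPatch

variable (P : AdaptedPatch (κ := κ) N L)

/-- The coordinate identity `sum_logFrame`, read on `M`: in adapted coordinates, pulling back by `ρ`
amounts to shifting the fibre coordinates. -/
theorem logCovector_shift {x₀ : BlowUp κ L} {x : BlowUp κ L}
    (hx : x ∈ (P.patch.affineChart x₀).source) (hN : BlowUp.proj κ L x ∉ N) (ξ : κ → ℂ) :
    logCovector (P.patch.affineChart x₀) P.logChart.poles (ξ + P.fibreShift ξ) x =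
      (logCovector P.logChart.chart P.logChart.poles ξ (BlowUp.proj κ L x)).comp
        (mfderiv 𝓘(ℂ, κ → ℂ) 𝓘(ℂ, κ → ℂ) (BlowUp.proj κ L) x) := by
  have h1 := BlowUpPatch.chart_proj hx
  have h2 := BlowUpPatch.proj_mem_source hx
  have h3 := BlowUpPatch.mfderiv_chart_comp_mfderiv_proj hx
  rw [patch_chart] at h1 h2 h3
  ext v
  have e1 : (logCovector P.logChart.chart P.logChart.poles ξ (BlowUp.proj κ L x)).comp
        (mfderiv 𝓘(ℂ, κ → ℂ) 𝓘(ℂ, κ → ℂ) (BlowUp.proj κ L) x) v =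
      logCovector P.logChart.chart P.logChart.poles ξ (BlowUp.proj κ L x)
        (mfderiv 𝓘(ℂ, κ → ℂ) 𝓘(ℂ, κ → ℂ) (BlowUp.proj κ L) x v) := rfl
  rw [e1, LogChart.logCovector_apply, LogChart.logCovector_apply, h1]
  refine Eq.trans (P.sum_logFrame (P.patch.affineChart x₀ x)
    (mfderiv 𝓘(ℂ, κ → ℂ) 𝓘(ℂ, κ → ℂ) (P.patch.affineChart x₀) x v) ξ fun i => by
      rw [← h1]; exact P.logChart.logDenominator_ne_zero h2 hN i) ?_
  refine Finset.sum_congr rfl fun i _ => ?_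
  congr 1
  exact (congrFun (DFunLike.congr_fun h3 v) i).symm

/-- The change of the fibre coordinates, as a biholomorphic map. -/
def shift : OpenPartialHomeomorph (κ ⊕ κ → ℂ) (κ ⊕ κ → ℂ) :=
  (Homeomorph.toOpenPartialHomeomorph
    { toFun := fun w => Sum.elim (w ∘ Sum.inl) (w ∘ Sum.inr + P.fibreShift (w ∘ Sum.inr))
      invFun := fun w => Sum.elim (w ∘ Sum.inl) (w ∘ Sum.inr - P.fibreShift (w ∘ Sum.inr))
      left_inv := fun w => by
        funext k
        cases k <;> simp [P.fibreShift_fibreShift]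
      right_inv := fun w => by
        funext k
        cases k <;> simp [P.fibreShift_fibreShift]
      continuous_toFun := by
        refine continuous_pi fun k => ?_
        cases k <;> simp only [Sum.elim_inl, Sum.elim_inr, Pi.add_apply] <;> fun_prop
      continuous_invFun := by
        refine continuous_pi fun k => ?_
        cases k <;> simp only [Sum.elim_inl, Sum.elim_inr, Pi.sub_apply] <;> fun_prop })

theorem shift_apply (w : κ ⊕ κ → ℂ) :
    P.shift w = Sum.elim (w ∘ Sum.inl) (w ∘ Sum.inr + P.fibreShift (w ∘ Sum.inr)) := rfl

theorem contDiff_comp_sum {κ' : Type} [Fintype κ'] (f : κ' → κ) :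
    ContDiff ℂ ω (fun w : κ → ℂ => w ∘ f) :=
  contDiff_pi.2 fun i => contDiff_apply ℂ ℂ (f i)

theorem isBiholomorphic_shift : IsBiholomorphic (κ ⊕ κ) P.shift := by
  have h1 : ContDiff ℂ ω (fun w : κ ⊕ κ → ℂ => w ∘ Sum.inl) := contDiff_comp_sum _
  have h2 : ContDiff ℂ ω (fun w : κ ⊕ κ → ℂ => w ∘ Sum.inr) := contDiff_comp_sum _
  have h3 : ContDiff ℂ ω (fun w : κ ⊕ κ → ℂ => P.fibreShift (w ∘ Sum.inr)) :=
    P.fibreShift.contDiff.comp h2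
  constructor
  · refine (contMDiff_iff_contDiff.2 (contDiff_pi.2 fun k => ?_)).contMDiffOn
    cases k with
    | inl i => exact contDiff_pi.1 h1 i
    | inr i => exact contDiff_pi.1 (h2.add h3) i
  · refine (contMDiff_iff_contDiff.2 (contDiff_pi.2 fun k => ?_)).contMDiffOn
    cases k with
    | inl i => exact contDiff_pi.1 h1 i
    | inr i => exact contDiff_pi.1 (h2.sub h3) i

variable (p₀ : LogCotangent κ N) (x₀ : BlowUp κ L)
  (x₁ : BlowUp (κ ⊕ κ) (LogCotangent.proj κ N ⁻¹' L))
  (p₁ : LogCotangent κ (BlowUp.proj κ L ⁻¹' N))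

/-- The isomorphism in adapted coordinates. -/
def localIso : OpenPartialHomeomorph (BlowUp (κ ⊕ κ) (LogCotangent.proj κ N ⁻¹' L))
    (LogCotangent κ (BlowUp.proj κ L ⁻¹' N)) :=
  (((P.bundlePatch p₀).affineChart x₁).trans P.shift).trans
    (LogCotangent.bundleChart (P.blowUpChart x₀) p₁).symm

theorem isBiholomorphic_localIso : IsBiholomorphic (κ ⊕ κ) (P.localIso p₀ x₀ x₁ p₁) :=
  ((isCoordinateChart_iff.1 ((P.bundlePatch p₀).isCoordinateChart_affineChart x₁)).trans
    P.isBiholomorphic_shift).trans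
    (isCoordinateChart_iff.1 (LogCotangent.isCoordinateChart_bundleChart (P.blowUpChart x₀) p₁)).symm

variable {p₀ x₀ x₁ p₁}

theorem localIso_point {w : κ ⊕ κ → ℂ}
    (hw : (P.bundlePatch p₀).toCoord w ∈ (P.bundlePatch p₀).chart.target) :
    P.localIso p₀ x₀ x₁ p₁ ((P.bundlePatch p₀).point hw) =
      (P.blowUpChart x₀).point (u := w ∘ Sum.inl) ((P.mem_bundlePatch_dom p₀).1 hw)
        (w ∘ Sum.inr + P.fibreShift (w ∘ Sum.inr)) := by
  change (LogCotangent.bundleChart (P.blowUpChart x₀) p₁).symm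
    (P.shift ((P.bundlePatch p₀).affineChart x₁ ((P.bundlePatch p₀).point hw))) = _
  rw [BlowUpPatch.affineChart_point, P.shift_apply]
  exact LogCotangent.bundleChart_symm _

theorem mem_localIso_source {x : BlowUp (κ ⊕ κ) (LogCotangent.proj κ N ⁻¹' L)} :
    x ∈ (P.localIso p₀ x₀ x₁ p₁).source ↔ ∃ (w : κ ⊕ κ → ℂ)
      (hw : (P.bundlePatch p₀).toCoord w ∈ (P.bundlePatch p₀).chart.target),
      x = (P.bundlePatch p₀).point hw := by
  constructor
  · rintro ⟨⟨hx, -⟩, -⟩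
    exact (BlowUpPatch.mem_affineChart_source (x₀ := x₁)).1 hx
  · rintro ⟨w, hw, rfl⟩
    refine ⟨⟨BlowUpPatch.point_mem_affineChart_source (x₀ := x₁) hw, trivial⟩, ?_⟩
    change P.shift ((P.bundlePatch p₀).affineChart x₁ ((P.bundlePatch p₀).point hw)) ∘ Sum.inl ∈
      (P.blowUpChart x₀).chart.target
    rw [BlowUpPatch.affineChart_point]
    have h := (P.mem_bundlePatch_dom p₀).1 hw
    exact h

theorem proj_bundle_point {w : κ ⊕ κ → ℂ}
    (hw : (P.bundlePatch p₀).toCoord w ∈ (P.bundlePatch p₀).chart.target) :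
    BlowUp.proj (κ ⊕ κ) (LogCotangent.proj κ N ⁻¹' L) ((P.bundlePatch p₀).point hw) =
      P.logChart.point (u := P.patch.toCoord (w ∘ Sum.inl)) (by
        rw [← patch_chart]; exact (P.mem_bundlePatch_dom p₀).1 hw) (w ∘ Sum.inr) := by
  rw [BlowUpPatch.proj_point]
  have h1 : P.patch.toCoord (w ∘ Sum.inl) ∈ P.logChart.chart.target := by
    rw [← patch_chart]; exact (P.mem_bundlePatch_dom p₀).1 hw
  have h2 : (P.bundlePatch p₀).chart.symm ((P.bundlePatch p₀).toCoord w) =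
      (LogCotangent.bundleChart P.logChart p₀).symm
        (Sum.elim (P.patch.toCoord (w ∘ Sum.inl)) (w ∘ Sum.inr)) := by
    rw [bundlePatch_chart, bundlePatch_toCoord]
  refine h2.trans ?_
  exact LogCotangent.bundleChart_symm (w := Sum.elim (P.patch.toCoord (w ∘ Sum.inl)) (w ∘ Sum.inr)) h1

theorem isCorresponding_localIso (x : BlowUp (κ ⊕ κ) (LogCotangent.proj κ N ⁻¹' L))
    (hx : x ∈ (P.localIso p₀ x₀ x₁ p₁).source) :
    IsCorresponding N L x (P.localIso p₀ x₀ x₁ p₁ x) := by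
  obtain ⟨w, hw, rfl⟩ := P.mem_localIso_source.1 hx
  rw [localIso_point]
  have hd := (P.mem_bundlePatch_dom p₀).1 hw
  have hd' : P.patch.toCoord (w ∘ Sum.inl) ∈ P.logChart.chart.target := by
    rw [← patch_chart]; exact hd
  have hsymm : (P.blowUpChart x₀).chart.symm (w ∘ Sum.inl) = P.patch.point hd :=
    BlowUpPatch.affineChart_symm hd
  have hbase : LogCotangent.proj κ N (BlowUp.proj (κ ⊕ κ) (LogCotangent.proj κ N ⁻¹' L)
      ((P.bundlePatch p₀).point hw)) = P.logChart.chart.symm (P.patch.toCoord (w ∘ Sum.inl)) := by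
    rw [proj_bundle_point]; rfl
  have hbase' : BlowUp.proj κ L (P.patch.point hd) =
      P.logChart.chart.symm (P.patch.toCoord (w ∘ Sum.inl)) := by
    rw [BlowUpPatch.proj_point, patch_chart]
  refine ⟨?_, fun hN => ?_⟩
  · exact hbase.trans ((congrArg (BlowUp.proj κ L) hsymm).trans hbase').symm
  · rw [hbase] at hN
    have e1 := P.logChart.covector_point hd' (w ∘ Sum.inr) hN
    have e2 := (P.blowUpChart x₀).covector_point (u := w ∘ Sum.inl) hd
      (w ∘ Sum.inr + P.fibreShift (w ∘ Sum.inr)) (by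
        rw [hsymm, mem_preimage, hbase']; exact hN)
    have e3 := P.logCovector_shift (x₀ := x₀) (BlowUpPatch.point_mem_affineChart_source hd)
      (by rw [hbase']; exact hN) (w ∘ Sum.inr)
    -- The base points on the two sides are only propositionally equal, so the identities are
    -- generalized over the point before substituting.
    have e4 : ∀ q, q = P.logChart.point hd' (w ∘ Sum.inr) →
        (LogCotangent.covector κ N q : (κ → ℂ) →L[ℂ] ℂ) = logCovector P.logChart.chart
          P.logChart.poles (w ∘ Sum.inr) (P.logChart.chart.symm (P.patch.toCoord (w ∘ Sum.inl))) := by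
      rintro q rfl; exact e1
    have e5 : ∀ b, b = P.patch.point hd →
        (logCovector (P.patch.affineChart x₀) P.logChart.poles
          (w ∘ Sum.inr + P.fibreShift (w ∘ Sum.inr)) b : (κ → ℂ) →L[ℂ] ℂ) =
        (logCovector P.logChart.chart P.logChart.poles (w ∘ Sum.inr)
          (P.logChart.chart.symm (P.patch.toCoord (w ∘ Sum.inl))) : (κ → ℂ) →L[ℂ] ℂ).comp
        (mfderiv 𝓘(ℂ, κ → ℂ) 𝓘(ℂ, κ → ℂ) (BlowUp.proj κ L) b : (κ → ℂ) →L[ℂ] (κ → ℂ)) := by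
      rintro b rfl
      rw [← hbase']; exact e3
    have e6 := e5 _ hsymm
    rw [← e4 _ (P.proj_bundle_point hw)] at e6
    exact e2.trans e6

end AdaptedPatch

end Isomorphism

end

noncomputable section

/-! ### The global isomorphism, its compatibility with the canonical forms and with scalars -/

section GlobalIsomorphism

open PatchFamily

variable {κ : Type} [Fintype κ] {M : Type*} [TopologicalSpace M] [ChartedSpace (κ → ℂ) M]
  [IsManifold 𝓘(ℂ, κ → ℂ) ω M] {N L : Set M}

/-- Off the center `ρ` is a local isomorphism. Surjectivity lets a covector of `M` be recovered from
its pull back. -/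
theorem BlowUp.mfderiv_proj_surjective (hL : IsClosed L) {x : BlowUp κ L}
    (hx : BlowUp.proj κ L x ∉ L) :
    Function.Surjective (mfderiv 𝓘(ℂ, κ → ℂ) 𝓘(ℂ, κ → ℂ) (BlowUp.proj κ L) x) := by
  obtain ⟨φ, hφ, hxφ, -, h⟩ := BlowUp.exists_isBiholomorphic hL hx
  have h1 : mfderiv 𝓘(ℂ, κ → ℂ) 𝓘(ℂ, κ → ℂ) (BlowUp.proj κ L) x =
      mfderiv 𝓘(ℂ, κ → ℂ) 𝓘(ℂ, κ → ℂ) φ x :=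
    (Filter.eventuallyEq_of_mem (φ.open_source.mem_nhds hxφ) fun z hz => (h z hz).symm).mfderiv_eq
  intro v
  refine ⟨mfderiv 𝓘(ℂ, κ → ℂ) 𝓘(ℂ, κ → ℂ) φ.symm (φ x) v, ?_⟩
  rw [h1]
  exact DFunLike.congr_fun (hφ.mfderiv_symm_comp hxφ) v

namespace IsCorresponding

variable {x x' : BlowUp (κ ⊕ κ) (LogCotangent.proj κ N ⁻¹' L)}
  {p p' : LogCotangent κ (BlowUp.proj κ L ⁻¹' N)}

/-- Off `N`, hence off `L`, the point of the blow up is determined by its image in `M`, and the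
covector by the pull back. -/
theorem eq_right (hLN : L ⊆ N) (h : IsCorresponding N L x p) (h' : IsCorresponding N L x p')
    (hx : LogCotangent.proj κ N (BlowUp.proj (κ ⊕ κ) (LogCotangent.proj κ N ⁻¹' L) x) ∉ N) :
    p = p' := by
  have hb : LogCotangent.proj κ _ p = LogCotangent.proj κ _ p' :=
    BlowUp.eq_of_proj_eq (h.1.symm.trans h'.1) fun hl => hx (by rw [h.1]; exact hLN hl)
  refine LogCotangent.eq_of_covector_eq hb (fun hn => hx (by rw [h.1]; exact hn)) ?_
  have e := h.2 hx
  rw [hb] at e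
  exact e.trans (h'.2 hx).symm

theorem eq_left (hL : IsClosed L) (hLN : L ⊆ N) (h : IsCorresponding N L x p)
    (h' : IsCorresponding N L x' p)
    (hp : BlowUp.proj κ L (LogCotangent.proj κ (BlowUp.proj κ L ⁻¹' N) p) ∉ N) : x = x' := by
  have hxN : LogCotangent.proj κ N (BlowUp.proj (κ ⊕ κ) (LogCotangent.proj κ N ⁻¹' L) x) ∉ N := by
    rw [h.1]; exact hp
  have hxN' : LogCotangent.proj κ N (BlowUp.proj (κ ⊕ κ) (LogCotangent.proj κ N ⁻¹' L) x') ∉ N := by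
    rw [h'.1]; exact hp
  refine BlowUp.eq_of_proj_eq (LogCotangent.eq_of_covector_eq (h.1.trans h'.1.symm) hxN ?_)
    fun hl => hxN (hLN hl)
  refine ContinuousLinearMap.ext fun v => ?_
  obtain ⟨w, rfl⟩ := BlowUp.mfderiv_proj_surjective hL (fun hl => hp (hLN hl)) v
  exact DFunLike.congr_fun ((h.2 hxN).symm.trans (h'.2 hxN')) w

end IsCorresponding

theorem exists_localIso_source (hN : IsNormalCrossings κ N) (hL : IsTrivialCenter κ N L)
    (x : BlowUp (κ ⊕ κ) (LogCotangent.proj κ N ⁻¹' L)) :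
    ∃ (P : AdaptedPatch (κ := κ) N L) (p₀ : LogCotangent κ N) (x₀ : BlowUp κ L)
      (p₁ : LogCotangent κ (BlowUp.proj κ L ⁻¹' N)), x ∈ (P.localIso p₀ x₀ x p₁).source := by
  obtain ⟨P, w, hw, h⟩ := AdaptedPatch.exists_bundle_point hN hL
    (BlowUp.proj (κ ⊕ κ) (LogCotangent.proj κ N ⁻¹' L) x) x
  have hd := (P.mem_bundlePatch_dom _).1 hw
  -- The points `p₀`, `x₀`, `p₁` are mere default values in the charts, so the zero covector will
  -- do.
  exact ⟨P, _, P.patch.point hd, (P.blowUpChart (P.patch.point hd)).point (u := w ∘ Sum.inl) hd 0,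
    P.mem_localIso_source.2 ⟨w, hw, h⟩⟩

/-- The points of the logarithmic cotangent bundle of the blow up in adapted coordinates. -/
theorem AdaptedPatch.exists_eq_localIso (P : AdaptedPatch (κ := κ) N L) {p₀ : LogCotangent κ N}
    {x₀ : BlowUp κ L} {x₁ : BlowUp (κ ⊕ κ) (LogCotangent.proj κ N ⁻¹' L)}
    {p₁ : LogCotangent κ (BlowUp.proj κ L ⁻¹' N)} {u : κ → ℂ}
    (hu : u ∈ (P.blowUpChart x₀).chart.target) (η : κ → ℂ) :
    ∃ hw : (P.bundlePatch p₀).toCoord (Sum.elim u (η - P.fibreShift η)) ∈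
        (P.bundlePatch p₀).chart.target,
      P.localIso p₀ x₀ x₁ p₁ ((P.bundlePatch p₀).point hw) = (P.blowUpChart x₀).point hu η := by
  have hw : (P.bundlePatch p₀).toCoord (Sum.elim u (η - P.fibreShift η)) ∈
      (P.bundlePatch p₀).chart.target := (P.mem_bundlePatch_dom p₀).2 hu
  refine ⟨hw, (P.localIso_point hw).trans (LogChart.point_congr _ _ _ rfl ?_)⟩
  simp [P.fibreShift_fibreShift]

theorem exists_localIso_target (hN : IsNormalCrossings κ N) (hL : IsTrivialCenter κ N L)
    (p : LogCotangent κ (BlowUp.proj κ L ⁻¹' N)) :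
    ∃ (P : AdaptedPatch (κ := κ) N L) (p₀ : LogCotangent κ N)
      (x₁ : BlowUp (κ ⊕ κ) (LogCotangent.proj κ N ⁻¹' L)),
      LogCotangent.proj κ _ p ∈ (P.blowUpChart (LogCotangent.proj κ _ p)).chart.source ∧
      p ∈ (P.localIso p₀ (LogCotangent.proj κ _ p) x₁ p).target := by
  obtain ⟨P, y, hy, h⟩ := AdaptedPatch.exists_point hN hL (LogCotangent.proj κ _ p)
  have hs : LogCotangent.proj κ _ p ∈ (P.blowUpChart (LogCotangent.proj κ _ p)).chart.source :=
    BlowUpPatch.mem_affineChart_source.2 ⟨y, hy, h⟩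
  obtain ⟨u, hu, η, hp⟩ := LogCotangent.exists_eq_point _ hs
  let p₀ : LogCotangent κ N := P.logChart.point (u := P.patch.toCoord y)
    (by rw [← AdaptedPatch.patch_chart]; exact hy) 0
  have hw : (P.bundlePatch p₀).toCoord (Sum.elim u (η - P.fibreShift η)) ∈
      (P.bundlePatch p₀).chart.target := (P.mem_bundlePatch_dom p₀).2 hu
  refine ⟨P, p₀, (P.bundlePatch p₀).point hw, hs, ?_⟩
  obtain ⟨hw', h'⟩ := P.exists_eq_localIso (p₀ := p₀) (x₁ := (P.bundlePatch p₀).point hw) (p₁ := p)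
    hu η
  have hm : (P.bundlePatch p₀).point hw' ∈
      (P.localIso p₀ (LogCotangent.proj κ _ p) ((P.bundlePatch p₀).point hw) p).source :=
    P.mem_localIso_source.2 ⟨_, hw', rfl⟩
  have := OpenPartialHomeomorph.map_source _ hm
  rw [h', ← hp] at this
  exact this

/-- Density off the center alone would not suffice, as `N` is larger than `L`. The statement is
transported by the local isomorphisms from the bundle of the blow up, whose part off the poles is
dense. -/
theorem dense_proj_proj_notMem (hN : IsNormalCrossings κ N) (hL : IsTrivialCenter κ N L) :
    Dense {x : BlowUp (κ ⊕ κ) (LogCotangent.proj κ N ⁻¹' L) |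
      LogCotangent.proj κ N (BlowUp.proj (κ ⊕ κ) (LogCotangent.proj κ N ⁻¹' L) x) ∉ N} := by
  intro x
  obtain ⟨P, p₀, x₀, p₁, hx⟩ := exists_localIso_source hN hL x
  set φ := P.localIso p₀ x₀ x p₁
  rw [mem_closure_iff_nhds]
  intro t ht
  have h1 : φ.symm ⁻¹' t ∩ φ.target ∈ 𝓝 (φ x) :=
    Filter.inter_mem ((φ.symm.continuousAt (φ.map_source hx)).preimage_mem_nhds
      (by rw [φ.left_inv hx]; exact ht)) (φ.open_target.mem_nhds (φ.map_source hx))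
  obtain ⟨q, ⟨hqt, hq⟩, hqN⟩ := mem_closure_iff_nhds.1
    (LogCotangent.dense_proj_notMem (κ := κ) (N := BlowUp.proj κ L ⁻¹' N) (φ x)) _ h1
  refine ⟨φ.symm q, hqt, fun hn => hqN ?_⟩
  have h2 := (P.isCorresponding_localIso _ (φ.map_target hq)).1
  rw [φ.right_inv hq] at h2
  rw [h2] at hn
  exact hn

/-- The blow up of the logarithmic cotangent bundle is the logarithmic cotangent bundle of the
blow up. -/
theorem exists_diffeomorph [T2Space M] (hN : IsNormalCrossings κ N) (hL : IsTrivialCenter κ N L) :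
    ∃ Φ : BlowUp (κ ⊕ κ) (LogCotangent.proj κ N ⁻¹' L)
        ≃ₘ^ω⟮𝓘(ℂ, κ ⊕ κ → ℂ), 𝓘(ℂ, κ ⊕ κ → ℂ)⟯ LogCotangent κ (BlowUp.proj κ L ⁻¹' N),
      (∀ x, IsCorresponding N L x (Φ x)) ∧
      ∀ φ : OpenPartialHomeomorph (BlowUp (κ ⊕ κ) (LogCotangent.proj κ N ⁻¹' L))
        (LogCotangent κ (BlowUp.proj κ L ⁻¹' N)), (∀ z ∈ φ.source, IsCorresponding N L z (φ z)) →
        ∀ x ∈ φ.source, Φ x = φ x := by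
  have i1 : T2Space (LogCotangent κ N) := LogCotangent.t2Space
  have i2 : T2Space (BlowUp (κ ⊕ κ) (LogCotangent.proj κ N ⁻¹' L)) := BlowUp.t2Space
  have i3 : T2Space (BlowUp κ L) := BlowUp.t2Space
  have i4 : T2Space (LogCotangent κ (BlowUp.proj κ L ⁻¹' N)) := LogCotangent.t2Space
  refine exists_diffeomorph_of_relation (dense_proj_proj_notMem hN hL)
    (fun x hx p p' h h' => h.eq_right hL.subset h' hx)
    (LogCotangent.dense_proj_notMem (κ := κ) (N := BlowUp.proj κ L ⁻¹' N))
    (fun p hp x x' h h' => h.eq_left hL.1 hL.subset h' hp) (fun x => ?_) (fun p => ?_)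
  · obtain ⟨P, p₀, x₀, p₁, hx⟩ := exists_localIso_source hN hL x
    exact ⟨_, P.isBiholomorphic_localIso _ _ _ _, P.isCorresponding_localIso, hx⟩
  · obtain ⟨P, p₀, x₁, -, hx⟩ := exists_localIso_target hN hL p
    exact ⟨_, P.isBiholomorphic_localIso _ _ _ _, P.isCorresponding_localIso, hx⟩

variable {Φ : BlowUp (κ ⊕ κ) (LogCotangent.proj κ N ⁻¹' L)
    ≃ₘ^ω⟮𝓘(ℂ, κ ⊕ κ → ℂ), 𝓘(ℂ, κ ⊕ κ → ℂ)⟯ LogCotangent κ (BlowUp.proj κ L ⁻¹' N)}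

/-- Chain rule: with `α` the covector of `τ x`, both forms are `α` composed with the derivative of a
map to `M`, and these maps `π ∘ τ` and `ρ ∘ π' ∘ Φ` coincide. -/
theorem IsCorresponding.pullbackForm_eq (h : ∀ x, IsCorresponding N L x (Φ x))
    {x : BlowUp (κ ⊕ κ) (LogCotangent.proj κ N ⁻¹' L)}
    (hx : LogCotangent.proj κ N (BlowUp.proj (κ ⊕ κ) (LogCotangent.proj κ N ⁻¹' L) x) ∉ N) :
    pullbackForm (κ ⊕ κ) (κ ⊕ κ) Φ (LogCotangent.canonicalForm κ (BlowUp.proj κ L ⁻¹' N)) x =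
      pullbackForm (κ ⊕ κ) (κ ⊕ κ) (BlowUp.proj (κ ⊕ κ) (LogCotangent.proj κ N ⁻¹' L))
        (LogCotangent.canonicalForm κ N) x := by
  have d1 : MDifferentiable 𝓘(ℂ, κ ⊕ κ → ℂ) 𝓘(ℂ, κ ⊕ κ → ℂ) Φ :=
    Φ.contMDiff_toFun.mdifferentiable (by simp)
  have d2 : MDifferentiable 𝓘(ℂ, κ ⊕ κ → ℂ) 𝓘(ℂ, κ → ℂ)
      (LogCotangent.proj κ (BlowUp.proj κ L ⁻¹' N)) :=
    LogCotangent.contMDiff_proj.mdifferentiable (by simp)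
  have d3 : MDifferentiable 𝓘(ℂ, κ → ℂ) 𝓘(ℂ, κ → ℂ) (BlowUp.proj κ L) :=
    BlowUp.contMDiff_proj.mdifferentiable (by simp)
  have d4 : MDifferentiable 𝓘(ℂ, κ ⊕ κ → ℂ) 𝓘(ℂ, κ ⊕ κ → ℂ)
      (BlowUp.proj (κ ⊕ κ) (LogCotangent.proj κ N ⁻¹' L)) :=
    BlowUp.contMDiff_proj.mdifferentiable (by simp)
  have d5 : MDifferentiable 𝓘(ℂ, κ ⊕ κ → ℂ) 𝓘(ℂ, κ → ℂ) (LogCotangent.proj κ N) :=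
    LogCotangent.contMDiff_proj.mdifferentiable (by simp)
  have hfun : (LogCotangent.proj κ N ∘ BlowUp.proj (κ ⊕ κ) (LogCotangent.proj κ N ⁻¹' L)) =
      BlowUp.proj κ L ∘ (LogCotangent.proj κ (BlowUp.proj κ L ⁻¹' N) ∘ Φ) :=
    funext fun z => (h z).1
  have e1 := mfderiv_comp x (d5 _) (d4 x)
  have e2 := mfderiv_comp x (d3 _) ((d2.comp d1) x)
  have e3 := mfderiv_comp x (d2 _) (d1 x)
  refine ContinuousLinearMap.ext fun v => ?_
  have c1 := DFunLike.congr_fun ((h x).2 hx)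
    (mfderiv 𝓘(ℂ, κ ⊕ κ → ℂ) 𝓘(ℂ, κ → ℂ)
      (LogCotangent.proj κ (BlowUp.proj κ L ⁻¹' N)) (Φ x) (mfderiv 𝓘(ℂ, κ ⊕ κ → ℂ) 𝓘(ℂ, κ ⊕ κ → ℂ) Φ x v))
  refine Eq.trans c1 ?_
  refine congrArg (LogCotangent.covector κ N
    (BlowUp.proj (κ ⊕ κ) (LogCotangent.proj κ N ⁻¹' L) x) : (κ → ℂ) →L[ℂ] ℂ) ?_
  have c2 := DFunLike.congr_fun e1 v
  have c3 := DFunLike.congr_fun e2 v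
  have c4 := DFunLike.congr_fun e3 v
  have c5 : ∀ f g : BlowUp (κ ⊕ κ) (LogCotangent.proj κ N ⁻¹' L) → M, f = g →
      (mfderiv 𝓘(ℂ, κ ⊕ κ → ℂ) 𝓘(ℂ, κ → ℂ) f x v : κ → ℂ) =
        mfderiv 𝓘(ℂ, κ ⊕ κ → ℂ) 𝓘(ℂ, κ → ℂ) g x v := by
    rintro f _ rfl; rfl
  refine Eq.trans ?_ ((c3.symm.trans (c5 _ _ hfun).symm).trans c2)
  exact congrArg (mfderiv 𝓘(ℂ, κ → ℂ) 𝓘(ℂ, κ → ℂ) (BlowUp.proj κ L)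
    (LogCotangent.proj κ (BlowUp.proj κ L ⁻¹' N) (Φ x)) : (κ → ℂ) →L[ℂ] (κ → ℂ)) c4.symm

theorem IsCorresponding.isLogSymplecticPotential (hN : IsNormalCrossings κ N)
    (hL : IsTrivialCenter κ N L) (h : ∀ x, IsCorresponding N L x (Φ x)) :
    IsLogSymplecticPotential (κ ⊕ κ) (BlowUp.proj (κ ⊕ κ) (LogCotangent.proj κ N ⁻¹' L) ⁻¹'
        (LogCotangent.proj κ N ⁻¹' N))
      (pullbackForm (κ ⊕ κ) (κ ⊕ κ) (BlowUp.proj (κ ⊕ κ) (LogCotangent.proj κ N ⁻¹' L))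
        (LogCotangent.canonicalForm κ N)) := by
  have hs : BlowUp.proj (κ ⊕ κ) (LogCotangent.proj κ N ⁻¹' L) ⁻¹' (LogCotangent.proj κ N ⁻¹' N) =
      Φ ⁻¹' (LogCotangent.proj κ (BlowUp.proj κ L ⁻¹' N) ⁻¹' (BlowUp.proj κ L ⁻¹' N)) := by
    ext x
    simp only [mem_preimage, (h x).1]
  rw [hs]
  refine (LogCotangent.isLogSymplecticPotential (hL.isNormalCrossings_preimage hN)).pullback Φ ?_
  intro x hx
  refine (IsCorresponding.pullbackForm_eq h fun hn => hx ?_).symm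
  rw [(h x).1] at hn
  exact hn

theorem LogCotangent.isMultiple_iff_point {t : ℂ} {p q : LogCotangent κ N} :
    LogCotangent.IsMultiple κ N t p q ↔ ∃ (c : LogChart (κ := κ) N) (u : κ → ℂ)
      (hu : u ∈ c.chart.target) (ξ : κ → ℂ), p = c.point hu ξ ∧ q = c.point hu (t • ξ) := by
  constructor
  · rintro ⟨c, y, z, rfl, rfl, h1, h2⟩
    refine ⟨c, y.1 ∘ Sum.inl, y.2, y.1 ∘ Sum.inr, c.mk_eq_point y, (c.mk_eq_point z).trans ?_⟩
    exact c.point_congr _ _ (funext h1) (funext h2)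
  · rintro ⟨c, u, hu, ξ, rfl, rfl⟩
    exact ⟨c, ⟨Sum.elim u ξ, hu⟩, ⟨Sum.elim u (t • ξ), hu⟩, rfl, rfl, fun _ => rfl, fun _ => rfl⟩

/-- Scalar multiplication can be tested in any chart, because coordinate changes are linear in the
fibres. -/
theorem LogCotangent.IsMultiple.exists_of_mem_source {t : ℂ} {p q : LogCotangent κ N}
    (h : LogCotangent.IsMultiple κ N t p q) (c : LogChart (κ := κ) N)
    (hc : LogCotangent.proj κ N p ∈ c.chart.source) : ∃ (u : κ → ℂ)
      (hu : u ∈ c.chart.target) (ξ : κ → ℂ), p = c.point hu ξ ∧ q = c.point hu (t • ξ) := by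
  obtain ⟨c', u, hu, ξ, rfl, rfl⟩ := LogCotangent.isMultiple_iff_point.1 h
  obtain ⟨A, hA⟩ := c'.exists_point_eq c hu hc
  refine ⟨_, c.chart.map_source hc, _, hA ξ, (hA (t • ξ)).trans (c.point_congr _ _ rfl ?_)⟩
  funext k
  simp [Finset.mul_sum, mul_assoc]

/-- In adapted coordinates `τ ∘ Φ⁻¹` sends `η` to `η - shift η` in the fibre, and this is linear. -/
theorem IsCorresponding.isMultiple (hN : IsNormalCrossings κ N) (hL : IsTrivialCenter κ N L)
    (hΦ : ∀ φ : OpenPartialHomeomorph (BlowUp (κ ⊕ κ) (LogCotangent.proj κ N ⁻¹' L))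
        (LogCotangent κ (BlowUp.proj κ L ⁻¹' N)), (∀ z ∈ φ.source, IsCorresponding N L z (φ z)) →
        ∀ x ∈ φ.source, Φ x = φ x) {t : ℂ} {p q : LogCotangent κ (BlowUp.proj κ L ⁻¹' N)}
    (h : LogCotangent.IsMultiple κ (BlowUp.proj κ L ⁻¹' N) t p q) :
    LogCotangent.IsMultiple κ N t
      (BlowUp.proj (κ ⊕ κ) (LogCotangent.proj κ N ⁻¹' L) (Φ.symm p))
      (BlowUp.proj (κ ⊕ κ) (LogCotangent.proj κ N ⁻¹' L) (Φ.symm q)) := by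
  obtain ⟨P, p₀, x₁, hs, -⟩ := exists_localIso_target hN hL p
  obtain ⟨u, hu, η, hp, hq⟩ := h.exists_of_mem_source _ hs
  have key : ∀ (η : κ → ℂ) (r : LogCotangent κ (BlowUp.proj κ L ⁻¹' N)),
      r = (P.blowUpChart (LogCotangent.proj κ _ p)).point hu η →
      ∃ hd : P.patch.toCoord u ∈ P.logChart.chart.target,
      BlowUp.proj (κ ⊕ κ) (LogCotangent.proj κ N ⁻¹' L) (Φ.symm r) =
        P.logChart.point hd (η - P.fibreShift η) := by
    intro η r hr
    obtain ⟨hw, h'⟩ := P.exists_eq_localIso (p₀ := p₀) (x₁ := x₁) (p₁ := p) hu η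
    have hm := (P.mem_localIso_source (x₀ := LogCotangent.proj κ _ p) (x₁ := x₁) (p₁ := p)).2
      ⟨_, hw, rfl⟩
    have h1 := (hΦ _ P.isCorresponding_localIso _ hm).trans (h'.trans hr.symm)
    have h2 : Φ.symm r = (P.bundlePatch p₀).point hw := by
      rw [← h1]; exact Φ.symm_apply_apply _
    rw [h2]
    exact ⟨_, P.proj_bundle_point hw⟩
  obtain ⟨hd, h1⟩ := key η p hp
  obtain ⟨_, h2⟩ := key (t • η) q hq
  refine LogCotangent.isMultiple_iff_point.2 ⟨P.logChart, _, hd, _, h1, h2.trans ?_⟩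
  rw [map_smul, smul_sub]

end GlobalIsomorphism

end

noncomputable section

/-! ### Proper inverse images of hypersurfaces -/

section Hypersurfaces

open PatchFamily

variable {κ : Type} [Fintype κ] {M : Type*} [TopologicalSpace M] [ChartedSpace (κ → ℂ) M]

theorem IsHypersurface.isClosed {S : Set M} (hS : IsHypersurface κ S) : IsClosed S := by
  rw [← isOpen_compl_iff, isOpen_iff_mem_nhds]
  intro o ho
  obtain ⟨U, hU, hoU, f, hf, h⟩ := hS.2 o
  have hc : ContinuousAt f o := (hf.continuousOn.continuousAt (hU.mem_nhds hoU))
  filter_upwards [hU.mem_nhds hoU, hc.eventually_ne fun h0 => ho ((h o hoU).2 h0)] with x hx hx0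
  exact fun hxS => hx0 ((h x hx).1 hxS)

variable [IsManifold 𝓘(ℂ, κ → ℂ) ω M] {N L S : Set M}

theorem properInverseImage_subset (hS : IsClosed S) :
    properInverseImage (BlowUp.proj κ L) L S ⊆ BlowUp.proj κ L ⁻¹' S :=
  closure_minimal (fun _ hx => hx.1) (hS.preimage BlowUp.continuous_proj)

theorem mem_properInverseImage_iff (hS : IsClosed S) {x : BlowUp κ L}
    (hx : BlowUp.proj κ L x ∉ L) :
    x ∈ properInverseImage (BlowUp.proj κ L) L S ↔ BlowUp.proj κ L x ∈ S :=
  ⟨fun h => properInverseImage_subset hS h, fun h => subset_closure ⟨h, hx⟩⟩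

/-- A nonempty open set upstairs meets the dense part off the center, where `ρ` is open, and would
give an open subset of `S`. -/
theorem BlowUp.interior_preimage (hL : IsClosed L) (hS : interior S = ∅) :
    interior (BlowUp.proj κ L ⁻¹' S) = ∅ := by
  rw [eq_empty_iff_forall_notMem]
  intro x hx
  obtain ⟨z, hz, hzL⟩ := mem_closure_iff.1 (BlowUp.dense_proj_notMem (κ := κ) (L := L) x) _
    isOpen_interior hx
  obtain ⟨φ, -, hzφ, -, h⟩ := BlowUp.exists_isBiholomorphic hL hzL
  have hopen := φ.isOpen_image_source_inter (s := interior (BlowUp.proj κ L ⁻¹' S)) isOpen_interior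
  have hsub : φ '' (φ.source ∩ interior (BlowUp.proj κ L ⁻¹' S)) ⊆ interior S := by
    refine interior_maximal ?_ hopen
    rintro _ ⟨w, ⟨hw, hw'⟩, rfl⟩
    rw [h w hw]
    have hwS : w ∈ BlowUp.proj κ L ⁻¹' S := interior_subset hw'
    exact hwS
  rw [hS] at hsub
  exact hsub ⟨z, ⟨hzφ, hz⟩, rfl⟩

/-- The proper inverse image near a point of the exceptional set. -/
theorem exists_equation_properInverseImage (hL : IsClosed L) (hS : IsHypersurface κ S)
    {e : OpenPartialHomeomorph M (κ → ℂ)} (he : IsCoordinateChart κ e) {J : Finset κ}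
    (hJ : IsCoordinateSubspace e J L) {j : κ} (hj : j ∈ J) {y : κ → ℂ}
    (hy : blowDown κ J j y ∈ e.target) (hyj : y j = 0) :
    ∃ U : Set (BlowUp κ L), IsOpen U ∧
      (BlowUpPatch.along e he J hJ j hj).point hy ∈ U ∧ ∃ f : BlowUp κ L → ℂ,
        ContMDiffOn 𝓘(ℂ, κ → ℂ) 𝓘(ℂ, ℂ) ω f U ∧
        ∀ x ∈ U, x ∈ properInverseImage (BlowUp.proj κ L) L S ↔ f x = 0 := by
  set P := BlowUpPatch.along e he J hJ j hj with hP
  obtain ⟨U, hU, hoU, f, hf, hfS⟩ := hS.2 (e.symm (blowDown κ J j y))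
  let F : (κ → ℂ) → ℂ := fun w => f (e.symm (blowDown κ J j w))
  have hF : AnalyticAt ℂ F y :=
    (he.analyticAt_function hy (hf.contMDiffAt (hU.mem_nhds hoU))).fun_comp (analyticAt_blowDown J j y)
  have hW := P.eventually_base_mem hy (hU.mem_nhds hoU)
  let c := P.affineChart (P.point hy)
  have hyc : y ∈ c.target := BlowUpPatch.mem_affineChart_target.2 hy
  have hproj : ∀ x ∈ c.source, BlowUp.proj κ L x = e.symm (blowDown κ J j (c x)) := by
    intro x hx
    have h1 := BlowUpPatch.chart_proj hx
    have h2 := BlowUpPatch.proj_mem_source hx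
    exact (e.left_inv h2).symm.trans (congrArg e.symm h1)
  -- If the pulled back equation vanished near `y`, the inverse image of `S` would have interior. So
  -- a maximal power of `y_j` can be split off, and the cofactor is the equation sought.
  have hne : ¬ ∀ᶠ w in 𝓝 y, F w = 0 := by
    intro h0
    have hpt : P.point hy ∈ interior (BlowUp.proj κ L ⁻¹' S) := by
      have hcs : P.point hy ∈ c.source := BlowUpPatch.point_mem_affineChart_source (P := P) hy
      have hcy : c (P.point hy) = y := BlowUpPatch.affineChart_point (P := P) hy
      have ht : Filter.Tendsto c (𝓝 (P.point hy)) (𝓝 y) := by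
        have := (c.continuousAt hcs).tendsto
        rwa [hcy] at this
      rw [mem_interior_iff_mem_nhds]
      filter_upwards [c.open_source.mem_nhds hcs, ht.eventually h0, ht.eventually hW] with x hx hx0 hxW
      rw [mem_preimage, hproj x hx]
      exact (hfS _ hxW.2).2 hx0
    rw [BlowUp.interior_preimage hL hS.1] at hpt
    exact hpt
  obtain ⟨V, h, hVo, hyV, hVW, hh, hiff⟩ := hF.exists_zero_iff_mem_closure hyj hne hW
  refine ⟨c.source ∩ c ⁻¹' V, c.isOpen_inter_preimage hVo,
    ⟨BlowUpPatch.point_mem_affineChart_source (P := P) hy, ?_⟩, fun x => h (c x), ?_, ?_⟩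
  · change c (P.point hy) ∈ V
    rw [show c (P.point hy) = y from BlowUpPatch.affineChart_point (P := P) hy]
    exact hyV
  · have h1 : ContMDiffOn 𝓘(ℂ, κ → ℂ) 𝓘(ℂ, ℂ) ω h V :=
      contMDiffOn_iff_contDiffOn.2 (hh.contDiffOn hVo.uniqueDiffOn)
    exact h1.comp ((isCoordinateChart_iff.1 (P.isCoordinateChart_affineChart _)).1.mono
      inter_subset_left) inter_subset_right
  · rintro x ⟨hx, hxV⟩
    let c' := c.trans (OpenPartialHomeomorph.ofSet V hVo)
    -- The proper inverse image is a closure in the blow up, the equation describes one in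
    -- coordinates. A chart restricted to the open set `V` exchanges the two.
    have him : c'.IsImage (BlowUp.proj κ L ⁻¹' (S \ L)) {w | w ∈ V ∧ w j ≠ 0 ∧ F w = 0} := by
      rintro z ⟨hz, hzV⟩
      have hzW := hVW hzV
      change c z ∈ V ∧ c z j ≠ 0 ∧ F (c z) = 0 ↔ BlowUp.proj κ L z ∈ S \ L
      rw [hproj z hz]
      have h2 : e.symm (blowDown κ J j (c z)) ∈ L ↔ c z j = 0 :=
        BlowUpPatch.along_mem_iff hJ hj hzW.1
      constructor
      · rintro ⟨-, ha, hb⟩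
        exact ⟨(hfS _ hzW.2).2 hb, fun hl => ha (h2.1 hl)⟩
      · rintro ⟨ha, hb⟩
        exact ⟨hzV, fun h0 => hb (h2.2 h0), (hfS _ hzW.2).1 ha⟩
    have h3 := him.closure (x := x) ⟨hx, hxV⟩
    exact h3.symm.trans (hiff _ hxV).symm

theorem isHypersurface_properInverseImage (hL : IsTrivialCenter κ N L) (hS : IsHypersurface κ S) :
    IsHypersurface κ (properInverseImage (BlowUp.proj κ L) L S) := by
  have hSc := hS.isClosed
  refine ⟨?_, fun o => ?_⟩
  · rw [← subset_empty_iff, ← BlowUp.interior_preimage (κ := κ) hL.1 hS.1]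
    exact interior_mono (properInverseImage_subset hSc)
  · by_cases ho : BlowUp.proj κ L o ∈ L
    · obtain ⟨e, I, J, he, hoe, -, -, hJ, -, -⟩ := hL.2 _ ho
      obtain ⟨j, hj, y, hy, rfl⟩ := BlowUp.exists_mk_along ho he hoe hJ
      exact exists_equation_properInverseImage hL.1 hS he hJ hj hy
        ((BlowUpPatch.along_mem_iff hJ hj hy).1 ho)
    · obtain ⟨U, hU, hoU, f, hf, hfS⟩ := hS.2 (BlowUp.proj κ L o)
      refine ⟨BlowUp.proj κ L ⁻¹' (U \ L), (hU.sdiff hL.1).preimage BlowUp.continuous_proj,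
        ⟨hoU, ho⟩, fun x => f (BlowUp.proj κ L x),
        hf.comp BlowUp.contMDiff_proj.contMDiffOn fun x hx => hx.1, fun x hx => ?_⟩
      rw [mem_properInverseImage_iff hSc hx.2]
      exact hfS _ hx.1

/-- A bad chart at a point of the proper inverse image may be centered on the exceptional divisor.
But its domain is open, so it also contains points of the inverse image of `S \ L`, and there `ρ`
carries the chart to one that contradicts naturality of `S`. -/
theorem isNatural_properInverseImage (hL : IsClosed L) (hS : IsHypersurface κ S)
    (hnat : IsNatural κ N S) :
    IsNatural κ (BlowUp.proj κ L ⁻¹' N) (properInverseImage (BlowUp.proj κ L) L S) := by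
  have hSc := hS.isClosed
  rintro o ho ⟨e, K, I, he, hoe, -, hK, hIK, hI, hIS⟩
  obtain ⟨z, hze, hzS, hzL⟩ := mem_closure_iff.1 ho _ e.open_source hoe
  obtain ⟨φ, hφ, hzφ, hφL, h⟩ := BlowUp.exists_isBiholomorphic hL hzL
  have he1 : IsCoordinateChart κ (φ.symm.trans e) := hφ.symm.isCoordinateChart_trans he
  have hφz : φ.symm (BlowUp.proj κ L z) = z := by rw [← h z hzφ, φ.left_inv hzφ]
  have hsource : ∀ x, x ∈ (φ.symm.trans e).source ↔ x ∈ φ.target ∧ φ.symm x ∈ e.source :=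
    fun _ => Iff.rfl
  have hz1 : BlowUp.proj κ L z ∈ (φ.symm.trans e).source := by
    refine (hsource _).2 ⟨?_, ?_⟩
    · rw [← h z hzφ]; exact φ.map_source hzφ
    · rw [hφz]; exact hze
  have hproj : ∀ x ∈ φ.target, BlowUp.proj κ L (φ.symm x) = x := fun x hx => by
    rw [← h _ (φ.map_target hx), φ.right_inv hx]
  have hK1 : IsCoordinateDivisor (φ.symm.trans e) K N := by
    intro x hx₀
    obtain ⟨hx, hx'⟩ := (hsource x).1 hx₀
    have h1 := hK _ hx'
    rw [mem_preimage, hproj x hx] at h1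
    exact h1
  -- Recentering discards the components of `N` that miss the new point. Those with index in `I`
  -- pass through it, since it lies on the proper inverse image, and are kept.
  obtain ⟨e', K', -, he', hz', hz0, hsub, hK', hKK', heq⟩ := hK1.exists_centered he1 hz1 Filter.univ_mem
  have hzI : ∀ i ∈ I, (φ.symm.trans e) (BlowUp.proj κ L z) i = 0 := by
    intro i hi
    change e (φ.symm (BlowUp.proj κ L z)) i = 0
    rw [hφz]
    exact (hIS z hze).1 (subset_closure ⟨hzS, hzL⟩) i hi
  refine hnat _ hzS ⟨e', K', I, he', hz', hz0, hK', fun i hi => hKK' i (hIK hi) (hzI i hi), hI, ?_⟩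
  intro x hx
  obtain ⟨hxt, hxe⟩ := (hsource x).1 (hsub hx).1
  have h1 := hIS _ hxe
  rw [mem_properInverseImage_iff hSc (hφL _ (φ.map_target hxt)), hproj x hxt] at h1
  rw [h1]
  exact forall₂_congr fun i hi => by rw [heq x i (hzI i hi)]; rfl

/-- Off the center the blow up is a local homeomorphism and commutes with closures. This turns the
proper inverse image of a conormal, which is a closure of covectors off `N`, into a single closure.
-/
theorem properInverseImage_closure (hL : IsClosed L) {A : Set M} (hA : Disjoint A L) :
    properInverseImage (BlowUp.proj κ L) L (closure A) = closure (BlowUp.proj κ L ⁻¹' A) := by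
  refine subset_antisymm (closure_minimal ?_ isClosed_closure)
    (closure_mono fun x hx => ⟨subset_closure hx, fun hl => hA.le_bot ⟨hx, hl⟩⟩)
  rintro x ⟨hx, hxL⟩
  obtain ⟨φ, -, hxφ, -, h⟩ := BlowUp.exists_isBiholomorphic hL hxL
  have him : φ.IsImage (BlowUp.proj κ L ⁻¹' A) A := fun z hz => by rw [h z hz]; rfl
  refine (him.closure hxφ).1 ?_
  rw [h x hxφ]
  exact hx

/-- Near `b` the map `ρ` is biholomorphic and takes the proper inverse image to `S`. The point `m`
is kept separate from `ρ b` so that the equality of base points given by `IsCorresponding` can be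
substituted. -/
theorem isConormalCovector_properInverseImage (hL : IsClosed L) (hS : IsClosed S) {b : BlowUp κ L}
    (hb : BlowUp.proj κ L b ∉ L) {m : M} (hm : m = BlowUp.proj κ L b) (β : (κ → ℂ) →L[ℂ] ℂ) :
    IsConormalCovector κ (properInverseImage (BlowUp.proj κ L) L S) b
      (β.comp (mfderiv 𝓘(ℂ, κ → ℂ) 𝓘(ℂ, κ → ℂ) (BlowUp.proj κ L) b : (κ → ℂ) →L[ℂ] (κ → ℂ))) ↔
      IsConormalCovector κ S m β := by
  obtain ⟨φ, hφ, hbφ, hφL, h⟩ := BlowUp.exists_isBiholomorphic hL hb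
  have h1 : mfderiv 𝓘(ℂ, κ → ℂ) 𝓘(ℂ, κ → ℂ) (BlowUp.proj κ L) b =
      mfderiv 𝓘(ℂ, κ → ℂ) 𝓘(ℂ, κ → ℂ) φ b :=
    (Filter.eventuallyEq_of_mem (φ.open_source.mem_nhds hbφ) fun z hz => (h z hz).symm).mfderiv_eq
  obtain rfl : m = φ b := hm.trans (h b hbφ).symm
  have h2 := hφ.isConormalCovector_comp_iff hbφ (S := properInverseImage (BlowUp.proj κ L) L S)
    (S' := S) (fun z hz => by rw [mem_properInverseImage_iff hS (hφL z hz), h z hz]) (β := β)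
  refine Iff.trans ?_ h2
  have h3 : (β.comp (mfderiv 𝓘(ℂ, κ → ℂ) 𝓘(ℂ, κ → ℂ) (BlowUp.proj κ L) b :
      (κ → ℂ) →L[ℂ] (κ → ℂ))) = β.comp (mfderiv 𝓘(ℂ, κ → ℂ) 𝓘(ℂ, κ → ℂ) φ b :
      (κ → ℂ) →L[ℂ] (κ → ℂ)) := congrArg (fun T : (κ → ℂ) →L[ℂ] (κ → ℂ) => β.comp T) h1
  exact iff_of_eq (congrArg (IsConormalCovector κ (properInverseImage (BlowUp.proj κ L) L S) b) h3)

/-- Both sides are closures of sets of covectors off `N`. The homeomorphism `Φ` commutes with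
closure, and matches the two sets because corresponding covectors are related by the derivative of
`ρ`, which preserves conormality off `L`. -/
theorem image_properInverseImage_conormal (hL : IsTrivialCenter κ N L) (hS : IsClosed S)
    {Φ : BlowUp (κ ⊕ κ) (LogCotangent.proj κ N ⁻¹' L)
      ≃ₘ^ω⟮𝓘(ℂ, κ ⊕ κ → ℂ), 𝓘(ℂ, κ ⊕ κ → ℂ)⟯ LogCotangent κ (BlowUp.proj κ L ⁻¹' N)}
    (h : ∀ x, IsCorresponding N L x (Φ x)) :
    Φ '' properInverseImage (BlowUp.proj (κ ⊕ κ) (LogCotangent.proj κ N ⁻¹' L))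
        (LogCotangent.proj κ N ⁻¹' L) (LogCotangent.conormal κ N S) =
      LogCotangent.conormal κ (BlowUp.proj κ L ⁻¹' N)
        (properInverseImage (BlowUp.proj κ L) L S) := by
  rw [LogCotangent.conormal, properInverseImage_closure
    (hL.1.preimage LogCotangent.continuous_proj)
    (Set.disjoint_left.2 fun p hp hl => hp.1 (hL.subset hl)), LogCotangent.conormal]
  refine (Φ.toHomeomorph.image_closure _).trans (congrArg closure ?_)
  rw [Φ.toHomeomorph.image_eq_preimage_symm]
  ext p
  obtain ⟨x, rfl⟩ := Φ.toHomeomorph.surjective p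
  rw [mem_preimage, Homeomorph.symm_apply_apply]
  have hb := (h x).1
  have hN : LogCotangent.proj κ N (BlowUp.proj (κ ⊕ κ) (LogCotangent.proj κ N ⁻¹' L) x) ∉ N ↔
      LogCotangent.proj κ (BlowUp.proj κ L ⁻¹' N) (Φ x) ∉ BlowUp.proj κ L ⁻¹' N := by
    rw [hb]; rfl
  have key : LogCotangent.proj κ (BlowUp.proj κ L ⁻¹' N) (Φ x) ∉ BlowUp.proj κ L ⁻¹' N →
      (IsConormalCovector κ S
        (LogCotangent.proj κ N (BlowUp.proj (κ ⊕ κ) (LogCotangent.proj κ N ⁻¹' L) x))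
        (LogCotangent.covector κ N (BlowUp.proj (κ ⊕ κ) (LogCotangent.proj κ N ⁻¹' L) x)) ↔
      IsConormalCovector κ (properInverseImage (BlowUp.proj κ L) L S)
        (LogCotangent.proj κ (BlowUp.proj κ L ⁻¹' N) (Φ x))
        (LogCotangent.covector κ (BlowUp.proj κ L ⁻¹' N) (Φ x))) := fun hx =>
    (isConormalCovector_properInverseImage hL.1 hS (fun hl => hx (hL.subset hl)) hb
      (LogCotangent.covector κ N
        (BlowUp.proj (κ ⊕ κ) (LogCotangent.proj κ N ⁻¹' L) x))).symm.trans
      (iff_of_eq (congrArg (IsConormalCovector κ (properInverseImage (BlowUp.proj κ L) L S)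
        (LogCotangent.proj κ (BlowUp.proj κ L ⁻¹' N) (Φ x))) ((h x).2 (hN.2 hx)).symm))
  exact ⟨fun hp => ⟨hN.1 hp.1, (key (hN.1 hp.1)).1 hp.2⟩,
    fun hp => ⟨hN.2 hp.1, (key hp.1).2 hp.2⟩⟩

end Hypersurfaces

end

theorem mainTheorem5 {n : ℕ} {M : Type*} [TopologicalSpace M] [T2Space M]
    [ChartedSpace (Fin n → ℂ) M] [IsManifold 𝓘(ℂ, Fin n → ℂ) ω M] (N L : Set M)
    (hN : IsNormalCrossings (Fin n) N) (hL : IsTrivialCenter (Fin n) N L)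
    -- the blow up `ρ` of `M` along `L`, and the inverse image of `N`
    (ρ : BlowUp (Fin n) L → M) (hρ : ρ = BlowUp.proj (Fin n) L)
    (N' : Set (BlowUp (Fin n) L)) (hN' : N' = ρ ⁻¹' N)
    -- the projections of the two logarithmic cotangent bundles
    (π : LogCotangent (Fin n) N → M) (hπ : π = LogCotangent.proj (Fin n) N)
    (π' : LogCotangent (Fin n) N' → BlowUp (Fin n) L) (hπ' : π' = LogCotangent.proj (Fin n) N')
    -- the center in the logarithmic cotangent bundle, and the blow up `τ` along it
    (C : Set (LogCotangent (Fin n) N)) (hC : C = π ⁻¹' L)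
    (τ : BlowUp (Fin n ⊕ Fin n) C → LogCotangent (Fin n) N)
    (hτ : τ = BlowUp.proj (Fin n ⊕ Fin n) C) :
    IsNormalCrossings (Fin n) N' ∧
    -- the blow up is a logarithmic symplectic manifold
    T2Space (BlowUp (Fin n ⊕ Fin n) C) ∧
    IsLogSymplecticPotential (Fin n ⊕ Fin n) (τ ⁻¹' (π ⁻¹' N))
      (pullbackForm (Fin n ⊕ Fin n) (Fin n ⊕ Fin n) τ (LogCotangent.canonicalForm (Fin n) N)) ∧
    -- it is isomorphic to the logarithmic cotangent bundle of the blow up of `M`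
    ∃ Φ : BlowUp (Fin n ⊕ Fin n) C
        ≃ₘ^ω⟮𝓘(ℂ, Fin n ⊕ Fin n → ℂ), 𝓘(ℂ, Fin n ⊕ Fin n → ℂ)⟯ LogCotangent (Fin n) N',
      (∀ x, π (τ x) = ρ (π' (Φ x))) ∧
      (∀ x, π (τ x) ∉ N → pullbackForm (Fin n ⊕ Fin n) (Fin n ⊕ Fin n) Φ (LogCotangent.canonicalForm (Fin n) N') x =
        pullbackForm (Fin n ⊕ Fin n) (Fin n ⊕ Fin n) τ (LogCotangent.canonicalForm (Fin n) N) x) ∧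
      (∀ (t : ℂ) (p q : LogCotangent (Fin n) N'), LogCotangent.IsMultiple (Fin n) N' t p q →
        LogCotangent.IsMultiple (Fin n) N t (τ (Φ.symm p)) (τ (Φ.symm q))) ∧
      -- conormals of natural hypersurfaces
      ∀ S : Set M, IsHypersurface (Fin n) S → IsNatural (Fin n) N S →
        IsHypersurface (Fin n) (properInverseImage ρ L S) ∧
        IsNatural (Fin n) N' (properInverseImage ρ L S) ∧
        Φ '' properInverseImage τ C (LogCotangent.conormal (Fin n) N S) =
          LogCotangent.conormal (Fin n) N' (properInverseImage ρ L S) := by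
  subst hρ hN' hπ hπ' hC hτ
  have i1 : T2Space (LogCotangent (Fin n) N) := LogCotangent.t2Space
  obtain ⟨Φ, h1, h2⟩ := exists_diffeomorph hN hL
  exact ⟨hL.isNormalCrossings_preimage hN, BlowUp.t2Space,
    IsCorresponding.isLogSymplecticPotential hN hL h1, Φ, fun x => (h1 x).1,
    fun x hx => IsCorresponding.pullbackForm_eq h1 hx,
    fun t p q h => IsCorresponding.isMultiple hN hL h2 h, fun S hS hnat =>
      ⟨isHypersurface_properInverseImage hL hS, isNatural_properInverseImage hL.1 hS hnat,
        image_properInverseImage_conormal hL hS.isClosed h1⟩⟩
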